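/- Let $n,p\ge 0$ be integers with $p\le n$, let $\Sigma\in\mathbb{R}^{(n+1)p\times(n+1)p}$ be symmetric positive definite with condition number $\kappa_\Sigma=\|\Sigma\|\,\|\Sigma^{-1}\|$ (spectral norm), let $\beta\in\mathbb{R}^p$ and $\sigma\ge 0$. Let $X\in\mathbb{R}^{(n+1)\times p}$ be a random matrix with rows $X_1,\dots,X_{n+1}$ and $\mathrm{vec}(X)\sim\mathcal N(0,\Sigma)$, and let $Y_k=X_k^\top\beta+\epsilon_k$ for $k=1,\dots,n+1$, where $\epsilon_1,\dots,\epsilon_{n+1}$ are i.i.d. $\mathcal N(0,\sigma^2)$ and independent of $X$. Put $Z=(Z_1,\dots,Z_{n+1})$ with $Z_k=(X_k,Y_k)$, and for $i\in\{1,\dots,n+1\}$ let $Z^i$ be $Z$ with the entries $Z_i$ and $Z_{n+1}$ exchanged ($Z^{n+1}=Z$). For a data set $z=((x_1,y_1),\dots,(x_{n+1},y_{n+1}))$ let $\widehat\mu(x)=x^\top(\mathbf{x}^\top \mathbf{x})^{-1}\mathbf{x}^\top y$ be the least squares fit to all $n+1$ points, where $\mathbf{x}$ is the matrix with rows $x_k$,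 and let $R_{\mathrm{fullCP}}(z)\in\mathbb{R}^{n+1}$ be the vector of full conformal residuals, read either as the signed residuals $y_k-\widehat\mu(x_k)$ or as the absolute residuals $|y_k-\widehat\mu(x_k)|$. Write $\mathsf d_{\mathsf{TV}}(U,V)=\sup_A|\mathbb P(U\in A)-\mathbb P(V\in A)|$ for the total variation distance between the laws of $U$ and $V$. Then, for every $i\in\{1,\dots,n+1\}$ and for both readings of $R_{\mathrm{fullCP}}$, $$\mathsf d_{\mathsf{TV}}\big(R_{\mathrm{fullCP}}(Z),R_{\mathrm{fullCP}}(Z^i)\big)\le \kappa_\Sigma\sqrt 8\cdot\frac{p}{\sqrt{n+1-p}}.$$ Moreover, this distance can be vanishingly small while $\mathsf d_{\mathsf{TV}}(Z,Z^i)$ is bounded away from zero. Take $p=1$, $|\gamma|<1$, and autoregressive covariates $X_1\sim\mathcal N(0,1)$, $X_{k+1}=\gamma X_k+\eta_{k+1}$, with $\eta_{k+1}\sim\mathcal N(0,1-\gamma^2)$ and $X_1,\eta_2,\dots,\eta_{n+1}$ independent; $Y$ is as above, for any $\beta$ and $\sigma\ge0$. There are a universal constant $c>0$ and, for each $\gamma$,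 a constant $C_\gamma$ depending only on $\gamma$ such that, for all $n$ and all $2\le i\le n$ (and both readings of $R_{\mathrm{fullCP}}$), $$\mathsf d_{\mathsf{TV}}(Z,Z^i)\ \ge\ \mathsf d_{\mathsf{TV}}\big(\mathcal N(0,1-\gamma^2),\,\mathcal N(0,1+\gamma^2-2\gamma^{n+3-i})\big)\ \ge\ c\,\gamma^2,\qquad \mathsf d_{\mathsf{TV}}\big(R_{\mathrm{fullCP}}(Z),R_{\mathrm{fullCP}}(Z^i)\big)\le \frac{C_\gamma}{\sqrt n}.$$ -/

import Mathlib

open MeasureTheory ProbabilityTheory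
open scoped NNReal Matrix

universe u

noncomputable section

namespace FullCP

/-- Total variation distance `sup_A |μ(A) - ν(A)|` over measurable `A`. -/
def tvDist {E : Type*} [MeasurableSpace E] (μ ν : Measure E) : ℝ :=
  ⨆ A : {A : Set E // MeasurableSet A}, |μ.real A.1 - ν.real A.1|

/-- Total variation distance between the laws of two random elements. -/
def tvDistLaw {Ω E : Type*} [MeasurableSpace Ω] [MeasurableSpace E] (P : Measure Ω)
    (U V : Ω → E) : ℝ :=
  tvDist (P.map U) (P.map V)

open scoped Matrix.Norms.L2Operator in
/-- Condition number `‖S‖ * ‖S⁻¹‖` for the spectral (Euclidean operator) norm. -/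
def condNumber {ι : Type*} [Fintype ι] [DecidableEq ι] (S : Matrix ι ι ℝ) : ℝ :=
  ‖S‖ * ‖S⁻¹‖

/-- A data set of `m` points `(x_k, y_k)` with `x_k ∈ ℝ^p` and `y_k ∈ ℝ`. -/
abbrev Dataset (m p : ℕ) : Type := Fin m → (Fin p → ℝ) × ℝ

/-- The `m × p` matrix whose rows are the covariates of the data set. -/
def designMatrix {m p : ℕ} (z : Dataset m p) : Matrix (Fin m) (Fin p) ℝ :=
  Matrix.of fun k => (z k).1

/-- The vector of responses of the data set. -/
def responses {m p : ℕ} (z : Dataset m p) : Fin m → ℝ := fun k => (z k).2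

/-- Least squares coefficients `(XᵀX)⁻¹ Xᵀ Y`. -/
def lsCoef {m p : ℕ} (z : Dataset m p) : Fin p → ℝ :=
  ((designMatrix z)ᵀ * designMatrix z)⁻¹ *ᵥ ((designMatrix z)ᵀ *ᵥ responses z)

/-- The least squares algorithm: it maps a data set to the fitted function
`x ↦ xᵀ (XᵀX)⁻¹ Xᵀ Y`. -/
def leastSquares {m p : ℕ} (z : Dataset m p) : (Fin p → ℝ) → ℝ :=
  fun x => x ⬝ᵥ lsCoef z

/-- Signed residuals `y_k - μ̂(x_k)`, with `μ̂` fitted by the algorithm `alg` to the whole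
data set. -/
def signedResiduals {m p : ℕ} (alg : Dataset m p → (Fin p → ℝ) → ℝ) (z : Dataset m p) :
    Fin m → ℝ :=
  fun k => (z k).2 - alg z (z k).1

/-- Full conformal residuals `|y_k - μ̂(x_k)|`, with `μ̂` fitted by the algorithm `alg` to the
whole data set. -/
def fullCPResiduals {m p : ℕ} (alg : Dataset m p → (Fin p → ℝ) → ℝ) (z : Dataset m p) :
    Fin m → ℝ :=
  fun k => |(z k).2 - alg z (z k).1|

/-- The data set `z^i`: the `i`-th point and the last point (the test point) are exchanged.
For `i = Fin.last n` this is `z` itself. -/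
def swapData {n p : ℕ} (i : Fin (n + 1)) (z : Dataset (n + 1) p) : Dataset (n + 1) p :=
  fun k => z (Equiv.swap i (Fin.last n) k)

/-- The random data set with points `(X_k, Y_k)`. -/
def dataset {Ω : Type*} {m p : ℕ} (X : Ω → Fin m → Fin p → ℝ) (Y : Ω → Fin m → ℝ) :
    Ω → Dataset m p :=
  fun ω k => (X ω k, Y ω k)

/-- The linear model `Y_k = X_kᵀ β + ε_k`, where the `ε_k` are i.i.d. `N(0, σ²)` and the vector
`ε` is independent of the covariates. -/
def IsLinearModel {Ω : Type*} [MeasurableSpace Ω] {m p : ℕ} (P : Measure Ω)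
    (X : Ω → Fin m → Fin p → ℝ) (Y : Ω → Fin m → ℝ) (β : Fin p → ℝ) (σ : ℝ≥0) : Prop :=
  ∃ ε : Ω → Fin m → ℝ,
    HasLaw ε (Measure.pi fun _ => gaussianReal 0 (σ ^ 2)) P ∧
    IndepFun X ε P ∧
    ∀ᵐ ω ∂P, ∀ k, Y ω k = X ω k ⬝ᵥ β + ε ω k

/-- Jointly Gaussian covariates: `vec(X) ~ N(0, S)`. -/
def HasGaussianCovariates {Ω : Type*} [MeasurableSpace Ω] {m p : ℕ} (P : Measure Ω)
    (X : Ω → Fin m → Fin p → ℝ) (S : Matrix (Fin p × Fin m) (Fin p × Fin m) ℝ) : Prop :=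
  HasLaw (fun ω => WithLp.toLp 2 (Matrix.vec (Matrix.of (X ω)))) (multivariateGaussian 0 S) P

/-- Scalar covariates (`p = 1`) from the stationary autoregressive model: `X_1 ~ N(0, 1)` and
`X_{k+1} = γ X_k + N(0, 1 - γ²)`, with the innovations independent of each other and of `X_1`. -/
def IsAutoregressive {Ω : Type*} [MeasurableSpace Ω] {n : ℕ} (P : Measure Ω)
    (X : Ω → Fin (n + 1) → Fin 1 → ℝ) (γ : ℝ) : Prop :=
  ∃ W : Fin (n + 1) → Ω → ℝ,
    iIndepFun W P ∧
    HasLaw (W 0) (gaussianReal 0 1) P ∧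
    (∀ k : Fin n, HasLaw (W k.succ) (gaussianReal 0 (Real.toNNReal (1 - γ ^ 2))) P) ∧
    ∀ᵐ ω ∂P, X ω 0 0 = W 0 ω ∧
      ∀ k : Fin n, X ω k.succ 0 = γ * X ω k.castSucc 0 + W k.succ ω

end FullCP

end

/-!
Total variation stability of least squares residuals under the exchange of two data points.

Let `x` be the columns of the design matrix. In the linear model the residual vector is `σ` times
the projection `r` of a standard Gaussian vector to the orthogonal complement of `x`
(`toLp_signedResiduals_eq_starProjection`, `signedResiduals_eq_residualVector`). Least squares is
symmetric, so exchanging two data points exchanges two coordinates of `r`, that is, applies the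
reflection along a unit vector `u` (`swapAxis`). Hence the laws of `r` and of its mirror image have
to be compared.

If the columns are standard Gaussian, the two laws agree, and more is true. For every `s` there is
a rotation `Q s` (`planeRotation`) in the plane of `u` and `s` which takes `s` to its mirror image,
and the map `(s, x) ↦ (mirror image of s, Q s x)` preserves the joint law of `(r, x)`
(`map_rotationMap_residual`). Indeed, for fixed `s` it acts by isometries, so it preserves the law
of an independent pair of standard Gaussians, also after conditioning on `s` lying in a thin slab
around the orthogonal complement of the columns; the joint law of `(r, x)` is the limit of these
conditioned laws as the slabs get thin (`tendsto_setAverage_slab`).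

If the columns have covariance `S`, their law has a density with respect to the standard Gaussian
law (`exists_stdGaussian_map_eq_withDensity`). By the invariance, the laws of `r` and of its mirror
image differ by at most the expectation of the positive part of the log-likelihood ratio between
`x` and `Q r x` (`residual_measure_le`). This ratio is a difference of values of the quadratic form
of the precision operator `S⁻¹` (`quadIncrement`). As `Q r` is an isometry, a multiple of the
identity may be subtracted from `S⁻¹`, which leaves an operator of norm at most
`(‖S⁻¹‖ - ‖S‖⁻¹) / 2` (`exists_norm_sub_smul_id_mul_le`). As the columns are orthogonal to `r`, the
rotation moves them by a shear only (`planeRotation_apply_of_inner_eq_zero`), and the difference is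
bounded by a quotient whose denominator is the squared norm of a Gaussian vector in dimension about
`n - p`, independent of the numerator. The inverse moment `lintegral_inv_sq_norm_stdGaussian` and
the second moments of the columns then give a bound of order `κ p √n / (n - p)`, which is below
the asserted one unless the latter is at least `1`, the trivial bound (`residual_bound_le`).

In the autoregressive model the statistic `X_i - γ X_{i-1}` is an innovation for the original data
and `X_{n+1} - γ X_{i-1}` for the exchanged data, which bounds the distance between the data sets
from below by the distance of two centred Gaussians on the line
(`tvDist_gaussianReal_le_tvDistLaw_dataset`); an interval separates these
(`mul_le_tvDist_gaussianReal`). The upper bound for the residuals is the first part for `p = 1`: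
the map from a path to its normalised innovations and its inverse are bounded in terms of `γ`, so
the condition numbers of the covariance matrices are bounded (`condNumber_whitening_le`).
-/

/-! ### Standard Gaussian measures -/

section StandardGaussian

variable {E : Type*} [NormedAddCommGroup E] [InnerProductSpace ℝ E] [FiniteDimensional ℝ E]
  [MeasurableSpace E] [BorelSpace E]

open Module in
theorem integral_exp_neg_mul_sq_norm_ofReal_eq {b : ℝ} (hb : 0 < b) :
    ∫⁻ x : E, ENNReal.ofReal (Real.exp (-b * ‖x‖ ^ 2)) =
      ENNReal.ofReal ((Real.pi / b) ^ (finrank ℝ E / 2 : ℝ)) := by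
  have h := GaussianFourier.integral_rexp_neg_mul_sq_norm (V := E) hb
  rw [← h, ofReal_integral_eq_lintegral_ofReal]
  · by_contra hcon
    rw [integral_undef hcon] at h
    exact absurd h (by positivity)
  · exact Filter.Eventually.of_forall fun x => by positivity

open Module in
/-- The standard Gaussian measure has the expected density with respect to Lebesgue measure. -/
theorem stdGaussian_eq_withDensity :
    stdGaussian E = volume.withDensity (fun x : E =>
      ENNReal.ofReal ((2 * Real.pi) ^ (-(finrank ℝ E / 2 : ℝ)) * Real.exp (-(1 / 2) * ‖x‖ ^ 2))) := by
  have hc : (0 : ℝ) ≤ (2 * Real.pi) ^ (-(finrank ℝ E / 2 : ℝ)) := by positivity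
  have hfin : IsFiniteMeasure (volume.withDensity (fun x : E =>
      ENNReal.ofReal ((2 * Real.pi) ^ (-(finrank ℝ E / 2 : ℝ)) *
        Real.exp (-(1 / 2) * ‖x‖ ^ 2)))) := by
    refine isFiniteMeasure_withDensity ?_
    simp_rw [ENNReal.ofReal_mul hc]
    rw [lintegral_const_mul _ (by fun_prop), integral_exp_neg_mul_sq_norm_ofReal_eq (by norm_num)]
    finiteness
  apply Measure.ext_of_charFun
  ext t
  rw [charFun_stdGaussian, charFun_apply,
    integral_withDensity_eq_integral_toReal_smul (by fun_prop) (by simp)]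
  have h := GaussianFourier.integral_cexp_neg_mul_sq_norm_add (V := E) (b := 1 / 2) (by norm_num)
    Complex.I t
  have e : ∀ x : E, (ENNReal.ofReal ((2 * Real.pi) ^ (-(finrank ℝ E / 2 : ℝ)) *
        Real.exp (-(1 / 2) * ‖x‖ ^ 2))).toReal • Complex.exp ((inner ℝ x t : ℝ) * Complex.I) =
      (((2 * Real.pi) ^ (-(finrank ℝ E / 2 : ℝ)) : ℝ) : ℂ) *
        Complex.exp (-(1 / 2) * ‖x‖ ^ 2 + Complex.I * (inner ℝ t x : ℝ)) := by
    intro x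
    rw [ENNReal.toReal_ofReal (by positivity), Complex.exp_add, real_inner_comm, mul_comm Complex.I]
    simp [Complex.ofReal_exp, mul_assoc]
  simp_rw [e]
  rw [integral_const_mul, h, ← mul_assoc]
  have e2 : (((2 * Real.pi) ^ (-(finrank ℝ E / 2 : ℝ)) : ℝ) : ℂ) *
      ((Real.pi : ℂ) / (1 / 2)) ^ ((finrank ℝ E : ℂ) / 2) = 1 := by
    have : ((Real.pi : ℂ) / (1 / 2)) ^ ((finrank ℝ E : ℂ) / 2) =
        (((2 * Real.pi) ^ (finrank ℝ E / 2 : ℝ) : ℝ) : ℂ) := by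
      rw [Complex.ofReal_cpow (by positivity)]
      push_cast
      congr 1
      ring
    rw [this, ← Complex.ofReal_mul, Real.rpow_neg (by positivity), inv_mul_cancel₀ (by positivity),
      Complex.ofReal_one]
  rw [e2, one_mul]
  congr 1
  rw [Complex.I_sq]
  ring

theorem stdGaussian_absolutelyContinuous : stdGaussian E ≪ (volume : Measure E) := by
  rw [stdGaussian_eq_withDensity]
  exact withDensity_absolutelyContinuous _ _

theorem volume_absolutelyContinuous_stdGaussian : (volume : Measure E) ≪ stdGaussian E := by
  rw [stdGaussian_eq_withDensity]
  refine withDensity_absolutelyContinuous' (by fun_prop) (Filter.Eventually.of_forall fun x => ?_)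
  simp only [ne_eq, ENNReal.ofReal_eq_zero, not_le]
  positivity

instance isOpenPosMeasure_stdGaussian : (stdGaussian E).IsOpenPosMeasure :=
  volume_absolutelyContinuous_stdGaussian.isOpenPosMeasure

theorem charFun_map_starProjection_stdGaussian (U : Submodule ℝ E) (t : E) :
    charFun ((stdGaussian E).map U.starProjection) t =
      Complex.exp (-‖U.starProjection t‖ ^ 2 / 2) := by
  rw [← charFun_stdGaussian, charFun_apply, charFun_apply, integral_map (by fun_prop)
    (by fun_prop)]
  simp_rw [Submodule.inner_starProjection_left_eq_right]

/-- The components of a standard Gaussian vector in a subspace and in its orthogonal complement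
are independent: a standard Gaussian vector has the law of `U.starProjection ε +
Uᗮ.starProjection ε'` with `ε` and `ε'` independent and standard Gaussian. -/
theorem stdGaussian_eq_map_prod_starProjection (U : Submodule ℝ E) :
    ((stdGaussian E).prod (stdGaussian E)).map
      (fun e => U.starProjection e.1 + Uᗮ.starProjection e.2) = stdGaussian E := by
  have : IsProbabilityMeasure ((stdGaussian E).map U.starProjection) :=
    Measure.isProbabilityMeasure_map (by fun_prop)
  have : IsProbabilityMeasure ((stdGaussian E).map Uᗮ.starProjection) :=
    Measure.isProbabilityMeasure_map (by fun_prop)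
  have h : ((stdGaussian E).prod (stdGaussian E)).map
      (fun e => U.starProjection e.1 + Uᗮ.starProjection e.2) =
      ((stdGaussian E).map U.starProjection).conv ((stdGaussian E).map Uᗮ.starProjection) := by
    rw [Measure.conv, Measure.map_prod_map _ _ (by fun_prop) (by fun_prop),
      Measure.map_map (by fun_prop) (by fun_prop)]
    rfl
  rw [h]
  apply Measure.ext_of_charFun
  ext t
  rw [charFun_conv, charFun_map_starProjection_stdGaussian, charFun_map_starProjection_stdGaussian,
    charFun_stdGaussian, ← Complex.exp_add]
  congr 1
  have := Submodule.norm_sq_eq_add_norm_sq_starProjection t U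
  rw [← Complex.ofReal_pow, ← Complex.ofReal_pow, ← Complex.ofReal_pow, this]
  push_cast
  ring

theorem lintegral_stdGaussian_eq_lintegral_lintegral (U : Submodule ℝ E) {f : E → ENNReal}
    (hf : Measurable f) :
    ∫⁻ e, f e ∂stdGaussian E =
      ∫⁻ e', ∫⁻ e, f (U.starProjection e + Uᗮ.starProjection e') ∂stdGaussian E ∂stdGaussian E := by
  conv_lhs => rw [← stdGaussian_eq_map_prod_starProjection U]
  rw [lintegral_map hf (by fun_prop), lintegral_prod_symm' _ (by fun_prop)]

theorem stdGaussian_map_orthogonalProjectionOnto (U : Submodule ℝ E) :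
    (stdGaussian E).map U.orthogonalProjectionOnto = stdGaussian U := by
  have : IsProbabilityMeasure ((stdGaussian E).map U.orthogonalProjectionOnto) :=
    Measure.isProbabilityMeasure_map (by fun_prop)
  apply Measure.ext_of_charFun
  ext t
  rw [charFun_stdGaussian, charFun_apply, integral_map (by fun_prop) (by fun_prop)]
  have h := charFun_stdGaussian (E := E) (t : E)
  rw [charFun_apply] at h
  simpa [Submodule.inner_starProjection_left_eq_right,
    Submodule.starProjection_eq_self_iff.2 t.2] using h

theorem lintegral_inner_sq_stdGaussian (a : E) :
    ∫⁻ x, ENNReal.ofReal (inner ℝ a x ^ 2) ∂stdGaussian E = ENNReal.ofReal (‖a‖ ^ 2) := by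
  have hmem : MemLp (innerSL ℝ a) 2 (stdGaussian E) := IsGaussian.memLp_dual _ _ _ (by simp)
  have h := variance_dual_stdGaussian (innerSL ℝ a)
  rw [variance_of_integral_eq_zero (by fun_prop)
    (integral_strongDual_stdGaussian (innerSL ℝ a))] at h
  rw [← ofReal_integral_eq_lintegral_ofReal]
  · congr 1
    simpa using h
  · simpa using hmem.integrable_sq
  · exact Filter.Eventually.of_forall fun x => by positivity

open Module in
theorem lintegral_exp_neg_mul_sq_norm_stdGaussian {b : ℝ} (hb : 0 ≤ b) :
    ∫⁻ x, ENNReal.ofReal (Real.exp (-b * ‖x‖ ^ 2)) ∂stdGaussian E =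
      ENNReal.ofReal ((1 + 2 * b) ^ (-(finrank ℝ E / 2 : ℝ))) := by
  rw [stdGaussian_eq_withDensity, lintegral_withDensity_eq_lintegral_mul _ (by fun_prop)
    (by fun_prop)]
  have hc : (0 : ℝ) ≤ (2 * Real.pi) ^ (-(finrank ℝ E / 2 : ℝ)) := by positivity
  have e : ∀ x : E, ((fun x : E => ENNReal.ofReal ((2 * Real.pi) ^ (-(finrank ℝ E / 2 : ℝ)) *
      Real.exp (-(1 / 2) * ‖x‖ ^ 2))) * fun x : E => ENNReal.ofReal (Real.exp (-b * ‖x‖ ^ 2))) x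
      = ENNReal.ofReal ((2 * Real.pi) ^ (-(finrank ℝ E / 2 : ℝ))) *
        ENNReal.ofReal (Real.exp (-(b + 1 / 2) * ‖x‖ ^ 2)) := by
    intro x
    simp only [Pi.mul_apply]
    rw [← ENNReal.ofReal_mul (by positivity), ← ENNReal.ofReal_mul (by positivity), mul_assoc,
      ← Real.exp_add]
    congr 3
    ring
  simp_rw [e]
  rw [lintegral_const_mul _ (by fun_prop), integral_exp_neg_mul_sq_norm_ofReal_eq (by linarith),
    ← ENNReal.ofReal_mul hc]
  congr 1
  rw [Real.rpow_neg (by positivity), Real.rpow_neg (by positivity), ← Real.inv_rpow (by positivity),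
    ← Real.inv_rpow (by positivity), ← Real.mul_rpow (by positivity) (by positivity)]
  congr 1
  field_simp
  ring

theorem lintegral_Ioi_one_add_two_mul_rpow {a : ℝ} (ha : 1 < a) :
    ∫⁻ b in Set.Ioi (0 : ℝ), ENNReal.ofReal ((1 + 2 * b) ^ (-a)) =
      ENNReal.ofReal (1 / (2 * (a - 1))) := by
  have hd : ∀ x ∈ Set.Ici (0 : ℝ), HasDerivAt (fun b : ℝ => -(1 + 2 * b) ^ (1 - a) / (2 * (a - 1)))
      ((1 + 2 * x) ^ (-a)) x := by
    intro x hx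
    have hx' : (0 : ℝ) ≤ x := hx
    have h1 : HasDerivAt (fun b : ℝ => 1 + 2 * b) 2 x := by
      simpa using ((hasDerivAt_id x).const_mul 2).const_add 1
    have h2 := (h1.rpow_const (p := 1 - a) (Or.inl (by positivity))).neg.div_const (2 * (a - 1))
    refine h2.congr_deriv ?_
    rw [show 1 - a - 1 = -a by ring]
    have : a - 1 ≠ 0 := by linarith
    field_simp
    ring
  have hlim : Filter.Tendsto (fun b : ℝ => -(1 + 2 * b) ^ (1 - a) / (2 * (a - 1))) Filter.atTop
      (nhds 0) := by
    have h1 : Filter.Tendsto (fun b : ℝ => 1 + 2 * b) Filter.atTop Filter.atTop :=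
      Filter.tendsto_atTop_add_const_left _ _ (Filter.tendsto_id.const_mul_atTop (by norm_num))
    have h2 := (tendsto_rpow_neg_atTop (y := a - 1) (by linarith)).comp h1
    simpa [neg_sub] using h2.neg.div_const (2 * (a - 1))
  have hpos : ∀ x ∈ Set.Ioi (0 : ℝ), 0 ≤ (1 + 2 * x) ^ (-a) := by
    intro x hx
    have hx' : (0 : ℝ) < x := hx
    positivity
  have hint := integral_Ioi_of_hasDerivAt_of_nonneg' hd hpos hlim
  have hint' := integrableOn_Ioi_deriv_of_nonneg' hd hpos hlim
  rw [← ofReal_integral_eq_lintegral_ofReal hint', hint]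
  · congr 1
    simp [neg_div]
  · exact (ae_restrict_iff' measurableSet_Ioi).2 (Filter.Eventually.of_forall hpos)

open Module in
/-- The inverse second moment of a standard Gaussian vector in dimension `k ≥ 3` is `1 / (k - 2)`:
write `‖x‖⁻² = ∫ exp (-b ‖x‖²) db` and integrate over `x` first. -/
theorem lintegral_inv_sq_norm_stdGaussian (hk : 3 ≤ finrank ℝ E) :
    ∫⁻ x, (ENNReal.ofReal (‖x‖ ^ 2))⁻¹ ∂stdGaussian E =
      ENNReal.ofReal (1 / (finrank ℝ E - 2)) := by
  have hk' : (3 : ℝ) ≤ finrank ℝ E := by exact_mod_cast hk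
  have : Nontrivial E := Module.nontrivial_of_finrank_pos (R := ℝ) (by omega)
  have h0 : ∀ᵐ x ∂stdGaussian E, x ≠ 0 :=
    stdGaussian_absolutelyContinuous (Measure.ae_ne volume (0 : E))
  have h1 : ∀ᵐ x ∂stdGaussian E, (ENNReal.ofReal (‖x‖ ^ 2))⁻¹ =
      ∫⁻ b in Set.Ioi (0 : ℝ), ENNReal.ofReal (Real.exp (-b * ‖x‖ ^ 2)) := by
    filter_upwards [h0] with x hx
    have hx2 : 0 < ‖x‖ ^ 2 := by positivity
    have hI := integral_exp_mul_Ioi (a := -‖x‖ ^ 2) (by linarith) 0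
    have hI' := integrableOn_exp_mul_Ioi (a := -‖x‖ ^ 2) (by linarith) 0
    rw [← ENNReal.ofReal_inv_of_pos hx2]
    have e : ∀ b : ℝ, -b * ‖x‖ ^ 2 = -‖x‖ ^ 2 * b := fun b => by ring
    simp_rw [e]
    rw [← ofReal_integral_eq_lintegral_ofReal hI' (Filter.Eventually.of_forall fun b => by positivity),
      hI]
    congr 1
    simp
  rw [lintegral_congr_ae h1, lintegral_lintegral_swap (by fun_prop)]
  have h2 : ∀ b ∈ Set.Ioi (0 : ℝ),
      ∫⁻ x, ENNReal.ofReal (Real.exp (-b * ‖x‖ ^ 2)) ∂stdGaussian E =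
      ENNReal.ofReal ((1 + 2 * b) ^ (-(finrank ℝ E / 2 : ℝ))) := fun b hb =>
    lintegral_exp_neg_mul_sq_norm_stdGaussian (le_of_lt hb)
  rw [setLIntegral_congr_fun measurableSet_Ioi h2,
    lintegral_Ioi_one_add_two_mul_rpow (by linarith)]
  congr 2
  ring

end StandardGaussian

/-! ### Conditioning on thin slabs -/

section Slab

variable {F : Type*} [NormedAddCommGroup F] [InnerProductSpace ℝ F]

/-- The slab of all vectors whose inner products with the `x j` are at most `η` in absolute
value: a neighbourhood of the orthogonal complement of the span of the `x j`. -/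
def slab {ι : Type*} (x : ι → F) (η : ℝ) : Set F := {s | ∀ j, |inner ℝ (x j) s| ≤ η}

/-- The inner products with the `x j` determine the component in the span of the `x j`, with a bounded
inverse: the slab is thin in the directions of the span. -/
theorem exists_norm_starProjection_le_of_mem_slab [FiniteDimensional ℝ F] {ι : Type*} [Fintype ι]
    (x : ι → F) :
    ∃ C : ℝ, 0 < C ∧ ∀ η, 0 ≤ η → ∀ s ∈ slab x η,
      ‖(Submodule.span ℝ (Set.range x)).starProjection s‖ ≤ C * η := by
  set K := Submodule.span ℝ (Set.range x) with hK
  have hx : ∀ j, x j ∈ K := fun j => Submodule.subset_span ⟨j, rfl⟩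
  -- `T` records the inner products with the `x j`; it is injective on their span
  let T : K →ₗ[ℝ] (ι → ℝ) := LinearMap.pi fun j => (innerₗ F (x j)) ∘ₗ K.subtype
  have hT : T.ker = ⊥ := by
    rw [LinearMap.ker_eq_bot']
    intro u hu
    have h0 : ∀ j, inner ℝ (x j) (u : F) = 0 := fun j => congrFun hu j
    have h1 : (u : F) ∈ Kᗮ := by
      rw [Submodule.mem_orthogonal]
      intro w hw
      induction hw using Submodule.span_induction with
      | mem w hw => obtain ⟨j, rfl⟩ := hw; exact h0 j
      | zero => simp
      | add a b _ _ ha hb => rw [inner_add_left, ha, hb, add_zero]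
      | smul c a _ ha => rw [inner_smul_left, ha, mul_zero]
    have h2 : inner ℝ (u : F) (u : F) = 0 := (Submodule.mem_orthogonal _ _).1 h1 _ u.2
    simpa using h2
  obtain ⟨C, hC, hanti⟩ := T.exists_antilipschitzWith hT
  refine ⟨C, by exact_mod_cast hC, fun η hη s hs => ?_⟩
  have h := hanti.le_mul_dist (K.orthogonalProjectionOnto s) 0
  rw [map_zero, dist_zero_right, dist_zero_right] at h
  refine le_trans (le_of_eq ?_) (h.trans (mul_le_mul_of_nonneg_left ?_ C.2))
  · simp
  · rw [pi_norm_le_iff_of_nonneg hη]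
    intro j
    have : T (K.orthogonalProjectionOnto s) j = inner ℝ (x j) s := by
      change inner ℝ (x j) (K.starProjection s) = _
      rw [← Submodule.inner_starProjection_left_eq_right,
        Submodule.starProjection_eq_self_iff.2 (hx j)]
    rw [this, Real.norm_eq_abs]
    exact hs j

theorem isClosed_slab {ι : Type*} (x : ι → F) (η : ℝ) : IsClosed (slab x η) := by
  have : slab x η = ⋂ j, {s | |inner ℝ (x j) s| ≤ η} := by ext; simp [slab]
  rw [this]
  exact isClosed_iInter fun j => isClosed_le (by fun_prop) continuous_const

theorem slab_mem_nhds_zero {ι : Type*} [Finite ι] (x : ι → F) {η : ℝ} (hη : 0 < η) :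
    slab x η ∈ nhds (0 : F) := by
  have : slab x η = ⋂ j, {s | |inner ℝ (x j) s| ≤ η} := by ext; simp [slab]
  rw [this, Filter.iInter_mem]
  intro j
  have hc : ContinuousAt (fun s : F => |inner ℝ (x j) s|) 0 := by fun_prop
  exact hc.eventually_le_const (by simpa using hη)

variable [FiniteDimensional ℝ F] [MeasurableSpace F] [BorelSpace F]

theorem stdGaussian_real_slab_pos {ι : Type*} [Finite ι] (x : ι → F) {η : ℝ} (hη : 0 < η) :
    0 < (stdGaussian F).real (slab x η) :=
  ENNReal.toReal_pos (Measure.measure_pos_of_mem_nhds _ (slab_mem_nhds_zero x hη)).ne'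
    (by finiteness)

open Filter Topology in
/-- Conditionally on lying in a thin slab around the orthogonal complement of the span of the
`x j`, a standard Gaussian vector is close in law to its projection to this complement: the
component in the span tends to `0` and is independent of the component in the complement. -/
theorem tendsto_setAverage_slab {ι : Type*} [Fintype ι] (x : ι → F) {f : F → ℝ} (hf : Measurable f)
    {C : ℝ} (hC : ∀ s, |f s| ≤ C)
    (hcont : ∀ᵐ e ∂stdGaussian F,
      ContinuousAt f ((Submodule.span ℝ (Set.range x))ᗮ.starProjection e)) :
    Tendsto (fun η => ⨍ s in slab x η, f s ∂stdGaussian F) (𝓝[>] 0)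
      (𝓝 (∫ e, f ((Submodule.span ℝ (Set.range x))ᗮ.starProjection e) ∂stdGaussian F)) := by
  set K := Submodule.span ℝ (Set.range x) with hK
  have hx : ∀ j, x j ∈ K := fun j => Submodule.subset_span ⟨j, rfl⟩
  -- `H u` averages `f` over the component in `Kᗮ`, the component in `K` being frozen at `u`
  set H : F → ℝ := fun u => ∫ e, f (u + Kᗮ.starProjection e) ∂stdGaussian F with hH
  have hHm : StronglyMeasurable H :=
    StronglyMeasurable.integral_prod_right (f := fun u e => f (u + Kᗮ.starProjection e))
      (hf.comp (by fun_prop)).stronglyMeasurable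
  have hHC : ∀ u, |H u| ≤ C := fun u => by
    have := norm_integral_le_of_norm_le_const (μ := stdGaussian F)
      (f := fun e => f (u + Kᗮ.starProjection e)) (C := C)
      (Eventually.of_forall fun e => hC _)
    simpa only [probReal_univ, mul_one, Real.norm_eq_abs] using this
  have hmem : ∀ e e' : F, ∀ η, K.starProjection e + Kᗮ.starProjection e' ∈ slab x η ↔
      e ∈ slab x η := by
    intro e e' η
    have : ∀ j, inner ℝ (x j) (K.starProjection e + Kᗮ.starProjection e') = inner ℝ (x j) e := by
      intro j
      rw [inner_add_right, ← Submodule.inner_starProjection_left_eq_right,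
        Submodule.starProjection_eq_self_iff.2 (hx j),
        (Submodule.mem_orthogonal _ _).1 (Submodule.starProjection_apply_mem Kᗮ e') _ (hx j),
        add_zero]
    simp only [slab, Set.mem_ofPred_eq, this]
  have hslab : ∀ η, ∫ s in slab x η, f s ∂stdGaussian F =
      ∫ s in slab x η, H (K.starProjection s) ∂stdGaussian F := by
    intro η
    have hms := (isClosed_slab x η).measurableSet
    have hgm : Measurable ((slab x η).indicator f) := hf.indicator hms
    rw [← integral_indicator hms, ← integral_indicator hms]
    conv_lhs => rw [← stdGaussian_eq_map_prod_starProjection K]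
    rw [integral_map (by fun_prop) hgm.aestronglyMeasurable, integral_prod]
    · congr 1
      ext e
      by_cases he : e ∈ slab x η
      · rw [Set.indicator_of_mem he]
        simp_rw [hH, Set.indicator_of_mem ((hmem e _ η).2 he)]
      · rw [Set.indicator_of_notMem he]
        simp_rw [Set.indicator_of_notMem (mt (hmem e _ η).1 he), integral_zero]
    · refine Integrable.of_bound (C := C) (hgm.comp (by fun_prop)).aestronglyMeasurable
        (Eventually.of_forall fun e => ?_)
      exact (norm_indicator_le_norm_self _ _).trans (hC _)
  -- `H` need not be continuous elsewhere: `f` is continuous only at almost every point of `Kᗮ`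
  have hlim : Tendsto H (𝓝 0) (𝓝 (H 0)) := by
    refine tendsto_integral_filter_of_dominated_convergence (fun _ => C) ?_ ?_
      (integrable_const C) ?_
    · exact Eventually.of_forall fun u => (hf.comp (by fun_prop)).aestronglyMeasurable
    · exact Eventually.of_forall fun u => Eventually.of_forall fun e => hC _
    · filter_upwards [hcont] with e he
      have h1 : Tendsto (fun u : F => u + Kᗮ.starProjection e) (𝓝 0)
          (𝓝 (0 + Kᗮ.starProjection e)) := (continuous_add_const _).tendsto 0
      rw [zero_add] at h1 ⊢
      exact he.tendsto.comp h1
  have hH0 : H 0 = ∫ e, f (Kᗮ.starProjection e) ∂stdGaussian F := by simp [hH]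
  rw [← hH0]
  obtain ⟨c, hc, hcb⟩ := exists_norm_starProjection_le_of_mem_slab x
  rw [Metric.tendsto_nhds]
  intro t ht
  obtain ⟨δ, hδ, hδt⟩ := Metric.tendsto_nhds_nhds.1 hlim (t / 2) (by positivity)
  have hev : ∀ᶠ η : ℝ in 𝓝[>] 0, η < δ / c :=
    nhdsWithin_le_nhds (eventually_lt_nhds (by positivity))
  filter_upwards [hev, self_mem_nhdsWithin] with η hη1 hη
  have hη0 : 0 < η := hη
  have hpos := stdGaussian_real_slab_pos x hη0
  have hclose : ∀ s ∈ slab x η, ‖H (K.starProjection s) - H 0‖ ≤ t / 2 := by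
    intro s hs
    refine (hδt ?_).le
    rw [dist_zero_right]
    refine (hcb η hη0.le s hs).trans_lt ?_
    rwa [lt_div_iff₀ hc, mul_comm] at hη1
  have hint : IntegrableOn (fun s => H (K.starProjection s)) (slab x η) (stdGaussian F) :=
    Integrable.of_bound (C := C) (hHm.comp_measurable (by fun_prop)).aestronglyMeasurable
      (Eventually.of_forall fun e => hHC _)
  have hb := norm_setIntegral_le_of_norm_le_const (μ := stdGaussian F) (by finiteness) hclose
  rw [integral_sub hint (integrable_const _), setIntegral_const, ← hslab, smul_eq_mul] at hb
  rw [setAverage_eq, smul_eq_mul, Real.dist_eq]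
  set m := (stdGaussian F).real (slab x η)
  set I := ∫ s in slab x η, f s ∂stdGaussian F
  have : m⁻¹ * I - H 0 = m⁻¹ * (I - m * H 0) := by field_simp
  rw [this, abs_mul, abs_of_pos (inv_pos.2 hpos)]
  calc m⁻¹ * |I - m * H 0| ≤ m⁻¹ * (t / 2 * m) := by gcongr; exact hb
    _ = t / 2 := by field_simp
    _ < t := by linarith

end Slab

/-! ### The rotation of a vector to its mirror image -/

section Rotation

variable {F : Type*} [NormedAddCommGroup F] [InnerProductSpace ℝ F]

/-- The component of `s` orthogonal to the unit vector `u`. -/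
noncomputable def perpPart (u s : F) : F := s - inner ℝ u s • u

/-- A vector in the plane of `u` and `s` which is orthogonal to `s`. -/
noncomputable def rotAxis (u s : F) : F := ‖perpPart u s‖ ^ 2 • u - inner ℝ u s • perpPart u s

theorem reflection_orthogonal_singleton_apply (q y : F) :
    (ℝ ∙ q)ᗮ.reflection y = y - (2 * (inner ℝ q y / ‖q‖ ^ 2)) • q := by
  rw [Submodule.reflection_orthogonal_apply, Submodule.reflection_singleton_apply]
  simp only [RCLike.ofReal_real_eq_id, id_eq, neg_sub, mul_smul, ofNat_smul_eq_nsmul]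

/-- For a unit vector `u`, the rotation in the plane of `u` and `s` which maps `s` to its mirror
image `(ℝ ∙ u)ᗮ.reflection s`. It is the product of the reflections along `rotAxis u s`, which
fixes `s`, and along `u`. -/
noncomputable def planeRotation (u s : F) : F ≃ₗᵢ[ℝ] F :=
  ((ℝ ∙ rotAxis u s)ᗮ.reflection).trans (ℝ ∙ u)ᗮ.reflection

theorem inner_perpPart {u : F} (hu : ‖u‖ = 1) (s : F) : inner ℝ u (perpPart u s) = 0 := by
  simp [perpPart, inner_sub_right, inner_smul_right, hu]

theorem inner_rotAxis_self {u : F} (hu : ‖u‖ = 1) (s : F) : inner ℝ (rotAxis u s) s = 0 := by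
  have h1 : inner ℝ (perpPart u s) s = ‖perpPart u s‖ ^ 2 := by
    have h : inner ℝ (perpPart u s) s = inner ℝ (perpPart u s) (inner ℝ u s • u + perpPart u s) := by
      congr 1
      simp [perpPart]
    rw [h, inner_add_right, inner_smul_right, real_inner_comm u, inner_perpPart hu,
      real_inner_self_eq_norm_sq, mul_zero, zero_add]
  rw [rotAxis, inner_sub_left, inner_smul_left, inner_smul_left, h1]
  simp
  ring

theorem planeRotation_apply_self {u : F} (hu : ‖u‖ = 1) (s : F) :
    planeRotation u s s = (ℝ ∙ u)ᗮ.reflection s := by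
  simp [planeRotation, reflection_orthogonal_singleton_apply (rotAxis u s), inner_rotAxis_self hu]

theorem inner_reflection_orthogonal_singleton {u : F} (hu : ‖u‖ = 1) (s : F) :
    inner ℝ u ((ℝ ∙ u)ᗮ.reflection s) = -inner ℝ u s := by
  rw [reflection_orthogonal_singleton_apply, inner_sub_right, inner_smul_right]
  simp [hu]
  ring

theorem perpPart_reflection {u : F} (hu : ‖u‖ = 1) (s : F) :
    perpPart u ((ℝ ∙ u)ᗮ.reflection s) = perpPart u s := by
  rw [perpPart, inner_reflection_orthogonal_singleton hu, reflection_orthogonal_singleton_apply,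
    perpPart, hu]
  module

theorem reflection_rotAxis {u : F} (hu : ‖u‖ = 1) (s : F) :
    rotAxis u ((ℝ ∙ u)ᗮ.reflection s) = -(ℝ ∙ u)ᗮ.reflection (rotAxis u s) := by
  have h1 : (ℝ ∙ u)ᗮ.reflection u = -u :=
    Submodule.reflection_orthogonalComplement_singleton_eq_neg u
  have h2 : (ℝ ∙ u)ᗮ.reflection (perpPart u s) = perpPart u s := by
    rw [reflection_orthogonal_singleton_apply, inner_perpPart hu]
    simp
  conv_rhs => rw [rotAxis, map_sub, map_smul, map_smul, h1, h2]
  rw [rotAxis, perpPart_reflection hu, inner_reflection_orthogonal_singleton hu]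
  module

/-- The rotation attached to the mirror image of `s` undoes the rotation attached to `s`, so that
`rotationMap` is an involution. -/
theorem planeRotation_reflection_apply {u : F} (hu : ‖u‖ = 1) (s y : F) :
    planeRotation u ((ℝ ∙ u)ᗮ.reflection s) (planeRotation u s y) = y := by
  have h : ∀ z, (ℝ ∙ rotAxis u ((ℝ ∙ u)ᗮ.reflection s))ᗮ.reflection ((ℝ ∙ u)ᗮ.reflection z) =
      (ℝ ∙ u)ᗮ.reflection ((ℝ ∙ rotAxis u s)ᗮ.reflection z) := by
    intro z
    rw [reflection_rotAxis hu, reflection_orthogonal_singleton_apply (-_),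
      reflection_orthogonal_singleton_apply (rotAxis u s), map_sub, map_smul, inner_neg_left,
      LinearIsometryEquiv.inner_map_map, norm_neg, LinearIsometryEquiv.norm_map]
    rw [neg_div, mul_neg, smul_neg, neg_smul, neg_neg]
  simp [planeRotation, h]

/-- On the orthogonal complement of `s` the rotation acts as a shear along the component of `s`
orthogonal to `u`. -/
theorem planeRotation_apply_of_inner_eq_zero {u s y : F} (hu : ‖u‖ = 1)
    (hs : perpPart u s ≠ 0) (hy : inner ℝ s y = 0) :
    planeRotation u s y =
      y + (2 * inner ℝ u s / ‖perpPart u s‖ ^ 2 * inner ℝ u y) • perpPart u s := by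
  have hn : ‖perpPart u s‖ ^ 2 ≠ 0 := by positivity
  have hn' : ‖perpPart u s‖ ≠ 0 := by positivity
  have h0 : inner ℝ (perpPart u s) y = -(inner ℝ u s * inner ℝ u y) := by
    rw [perpPart, inner_sub_left, hy, inner_smul_left]
    simp
  have h1 : inner ℝ (rotAxis u s) y =
      inner ℝ u y * (‖perpPart u s‖ ^ 2 + inner ℝ u s ^ 2) := by
    rw [rotAxis, inner_sub_left, inner_smul_left, inner_smul_left, h0]
    simp
    ring
  have h2 : ‖rotAxis u s‖ ^ 2 =
      ‖perpPart u s‖ ^ 2 * (‖perpPart u s‖ ^ 2 + inner ℝ u s ^ 2) := by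
    rw [rotAxis, norm_sub_sq_real, inner_smul_left, inner_smul_right, inner_perpPart hu, norm_smul,
      norm_smul, hu]
    simp
    rw [mul_pow, sq_abs]
    ring
  have hpos : 0 < ‖perpPart u s‖ ^ 2 + inner ℝ u s ^ 2 := by positivity
  have h3 : inner ℝ (rotAxis u s) y / ‖rotAxis u s‖ ^ 2 = inner ℝ u y / ‖perpPart u s‖ ^ 2 := by
    rw [h1, h2]
    field_simp
  have h4 : (ℝ ∙ rotAxis u s)ᗮ.reflection y = y - (2 * inner ℝ u y) • u +
      (2 * inner ℝ u s / ‖perpPart u s‖ ^ 2 * inner ℝ u y) • perpPart u s := by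
    rw [reflection_orthogonal_singleton_apply, h3, rotAxis, smul_sub, smul_smul, smul_smul]
    have e : 2 * (inner ℝ u y / ‖perpPart u s‖ ^ 2) * ‖perpPart u s‖ ^ 2 = 2 * inner ℝ u y := by
      field_simp
    rw [e, sub_sub_eq_add_sub, add_sub_right_comm]
    congr 2
    ring
  rw [planeRotation, LinearIsometryEquiv.trans_apply, h4, reflection_orthogonal_singleton_apply u]
  simp only [inner_add_right, inner_sub_right, inner_smul_right, inner_perpPart hu,
    real_inner_self_eq_norm_sq, hu]
  module

theorem planeRotation_apply (u s y : F) :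
    planeRotation u s y = (y - (2 * (inner ℝ (rotAxis u s) y / ‖rotAxis u s‖ ^ 2)) • rotAxis u s) -
      (2 * (inner ℝ u (y - (2 * (inner ℝ (rotAxis u s) y / ‖rotAxis u s‖ ^ 2)) • rotAxis u s)
        / ‖u‖ ^ 2)) • u := by
  rw [planeRotation, LinearIsometryEquiv.trans_apply, reflection_orthogonal_singleton_apply,
    reflection_orthogonal_singleton_apply]

theorem continuous_rotAxis (u : F) : Continuous (rotAxis u) := by
  unfold rotAxis perpPart
  fun_prop

theorem rotAxis_ne_zero {u s : F} (hu : ‖u‖ = 1) (hs : perpPart u s ≠ 0) : rotAxis u s ≠ 0 := by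
  intro h
  have h1 : inner ℝ u (rotAxis u s) = ‖perpPart u s‖ ^ 2 := by
    rw [rotAxis, inner_sub_right, inner_smul_right, inner_smul_right, inner_perpPart hu,
      real_inner_self_eq_norm_sq, hu]
    simp
  rw [h, inner_zero_right] at h1
  have : ‖perpPart u s‖ ^ 2 ≠ 0 := by positivity
  exact this h1.symm

theorem continuousAt_planeRotation {u s : F} (hu : ‖u‖ = 1) (hs : perpPart u s ≠ 0) (y : F) :
    ContinuousAt (fun s => planeRotation u s y) s := by
  simp_rw [planeRotation_apply]
  have h1 := (continuous_rotAxis u).continuousAt (x := s)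
  have h2 : ‖rotAxis u s‖ ^ 2 ≠ 0 := by
    have := rotAxis_ne_zero hu hs
    positivity
  fun_prop (disch := assumption)

theorem measurable_planeRotation [FiniteDimensional ℝ F] [MeasurableSpace F] [BorelSpace F]
    (u : F) : Measurable fun z : F × F => planeRotation u z.1 z.2 := by
  simp_rw [planeRotation_apply]
  have h1 := (continuous_rotAxis u).measurable
  fun_prop

theorem isClosed_prod_slab {κ : Type*} (η : ℝ) :
    IsClosed {z : F × PiLp 2 (fun _ : κ => F) | z.1 ∈ slab z.2 η} := by
  have : {z : F × PiLp 2 (fun _ : κ => F) | z.1 ∈ slab z.2 η} =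
      ⋂ j, {z | |inner ℝ (z.2 j) z.1| ≤ η} := by ext; simp [slab]
  rw [this]
  exact isClosed_iInter fun j => isClosed_le (by fun_prop) continuous_const

end Rotation

/-! ### Rotating the columns of a matrix -/

section Columns

variable {ι : Type*} [Fintype ι] {F : Type*} [NormedAddCommGroup F] [InnerProductSpace ℝ F]

/-- The isometry of the space of `ι`-tuples of vectors (the columns of a matrix) which applies `Q`
to each vector. -/
noncomputable abbrev columnwise (ι : Type*) [Fintype ι] (Q : F ≃ₗᵢ[ℝ] F) :
    PiLp 2 (fun _ : ι => F) ≃ₗᵢ[ℝ] PiLp 2 (fun _ : ι => F) :=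
  LinearIsometryEquiv.piLpCongrRight 2 fun _ => Q

/-- The map which rotates the columns `z.2` by `planeRotation u z.1` and thereby takes `z.1` to its
mirror image. -/
noncomputable def rotationMap (ι : Type*) [Fintype ι] (u : F) (z : F × PiLp 2 (fun _ : ι => F)) :
    F × PiLp 2 (fun _ : ι => F) :=
  ((ℝ ∙ u)ᗮ.reflection z.1, columnwise ι (planeRotation u z.1) z.2)

theorem slab_columnwise (Q : F ≃ₗᵢ[ℝ] F) (x : PiLp 2 (fun _ : ι => F)) (η : ℝ) (s : F) :
    Q s ∈ slab (columnwise ι Q x) η ↔ s ∈ slab x η := by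
  simp [slab]

variable [FiniteDimensional ℝ F] [MeasurableSpace F] [BorelSpace F]

theorem stdGaussian_slab_columnwise (Q : F ≃ₗᵢ[ℝ] F) (x : PiLp 2 (fun _ : ι => F)) (η : ℝ) :
    stdGaussian F (slab (columnwise ι Q x) η) = stdGaussian F (slab x η) := by
  conv_lhs => rw [← stdGaussian_map Q]
  rw [Measure.map_apply (by fun_prop) (isClosed_slab _ _).measurableSet]
  congr 1
  ext s
  exact slab_columnwise Q x η s

theorem measurable_rotationMap (u : F) : Measurable (rotationMap ι u) := by
  have h : Measurable fun z : F × PiLp 2 (fun _ : ι => F) =>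
      columnwise ι (planeRotation u z.1) z.2 := by
    refine (PiLp.continuous_toLp 2 _).measurable.comp (measurable_pi_lambda _ fun j => ?_)
    exact (measurable_planeRotation u).comp (g := fun z : F × F => planeRotation u z.1 z.2)
      (f := fun z : F × PiLp 2 (fun _ : ι => F) => (z.1, z.2 j)) (by fun_prop)
  exact (by fun_prop : Measurable fun z : F × PiLp 2 (fun _ : ι => F) =>
    (ℝ ∙ u)ᗮ.reflection z.1).prodMk h

/-- On the first coordinate the map acts by an isometry, and for a fixed first coordinate it acts on
the second one by an isometry. -/
theorem measurePreserving_rotationMap (u : F) :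
    MeasurePreserving (rotationMap ι u)
      ((stdGaussian F).prod (stdGaussian (PiLp 2 (fun _ : ι => F))))
      ((stdGaussian F).prod (stdGaussian (PiLp 2 (fun _ : ι => F)))) := by
  refine MeasurePreserving.skew_product (f := (ℝ ∙ u)ᗮ.reflection)
    (g := fun s x => columnwise ι (planeRotation u s) x)
    ⟨by fun_prop, stdGaussian_map _⟩ (measurable_rotationMap u).snd
    (Filter.Eventually.of_forall fun s => stdGaussian_map _)

end Columns

/-! ### Invariance of the joint law of residual and columns -/

section Invariance

open Filter Topology

variable {ι : Type*} [Fintype ι] {F : Type*} [NormedAddCommGroup F] [InnerProductSpace ℝ F]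
  [FiniteDimensional ℝ F] [MeasurableSpace F] [BorelSpace F]

/-- The law of a pair `(s, x)` of standard Gaussian elements, reweighted so that, conditionally
on `x`, the vector `s` is conditioned on lying in `slab x η`. -/
noncomputable def slabMeasure (ι : Type*) [Fintype ι] (F : Type*) [NormedAddCommGroup F]
    [InnerProductSpace ℝ F] [FiniteDimensional ℝ F] [MeasurableSpace F] [BorelSpace F] (η : ℝ) :
    Measure (F × PiLp 2 (fun _ : ι => F)) :=
  ((stdGaussian F).prod (stdGaussian (PiLp 2 (fun _ : ι => F)))).withDensity
    fun z => {z : F × PiLp 2 (fun _ : ι => F) | z.1 ∈ slab z.2 η}.indicator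
      (fun z => (stdGaussian F (slab z.2 η))⁻¹) z

theorem measurable_stdGaussian_slab (η : ℝ) :
    Measurable fun x : PiLp 2 (fun _ : ι => F) => stdGaussian F (slab x η) :=
  measurable_measure_prodMk_right (isClosed_prod_slab (F := F) (κ := ι) η).measurableSet

theorem measurable_slabMeasure_density (η : ℝ) :
    Measurable fun z : F × PiLp 2 (fun _ : ι => F) =>
      {z : F × PiLp 2 (fun _ : ι => F) | z.1 ∈ slab z.2 η}.indicator
      (fun z => (stdGaussian F (slab z.2 η))⁻¹) z :=
  Measurable.indicator ((measurable_stdGaussian_slab η).comp measurable_snd).inv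
    (isClosed_prod_slab η).measurableSet

theorem lintegral_slabMeasure_density {η : ℝ} (hη : 0 < η) (x : PiLp 2 (fun _ : ι => F)) :
    ∫⁻ s, {z : F × PiLp 2 (fun _ : ι => F) | z.1 ∈ slab z.2 η}.indicator
      (fun z => (stdGaussian F (slab z.2 η))⁻¹) (s, x) ∂stdGaussian F = 1 := by
  have : ∀ s, {z : F × PiLp 2 (fun _ : ι => F) | z.1 ∈ slab z.2 η}.indicator
      (fun z => (stdGaussian F (slab z.2 η))⁻¹) (s, x) =
      (slab x η).indicator (fun _ => (stdGaussian F (slab x η))⁻¹) s := by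
    intro s
    simp [Set.indicator]
  simp_rw [this]
  rw [lintegral_indicator_const (isClosed_slab _ _).measurableSet, ENNReal.inv_mul_cancel]
  · exact (Measure.measure_pos_of_mem_nhds _ (slab_mem_nhds_zero _ hη)).ne'
  · finiteness

theorem isProbabilityMeasure_slabMeasure {η : ℝ} (hη : 0 < η) :
    IsProbabilityMeasure (slabMeasure ι F η) := by
  constructor
  rw [slabMeasure, withDensity_apply _ MeasurableSet.univ, setLIntegral_univ,
    lintegral_prod_symm' _ (measurable_slabMeasure_density η)]
  simp_rw [lintegral_slabMeasure_density hη]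
  simp

/-- The conditioned measures are invariant exactly: both the Gaussian measures and the slabs are
preserved by the isometries involved. -/
theorem map_rotationMap_slabMeasure {u : F} (hu : ‖u‖ = 1) (η : ℝ) :
    (slabMeasure ι F η).map (rotationMap ι u) = slabMeasure ι F η := by
  have hT := measurePreserving_rotationMap (ι := ι) u
  have hd : ∀ z : F × PiLp 2 (fun _ : ι => F),
      {z : F × PiLp 2 (fun _ : ι => F) | z.1 ∈ slab z.2 η}.indicator
        (fun z => (stdGaussian F (slab z.2 η))⁻¹) (rotationMap ι u z) =
      {z : F × PiLp 2 (fun _ : ι => F) | z.1 ∈ slab z.2 η}.indicator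
        (fun z => (stdGaussian F (slab z.2 η))⁻¹) z := by
    rintro ⟨s, x⟩
    have h1 : (rotationMap ι u (s, x)).1 ∈ slab (rotationMap ι u (s, x)).2 η ↔ s ∈ slab x η := by
      change (ℝ ∙ u)ᗮ.reflection s ∈ slab (columnwise ι (planeRotation u s) x) η ↔ _
      rw [← planeRotation_apply_self hu, slab_columnwise]
    have h2 : stdGaussian F (slab (rotationMap ι u (s, x)).2 η) = stdGaussian F (slab x η) :=
      stdGaussian_slab_columnwise _ _ _
    by_cases h : s ∈ slab x η
    · rw [Set.indicator_of_mem (by exact h1.2 h), Set.indicator_of_mem (by exact h), h2]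
    · rw [Set.indicator_of_notMem (by exact mt h1.1 h), Set.indicator_of_notMem (by exact h)]
  ext A hA
  rw [Measure.map_apply hT.measurable hA, slabMeasure, withDensity_apply _ (hT.measurable hA),
    withDensity_apply _ hA, ← lintegral_indicator (hT.measurable hA), ← lintegral_indicator hA]
  conv_rhs => rw [← hT.map_eq,
    lintegral_map ((measurable_slabMeasure_density η).indicator hA) hT.measurable]
  congr 1
  ext z
  by_cases h : rotationMap ι u z ∈ A
  · rw [Set.indicator_of_mem h, Set.indicator_of_mem (by exact h), hd]
  · rw [Set.indicator_of_notMem h, Set.indicator_of_notMem (by exact h)]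

/-- Disintegration of `slabMeasure` over the columns. -/
theorem integral_slabMeasure {η : ℝ} (hη : 0 < η) {g : F × PiLp 2 (fun _ : ι => F) → ℝ}
    (hg : Measurable g) {C : ℝ} (hC : ∀ z, |g z| ≤ C) :
    ∫ z, g z ∂slabMeasure ι F η =
      ∫ x, ⨍ s in slab x η, g (s, x) ∂stdGaussian F ∂stdGaussian (PiLp 2 (fun _ : ι => F)) := by
  have := isProbabilityMeasure_slabMeasure (ι := ι) (F := F) hη
  have hlt : ∀ᵐ z ∂((stdGaussian F).prod (stdGaussian (PiLp 2 (fun _ : ι => F)))),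
      {z : F × PiLp 2 (fun _ : ι => F) | z.1 ∈ slab z.2 η}.indicator
      (fun z => (stdGaussian F (slab z.2 η))⁻¹) z < ⊤ := by
    refine Eventually.of_forall fun z => ?_
    refine lt_of_le_of_lt (Set.indicator_le_self' (by simp) _) ?_
    rw [ENNReal.inv_lt_top]
    exact Measure.measure_pos_of_mem_nhds _ (slab_mem_nhds_zero _ hη)
  have hint : Integrable g (slabMeasure ι F η) :=
    Integrable.of_bound hg.aestronglyMeasurable C (Eventually.of_forall hC)
  have hint' := hint
  rw [slabMeasure, integrable_withDensity_iff_integrable_smul'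
    (measurable_slabMeasure_density η) hlt] at hint'
  rw [slabMeasure, integral_withDensity_eq_integral_toReal_smul
    (measurable_slabMeasure_density η) hlt, integral_prod_symm _ hint']
  congr 1
  ext x
  rw [setAverage_eq, ← integral_indicator (isClosed_slab _ _).measurableSet, ← integral_smul]
  congr 1
  ext s
  by_cases h : s ∈ slab x η
  · rw [Set.indicator_of_mem h, Set.indicator_of_mem (by exact h), ENNReal.toReal_inv]
    rfl
  · rw [Set.indicator_of_notMem h, Set.indicator_of_notMem (by exact h)]
    simp

/-- As the slabs get thin, `slabMeasure` converges to the joint law of the residual `r` and the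
columns, also for test functions which are merely continuous at almost every residual. -/
theorem tendsto_integral_slabMeasure {g : F × PiLp 2 (fun _ : ι => F) → ℝ}
    (hg : Measurable g) {C : ℝ} (hC : ∀ z, |g z| ≤ C) {r : F × PiLp 2 (fun _ : ι => F) → F}
    (hr : Measurable r)
    (hproj : ∀ᵐ x ∂stdGaussian (PiLp 2 (fun _ : ι => F)), ∀ e,
      r (e, x) = (Submodule.span ℝ (Set.range x))ᗮ.starProjection e)
    (hcont : ∀ᵐ x ∂stdGaussian (PiLp 2 (fun _ : ι => F)), ∀ᵐ e ∂stdGaussian F,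
      ContinuousAt (fun s => g (s, x)) (r (e, x))) :
    Tendsto (fun η => ∫ z, g z ∂slabMeasure ι F η) (𝓝[>] 0)
      (𝓝 (∫ z, g (r z, z.2) ∂((stdGaussian F).prod (stdGaussian (PiLp 2 (fun _ : ι => F)))))) := by
  have hgr : Measurable fun z : F × PiLp 2 (fun _ : ι => F) => g (r z, z.2) :=
    hg.comp (hr.prodMk measurable_snd)
  rw [integral_prod_symm _ (Integrable.of_bound hgr.aestronglyMeasurable C
    (Eventually.of_forall fun z => hC _))]
  have heq : (fun η => ∫ x, ⨍ s in slab x η, g (s, x) ∂stdGaussian F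
      ∂stdGaussian (PiLp 2 (fun _ : ι => F))) =ᶠ[𝓝[>] 0]
      fun η => ∫ z, g z ∂slabMeasure ι F η := by
    filter_upwards [self_mem_nhdsWithin] with η hη
    rw [integral_slabMeasure hη hg hC]
  refine Tendsto.congr' heq ?_
  refine tendsto_integral_filter_of_dominated_convergence (fun _ => C) ?_ ?_
    (integrable_const C) ?_
  · refine Eventually.of_forall fun η => ?_
    simp_rw [setAverage_eq]
    have h1 : (fun x : PiLp 2 (fun _ : ι => F) => ∫ s in slab x η, g (s, x) ∂stdGaussian F) =
        fun x => ∫ s, {z : F × PiLp 2 (fun _ : ι => F) | z.1 ∈ slab z.2 η}.indicator g (s, x)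
          ∂stdGaussian F := by
      ext x
      rw [← integral_indicator (isClosed_slab _ _).measurableSet]
      congr 1
    have h2 : StronglyMeasurable fun x => ∫ s,
        {z : F × PiLp 2 (fun _ : ι => F) | z.1 ∈ slab z.2 η}.indicator g (s, x)
          ∂stdGaussian F :=
      (hg.indicator (isClosed_prod_slab η).measurableSet).stronglyMeasurable.integral_prod_left'
    rw [← h1] at h2
    exact ((measurable_stdGaussian_slab η).ennreal_toReal.inv.smul
      h2.measurable).aestronglyMeasurable
  · filter_upwards [self_mem_nhdsWithin] with η hη
    refine Eventually.of_forall fun x => ?_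
    have hpos := stdGaussian_real_slab_pos x (η := η) hη
    have hb := norm_setIntegral_le_of_norm_le_const (μ := stdGaussian F) (s := slab x η)
      (f := fun s => g (s, x)) (C := C) (by finiteness) (fun s _ => hC _)
    rw [setAverage_eq, norm_smul, norm_inv, Real.norm_of_nonneg hpos.le, inv_mul_le_iff₀ hpos,
      mul_comm]
    exact hb
  · filter_upwards [hproj, hcont] with x hx hc
    have := tendsto_setAverage_slab x (f := fun s => g (s, x)) (by fun_prop) (fun s => hC _)
      (by filter_upwards [hc] with e he; rw [hx] at he; exact he)
    simp_rw [hx]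
    exact this

/-- Let `x` have standard Gaussian columns, and let `r` be the projection of a standard Gaussian
vector to the orthogonal complement of these columns. Then the law of `(r, x)` is invariant under
`rotationMap`. -/
theorem map_rotationMap_residual {u : F} (hu : ‖u‖ = 1) {r : F × PiLp 2 (fun _ : ι => F) → F}
    (hr : Measurable r)
    (hproj : ∀ᵐ x ∂stdGaussian (PiLp 2 (fun _ : ι => F)), ∀ e,
      r (e, x) = (Submodule.span ℝ (Set.range x))ᗮ.starProjection e)
    (hne : ∀ᵐ x ∂stdGaussian (PiLp 2 (fun _ : ι => F)), ∀ᵐ e ∂stdGaussian F,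
      perpPart u (r (e, x)) ≠ 0) :
    (((stdGaussian F).prod (stdGaussian (PiLp 2 (fun _ : ι => F)))).map
      fun z => (r z, z.2)).map (rotationMap ι u) =
    ((stdGaussian F).prod (stdGaussian (PiLp 2 (fun _ : ι => F)))).map fun z => (r z, z.2) := by
  have hm : Measurable fun z : F × PiLp 2 (fun _ : ι => F) => (r z, z.2) :=
    hr.prodMk measurable_snd
  have hT : Measurable (rotationMap ι u) := measurable_rotationMap u
  have : IsProbabilityMeasure (((stdGaussian F).prod
    (stdGaussian (PiLp 2 (fun _ : ι => F)))).map fun z => (r z, z.2)) :=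
    Measure.isProbabilityMeasure_map hm.aemeasurable
  refine ext_of_forall_integral_eq_of_IsFiniteMeasure fun f => ?_
  have hf : ∀ z, |f z| ≤ ‖f‖ := fun z => f.norm_coe_le_norm z
  have hfm : Measurable f := f.continuous.measurable
  rw [integral_map hT.aemeasurable hfm.aestronglyMeasurable,
    integral_map (f := fun z => f (rotationMap ι u z)) hm.aemeasurable
      (hfm.comp hT).aestronglyMeasurable,
    integral_map hm.aemeasurable hfm.aestronglyMeasurable]
  -- `f` and `f ∘ rotationMap` have the same integral for every slab width, hence in the limit
  have h1 := tendsto_integral_slabMeasure (hfm.comp hT) (fun z => hf _) hr hproj (by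
    filter_upwards [hne] with x hx
    filter_upwards [hx] with e he
    refine f.continuous.continuousAt.comp ?_
    change ContinuousAt (fun s => (((ℝ ∙ u)ᗮ.reflection s,
      columnwise ι (planeRotation u s) x) : F × PiLp 2 (fun _ : ι => F))) (r (e, x))
    refine ContinuousAt.prodMk (by fun_prop) ?_
    refine (PiLp.continuous_toLp 2 _).continuousAt.comp (continuousAt_pi.2 fun j => ?_)
    exact continuousAt_planeRotation hu he (x j))
  have h2 := tendsto_integral_slabMeasure hfm hf hr hproj
    (Eventually.of_forall fun x => Eventually.of_forall fun e =>
      (f.continuous.comp (by fun_prop)).continuousAt)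
  refine tendsto_nhds_unique h1 (h2.congr' ?_)
  filter_upwards with η
  rw [← map_rotationMap_slabMeasure hu η, integral_map hT.aemeasurable hfm.aestronglyMeasurable,
    map_rotationMap_slabMeasure hu η]
  rfl

end Invariance

/-! ### Inverse moments of projections -/

section InverseMoment

open Module

variable {F : Type*} [NormedAddCommGroup F] [InnerProductSpace ℝ F] [FiniteDimensional ℝ F]
  [MeasurableSpace F] [BorelSpace F]

theorem lintegral_inv_sq_norm_starProjection (U : Submodule ℝ F) (hU : 3 ≤ finrank ℝ U) :
    ∫⁻ e, (ENNReal.ofReal (‖U.starProjection e‖ ^ 2))⁻¹ ∂stdGaussian F =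
      ENNReal.ofReal (1 / (finrank ℝ U - 2)) := by
  rw [← lintegral_inv_sq_norm_stdGaussian hU, ← stdGaussian_map_orthogonalProjectionOnto U,
    lintegral_map (by fun_prop) (by fun_prop)]
  rfl

/-- The components of a standard Gaussian vector in `W` and in `Wᗮ` are independent, hence the
expectation of a quotient of squares is the product of a second moment and an inverse second
moment. -/
theorem lintegral_sq_add_sq_div_sq_norm_le (W : Submodule ℝ F) {a b : F} (ha : a ∈ W) (hb : b ∈ W)
    (ha1 : ‖a‖ ≤ 1) (hb1 : ‖b‖ ≤ 1) {q q' : ℝ} (hq : 0 ≤ q) (hq' : 0 ≤ q')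
    (hW : 3 ≤ finrank ℝ Wᗮ) :
    ∫⁻ e, ENNReal.ofReal (q * inner ℝ a e ^ 2 + q' * inner ℝ b e ^ 2) *
        (ENNReal.ofReal (‖Wᗮ.starProjection e‖ ^ 2))⁻¹ ∂stdGaussian F ≤
      ENNReal.ofReal ((q + q') / (finrank ℝ Wᗮ - 2)) := by
  have hW' : (3 : ℝ) ≤ finrank ℝ Wᗮ := by exact_mod_cast hW
  rw [lintegral_stdGaussian_eq_lintegral_lintegral W (by fun_prop)]
  have h1 : ∀ e e' : F, ∀ c ∈ W, inner ℝ c (W.starProjection e + Wᗮ.starProjection e') =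
      inner ℝ c e := by
    intro e e' c hc
    rw [inner_add_right, ← Submodule.inner_starProjection_left_eq_right,
      Submodule.starProjection_eq_self_iff.2 hc,
      (Submodule.mem_orthogonal _ _).1 (Submodule.starProjection_apply_mem Wᗮ e') _ hc, add_zero]
  have h2 : ∀ e e' : F, Wᗮ.starProjection (W.starProjection e + Wᗮ.starProjection e') =
      Wᗮ.starProjection e' := by
    intro e e'
    have e1 : Wᗮ.starProjection (W.starProjection e) = 0 := by
      rw [Submodule.starProjection_apply_eq_zero_iff]
      exact W.le_orthogonal_orthogonal (Submodule.starProjection_apply_mem W e)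
    rw [map_add, e1, zero_add,
      Submodule.starProjection_eq_self_iff.2 (Submodule.starProjection_apply_mem Wᗮ e')]
  simp_rw [h2, h1 _ _ a ha, h1 _ _ b hb]
  have h3 : ∀ c : ENNReal, ∫⁻ e, ENNReal.ofReal (q * inner ℝ a e ^ 2 + q' * inner ℝ b e ^ 2) * c
      ∂stdGaussian F ≤ ENNReal.ofReal (q + q') * c := by
    intro c
    rw [lintegral_mul_const _ (by fun_prop)]
    gcongr
    have : ∀ e : F, ENNReal.ofReal (q * inner ℝ a e ^ 2 + q' * inner ℝ b e ^ 2) =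
        ENNReal.ofReal q * ENNReal.ofReal (inner ℝ a e ^ 2) +
        ENNReal.ofReal q' * ENNReal.ofReal (inner ℝ b e ^ 2) := by
      intro e
      rw [ENNReal.ofReal_add (by positivity) (by positivity), ENNReal.ofReal_mul hq,
        ENNReal.ofReal_mul hq']
    simp_rw [this]
    rw [lintegral_add_left (by fun_prop), lintegral_const_mul _ (by fun_prop),
      lintegral_const_mul _ (by fun_prop), lintegral_inner_sq_stdGaussian,
      lintegral_inner_sq_stdGaussian, ENNReal.ofReal_add hq hq']
    gcongr
    · exact mul_le_of_le_one_right' (ENNReal.ofReal_le_one.2 (pow_le_one₀ (norm_nonneg _) ha1))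
    · exact mul_le_of_le_one_right' (ENNReal.ofReal_le_one.2 (pow_le_one₀ (norm_nonneg _) hb1))
  calc _ ≤ ∫⁻ e', ENNReal.ofReal (q + q') *
        (ENNReal.ofReal (‖Wᗮ.starProjection e'‖ ^ 2))⁻¹ ∂stdGaussian F :=
        lintegral_mono fun e' => h3 _
    _ = _ := by
        rw [lintegral_const_mul _ (by fun_prop), lintegral_inv_sq_norm_starProjection _ hW,
          ← ENNReal.ofReal_mul (by positivity)]
        congr 1
        ring

end InverseMoment

/-! ### The likelihood ratio -/

section LogRatio

open Module

variable {ι : Type*} [Fintype ι] {F : Type*} [NormedAddCommGroup F] [InnerProductSpace ℝ F]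

/-- The increment of half the quadratic form of `B` when `x` is replaced by `Q x` columnwise: the
log-likelihood ratio between a Gaussian law with precision operator `B` and its image under the
inverse of `Q`. -/
noncomputable def quadIncrement (B : PiLp 2 (fun _ : ι => F) →L[ℝ] PiLp 2 (fun _ : ι => F))
    (Q : F ≃ₗᵢ[ℝ] F) (x : PiLp 2 (fun _ : ι => F)) : ℝ :=
  (inner ℝ (columnwise ι Q x) (B (columnwise ι Q x)) - inner ℝ x (B x)) / 2

/-- Multiples of the identity do not contribute, because `Q` is an isometry. -/
theorem quadIncrement_sub_smul_id (B : PiLp 2 (fun _ : ι => F) →L[ℝ] PiLp 2 (fun _ : ι => F))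
    (c : ℝ) (Q : F ≃ₗᵢ[ℝ] F) (x : PiLp 2 (fun _ : ι => F)) :
    quadIncrement (B - c • ContinuousLinearMap.id ℝ _) Q x = quadIncrement B Q x := by
  have h : inner ℝ (columnwise ι Q x) (columnwise ι Q x) = inner ℝ x x :=
    LinearIsometryEquiv.inner_map_map _ _ _
  have hc : ∀ y, (c • ContinuousLinearMap.id ℝ (PiLp 2 (fun _ : ι => F))) y = c • y := fun _ => rfl
  simp only [quadIncrement, sub_apply, hc, inner_sub_right, inner_smul_right, h]
  ring

/-- For columns orthogonal to `s` the shear formula makes the increment explicit; it is controlled by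
`1 / ‖perpPart u s‖ ^ 2`. -/
theorem quadIncrement_planeRotation_le {B : PiLp 2 (fun _ : ι => F) →L[ℝ] PiLp 2 (fun _ : ι => F)}
    (hB : (B : PiLp 2 (fun _ : ι => F) →ₗ[ℝ] PiLp 2 (fun _ : ι => F)).IsSymmetric)
    {u s : F} (hu : ‖u‖ = 1) (hs : perpPart u s ≠ 0)
    {x : PiLp 2 (fun _ : ι => F)} (hx : ∀ j, inner ℝ s (x j) = 0) :
    quadIncrement B (planeRotation u s) x ≤
      (2 * (|inner ℝ u s| * |inner ℝ (perpPart u s) (∑ j, inner ℝ u (x j) • B x j)|) +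
        2 * ‖B‖ * (∑ j, inner ℝ u (x j) ^ 2) * inner ℝ u s ^ 2) / ‖perpPart u s‖ ^ 2 := by
  set h := perpPart u s
  set α := inner ℝ u s
  have hn : 0 < ‖h‖ ^ 2 := by positivity
  -- by the shear formula `Q x = x + y` with all columns of `y` multiples of `h`
  set y : PiLp 2 (fun _ : ι => F) :=
    WithLp.toLp 2 fun j => (2 * α / ‖h‖ ^ 2 * inner ℝ u (x j)) • h with hy
  have hQ : columnwise ι (planeRotation u s) x = x + y := by
    ext j
    simp only [columnwise, LinearIsometryEquiv.piLpCongrRight_apply, PiLp.add_apply, hy]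
    exact planeRotation_apply_of_inner_eq_zero hu hs (hx j)
  have hyx : inner ℝ y (B x) =
      2 * α / ‖h‖ ^ 2 * inner ℝ h (∑ j, inner ℝ u (x j) • B x j) := by
    rw [PiLp.inner_apply, inner_sum, Finset.mul_sum]
    refine Finset.sum_congr rfl fun j _ => ?_
    simp only [hy, inner_smul_left, inner_smul_right]
    simp
    ring
  have hxy : inner ℝ x (B y) = inner ℝ y (B x) := by
    have := hB x y
    simp only [ContinuousLinearMap.coe_coe] at this
    rw [← this, real_inner_comm]
  have hyy : ‖y‖ ^ 2 = 4 * α ^ 2 * (∑ j, inner ℝ u (x j) ^ 2) / ‖h‖ ^ 2 := by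
    rw [PiLp.norm_sq_eq_of_L2, Finset.mul_sum, Finset.sum_div]
    refine Finset.sum_congr rfl fun j _ => ?_
    simp only [hy, norm_smul, mul_pow, Real.norm_eq_abs, sq_abs]
    field_simp
    ring
  have hbd : inner ℝ y (B y) ≤ ‖B‖ * ‖y‖ ^ 2 := by
    calc inner ℝ y (B y) ≤ ‖y‖ * ‖B y‖ := real_inner_le_norm _ _
      _ ≤ ‖y‖ * (‖B‖ * ‖y‖) := by gcongr; exact B.le_opNorm y
      _ = ‖B‖ * ‖y‖ ^ 2 := by ring
  have hL : quadIncrement B (planeRotation u s) x = inner ℝ y (B x) + inner ℝ y (B y) / 2 := by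
    rw [quadIncrement, hQ, map_add, inner_add_left, inner_add_right, inner_add_right, hxy]
    ring
  rw [hL, hyx]
  set w := ∑ j, inner ℝ u (x j) • B x j
  have h1 : α * inner ℝ h w ≤ |α| * |inner ℝ h w| := by
    rw [← abs_mul]
    exact le_abs_self _
  calc 2 * α / ‖h‖ ^ 2 * inner ℝ h w + inner ℝ y (B y) / 2
      ≤ 2 * α / ‖h‖ ^ 2 * inner ℝ h w +
        ‖B‖ * (4 * α ^ 2 * (∑ j, inner ℝ u (x j) ^ 2) / ‖h‖ ^ 2) / 2 := by
        rw [← hyy]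
        gcongr
    _ = (2 * (α * inner ℝ h w) + 2 * ‖B‖ * (∑ j, inner ℝ u (x j) ^ 2) * α ^ 2) / ‖h‖ ^ 2 := by
        ring
    _ ≤ _ := by gcongr

theorem norm_sum_smul_apply_le (B : PiLp 2 (fun _ : ι => F) →L[ℝ] PiLp 2 (fun _ : ι => F)) (u : F)
    (x : PiLp 2 (fun _ : ι => F)) :
    ‖∑ j, inner ℝ u (x j) • B x j‖ ≤ ‖B‖ * (√(∑ j, inner ℝ u (x j) ^ 2) * ‖x‖) := by
  calc ‖∑ j, inner ℝ u (x j) • B x j‖ ≤ ∑ j, |inner ℝ u (x j)| * ‖B x j‖ := by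
        refine (norm_sum_le _ _).trans (le_of_eq ?_)
        simp [norm_smul]
    _ ≤ √(∑ j, |inner ℝ u (x j)| ^ 2) * √(∑ j, ‖B x j‖ ^ 2) :=
        Real.sum_mul_le_sqrt_mul_sqrt _ _ _
    _ = √(∑ j, inner ℝ u (x j) ^ 2) * ‖B x‖ := by
        rw [← PiLp.norm_sq_eq_of_L2, Real.sqrt_sq (norm_nonneg _)]
        simp_rw [sq_abs]
    _ ≤ √(∑ j, inner ℝ u (x j) ^ 2) * (‖B‖ * ‖x‖) := by
        gcongr
        exact B.le_opNorm x
    _ = _ := by ring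

variable [FiniteDimensional ℝ F] [MeasurableSpace F] [BorelSpace F]

open Submodule in
/-- Given the columns `x`, the residual vector is a standard Gaussian vector in the orthogonal
complement of the columns, and the rotation angle is of the order of the inverse of its norm. -/
theorem lintegral_quadIncrement_le
    {B : PiLp 2 (fun _ : ι => F) →L[ℝ] PiLp 2 (fun _ : ι => F)}
    (hB : (B : PiLp 2 (fun _ : ι => F) →ₗ[ℝ] PiLp 2 (fun _ : ι => F)).IsSymmetric)
    {u : F} (hu : ‖u‖ = 1) (hd : Fintype.card ι + 5 ≤ finrank ℝ F)
    (x : PiLp 2 (fun _ : ι => F)) :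
    (∀ᵐ e ∂stdGaussian F, perpPart u ((span ℝ (Set.range x))ᗮ.starProjection e) ≠ 0) ∧
    ∫⁻ e, ENNReal.ofReal (quadIncrement B
        (planeRotation u ((span ℝ (Set.range x))ᗮ.starProjection e)) x) ∂stdGaussian F ≤
      ENNReal.ofReal (‖B‖ * (4 * (√(∑ j, inner ℝ u (x j) ^ 2) * ‖x‖) +
        2 * ∑ j, inner ℝ u (x j) ^ 2) / (finrank ℝ F - Fintype.card ι - 4)) := by
  set K := span ℝ (Set.range x) with hK
  set w := ∑ j, inner ℝ u (x j) • B x j with hw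
  set w' := ‖w‖⁻¹ • w with hw'
  have hw'1 : ‖w'‖ ≤ 1 := by
    rw [hw', norm_smul, norm_inv, norm_norm]
    exact inv_mul_le_one
  have hww' : w = ‖w‖ • w' := by
    by_cases h0 : w = 0
    · simp [h0]
    · rw [hw', smul_smul, mul_inv_cancel₀ (by positivity), one_smul]
  -- The numerator of the bound depends on the component of `e` in `W` only, and the denominator is at
  -- least the squared norm of the component in `Wᗮ`, which is independent of it.
  set W := K ⊔ span ℝ {u, w} with hW
  have hcardN : finrank ℝ W ≤ Fintype.card ι + 2 := by
    have h1 : finrank ℝ K ≤ Fintype.card ι := finrank_range_le_card _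
    have h2 : finrank ℝ (span ℝ ({u, w} : Set F)) ≤ 2 := by
      classical
      have := finrank_span_finset_le_card (R := ℝ) ({u, w} : Finset F)
      simp only [Finset.coe_insert, Finset.coe_singleton] at this
      exact this.trans Finset.card_le_two
    exact (Submodule.finrank_add_le_finrank_add_finrank K (span ℝ {u, w})).trans (by omega)
  have hfin := Submodule.finrank_add_finrank_orthogonal W
  have hWf : 3 ≤ finrank ℝ Wᗮ := by omega
  have hd1 : (finrank ℝ F : ℝ) - Fintype.card ι - 4 ≤ finrank ℝ Wᗮ - 2 := by
    have : finrank ℝ F ≤ finrank ℝ Wᗮ + (Fintype.card ι + 2) := by omega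
    have : (finrank ℝ F : ℝ) ≤ finrank ℝ Wᗮ + (Fintype.card ι + 2) := by exact_mod_cast this
    linarith
  have hd2 : (0 : ℝ) < (finrank ℝ F : ℝ) - Fintype.card ι - 4 := by
    have : (Fintype.card ι : ℝ) + 5 ≤ finrank ℝ F := by exact_mod_cast hd
    linarith
  have huW : u ∈ W := mem_sup_right (subset_span (by simp))
  have hw'W : w' ∈ W := W.smul_mem _ (mem_sup_right (subset_span (by simp)))
  have hKW : K ≤ W := le_sup_left
  have hproj : ∀ v ∈ W, Kᗮ.starProjection v ∈ W := by
    intro v hv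
    rw [starProjection_orthogonal_val]
    exact W.sub_mem hv (hKW (starProjection_apply_mem K v))
  have hnorm1 : ∀ v : F, ‖v‖ ≤ 1 → ‖Kᗮ.starProjection v‖ ≤ 1 := fun v hv =>
    (norm_starProjection_apply_le _ _).trans hv
  have hN : ∀ e, Wᗮ.starProjection e = Wᗮ.starProjection (perpPart u (Kᗮ.starProjection e)) := by
    intro e
    have e1 : ∀ v ∈ W, Wᗮ.starProjection v = 0 := fun v hv => by
      rw [starProjection_apply_eq_zero_iff]
      exact W.le_orthogonal_orthogonal hv
    rw [perpPart, map_sub, map_smul, e1 u huW, smul_zero, sub_zero, starProjection_orthogonal_val (K := K),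
      map_sub, e1 _ (hKW (starProjection_apply_mem K e)), sub_zero]
  have hpos : ∀ᵐ e ∂stdGaussian F, Wᗮ.starProjection e ≠ 0 := by
    have h1 : ∫⁻ e, (ENNReal.ofReal (‖Wᗮ.starProjection e‖ ^ 2))⁻¹ ∂stdGaussian F ≠ ⊤ := by
      rw [lintegral_inv_sq_norm_starProjection _ hWf]
      finiteness
    filter_upwards [ae_lt_top (by fun_prop) h1] with e he h0
    simp [h0] at he
  have hne : ∀ᵐ e ∂stdGaussian F, perpPart u (Kᗮ.starProjection e) ≠ 0 := by
    filter_upwards [hpos] with e he h0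
    rw [hN, h0, map_zero] at he
    exact he rfl
  refine ⟨hne, ?_⟩
  set A2 := ∑ j, inner ℝ u (x j) ^ 2 with hA2
  have hA2n : 0 ≤ A2 := Finset.sum_nonneg fun j _ => by positivity
  have hmain : ∀ᵐ e ∂stdGaussian F, ENNReal.ofReal (quadIncrement B
        (planeRotation u (Kᗮ.starProjection e)) x) ≤
      ENNReal.ofReal ((3 * ‖w‖ + 2 * ‖B‖ * A2) * inner ℝ (Kᗮ.starProjection u) e ^ 2 +
        ‖w‖ * inner ℝ (Kᗮ.starProjection w') e ^ 2) *
        (ENNReal.ofReal (‖Wᗮ.starProjection e‖ ^ 2))⁻¹ := by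
    filter_upwards [hne, hpos] with e he hp
    set s := Kᗮ.starProjection e with hs
    have hp2 : 0 < ‖Wᗮ.starProjection e‖ ^ 2 := by positivity
    rw [← ENNReal.ofReal_inv_of_pos hp2, ← ENNReal.ofReal_mul (by positivity)]
    refine ENNReal.ofReal_le_ofReal ?_
    have hsx : ∀ j, inner ℝ s (x j) = 0 := fun j => by
      rw [real_inner_comm]
      exact (mem_orthogonal _ _).1 (starProjection_apply_mem Kᗮ e) _ (subset_span ⟨j, rfl⟩)
    refine (quadIncrement_planeRotation_le hB hu he hsx).trans ?_
    rw [← hw, ← hA2, inner_starProjection_left_eq_right, inner_starProjection_left_eq_right, ← hs,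
      div_eq_mul_inv]
    set α := inner ℝ u s
    set ω := inner ℝ w' s
    have hhw : |inner ℝ (perpPart u s) w| ≤ ‖w‖ * |ω| + |α| * ‖w‖ := by
      have e1 : inner ℝ (perpPart u s) w = ‖w‖ * ω - α * inner ℝ u w := by
        have e2 : inner ℝ s w = ‖w‖ * ω := by
          conv_lhs => rw [hww']
          rw [inner_smul_right, real_inner_comm]
        rw [perpPart, inner_sub_left, inner_smul_left, e2]
        simp [α]
      have e3 : |inner ℝ u w| ≤ ‖w‖ := by
        simpa [hu] using abs_real_inner_le_norm u w
      rw [e1]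
      refine (abs_sub _ _).trans ?_
      rw [abs_mul, abs_mul, abs_norm]
      gcongr
    have hnum : 2 * (|α| * |inner ℝ (perpPart u s) w|) + 2 * ‖B‖ * A2 * α ^ 2 ≤
        (3 * ‖w‖ + 2 * ‖B‖ * A2) * α ^ 2 + ‖w‖ * ω ^ 2 := by
      have e1 : |α| * |inner ℝ (perpPart u s) w| ≤ |α| * (‖w‖ * |ω| + |α| * ‖w‖) := by gcongr
      have e2 : 0 ≤ ‖w‖ * (|α| - |ω|) ^ 2 := by positivity
      have e3 := sq_abs α
      have e4 := sq_abs ω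
      rw [← e3, ← e4]
      nlinarith
    have hden : (‖perpPart u s‖ ^ 2)⁻¹ ≤ (‖Wᗮ.starProjection e‖ ^ 2)⁻¹ := by
      refine inv_anti₀ hp2 ?_
      rw [hN]
      gcongr
      exact norm_starProjection_apply_le _ _
    refine mul_le_mul hnum hden (by positivity) (by positivity)
  refine (lintegral_mono_ae hmain).trans ?_
  refine (lintegral_sq_add_sq_div_sq_norm_le W (hproj u huW) (hproj w' hw'W) (hnorm1 u hu.le)
    (hnorm1 w' hw'1) (by positivity) (by positivity) hWf).trans ?_
  refine ENNReal.ofReal_le_ofReal ?_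
  have hwle := norm_sum_smul_apply_le B u x
  rw [← hw, ← hA2] at hwle
  have hnn : 0 ≤ ‖B‖ * (4 * (√A2 * ‖x‖) + 2 * A2) := by positivity
  refine le_trans (b := ‖B‖ * (4 * (√A2 * ‖x‖) + 2 * A2) / (finrank ℝ Wᗮ - 2)) ?_ ?_
  · have : (0 : ℝ) < finrank ℝ Wᗮ - 2 := by linarith
    gcongr
    nlinarith
  · gcongr

end LogRatio

/-! ### Comparison of the residual vector with its mirror image -/

section ResidualLaw

open Module

variable {ι : Type*} [Fintype ι] {F : Type*} [NormedAddCommGroup F] [InnerProductSpace ℝ F]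
  [FiniteDimensional ℝ F] [MeasurableSpace F] [BorelSpace F]

theorem measurable_quadIncrement_planeRotation
    (B : PiLp 2 (fun _ : ι => F) →L[ℝ] PiLp 2 (fun _ : ι => F)) (u : F) :
    Measurable fun z : F × PiLp 2 (fun _ : ι => F) =>
      quadIncrement B (planeRotation u z.1) z.2 := by
  have h : Measurable fun z : F × PiLp 2 (fun _ : ι => F) =>
    columnwise ι (planeRotation u z.1) z.2 := (measurable_rotationMap u).snd
  unfold quadIncrement
  fun_prop

/-- The laws of the residual vector `r` and of its mirror image differ at most by the expectation
of the positive part of the log-likelihood ratio. Indeed, by the invariance of the law of `(r, x)`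
for standard Gaussian columns, passing to the mirror image amounts to replacing the density `G x`
by `G (Q x)` with `Q` the rotation determined by `r`, and `G x - G (Q x) ≤ G x * log (G x / G (Q x))`. -/
theorem residual_measure_le {u : F} (hu : ‖u‖ = 1) {r : F × PiLp 2 (fun _ : ι => F) → F}
    (hr : Measurable r)
    (hproj : ∀ᵐ x ∂stdGaussian (PiLp 2 (fun _ : ι => F)), ∀ e,
      r (e, x) = (Submodule.span ℝ (Set.range x))ᗮ.starProjection e)
    (hne : ∀ᵐ x ∂stdGaussian (PiLp 2 (fun _ : ι => F)), ∀ᵐ e ∂stdGaussian F,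
      perpPart u (r (e, x)) ≠ 0)
    (B : PiLp 2 (fun _ : ι => F) →L[ℝ] PiLp 2 (fun _ : ι => F))
    {c : ℝ} (hc : 0 ≤ c) {ν : Measure (PiLp 2 (fun _ : ι => F))} [SFinite ν]
    (hν : ν = (stdGaussian (PiLp 2 (fun _ : ι => F))).withDensity fun x =>
      ENNReal.ofReal (c * Real.exp (-(inner ℝ x (B x) - ‖x‖ ^ 2) / 2)))
    {A : Set F} (hA : MeasurableSet A) :
    ((stdGaussian F).prod ν) (r ⁻¹' A) ≤
      ((stdGaussian F).prod ν) {z | (ℝ ∙ u)ᗮ.reflection (r z) ∈ A} +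
      ∫⁻ z, ENNReal.ofReal (quadIncrement B (planeRotation u (r z)) z.2)
        ∂((stdGaussian F).prod ν) := by
  set G : PiLp 2 (fun _ : ι => F) → ENNReal := fun x =>
    ENNReal.ofReal (c * Real.exp (-(inner ℝ x (B x) - ‖x‖ ^ 2) / 2)) with hG
  have hGm : Measurable G := by fun_prop
  set N := (stdGaussian F).prod (stdGaussian (PiLp 2 (fun _ : ι => F))) with hN
  have hμ : (stdGaussian F).prod ν = N.withDensity fun z => G z.2 := by
    have : SFinite ((stdGaussian (PiLp 2 (fun _ : ι => F))).withDensity G) := hν ▸ inferInstance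
    rw [hν, prod_withDensity_right hGm]
  have hm : Measurable fun z : F × PiLp 2 (fun _ : ι => F) => (r z, z.2) :=
    hr.prodMk measurable_snd
  have hT := measurable_rotationMap (ι := ι) u
  have hLm : Measurable fun z : F × PiLp 2 (fun _ : ι => F) =>
      ENNReal.ofReal (quadIncrement B (planeRotation u (r z)) z.2) :=
    ((measurable_quadIncrement_planeRotation B u).comp hm).ennreal_ofReal
  -- `1 ≤ exp (-L) + L⁺` with `L` the log-likelihood ratio
  have hGle : ∀ (Q : F ≃ₗᵢ[ℝ] F) x,
      G x ≤ G (columnwise ι Q x) + G x * ENNReal.ofReal (quadIncrement B Q x) := by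
    intro Q x
    set L := quadIncrement B Q x with hL
    have e1 : G (columnwise ι Q x) = G x * ENNReal.ofReal (Real.exp (-L)) := by
      simp only [hG]
      rw [← ENNReal.ofReal_mul (by positivity), mul_assoc, ← Real.exp_add,
        LinearIsometryEquiv.norm_map, hL, quadIncrement]
      congr 3
      ring
    have e2 : 1 ≤ ENNReal.ofReal (Real.exp (-L)) + ENNReal.ofReal L := by
      refine le_trans ?_ ENNReal.ofReal_add_le
      rw [ENNReal.one_le_ofReal]
      linarith [Real.add_one_le_exp (-L)]
    rw [e1, ← mul_add]
    exact le_mul_of_one_le_right' e2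
  -- `rotationMap` is an involution
  have hQ : ∀ z : F × PiLp 2 (fun _ : ι => F),
      (rotationMap ι u (rotationMap ι u z)).2 = z.2 := by
    rintro ⟨s, x⟩
    ext j
    exact planeRotation_reflection_apply hu s (x j)
  set H : F × PiLp 2 (fun _ : ι => F) → ENNReal := fun z =>
    A.indicator 1 z.1 * G (rotationMap ι u z).2 with hH
  have hHm : Measurable H := by
    have h1 : Measurable (A.indicator (1 : F → ENNReal)) := measurable_one.indicator hA
    exact (h1.comp measurable_fst).mul (hGm.comp hT.snd)
  have hinv : ∫⁻ z, A.indicator 1 (r z) * G (columnwise ι (planeRotation u (r z)) z.2) ∂N =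
      ∫⁻ z, A.indicator 1 ((ℝ ∙ u)ᗮ.reflection (r z)) * G z.2 ∂N := by
    have e1 := lintegral_map (μ := N) hHm hm
    rw [← map_rotationMap_residual hu hr hproj hne, lintegral_map hHm hT,
      lintegral_map (f := fun z => H (rotationMap ι u z)) (hHm.comp hT) hm] at e1
    calc _ = ∫⁻ z, H (r z, z.2) ∂N := rfl
      _ = _ := e1.symm
      _ = _ := by
        refine lintegral_congr fun z => ?_
        simp only [hH, hQ]
        rfl
  have hr' : Measurable fun z => (ℝ ∙ u)ᗮ.reflection (r z) := by fun_prop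
  have hind : ∀ f : F × PiLp 2 (fun _ : ι => F) → F, Measurable f →
      N.withDensity (fun z => G z.2) (f ⁻¹' A) = ∫⁻ z, A.indicator 1 (f z) * G z.2 ∂N := by
    intro f hf
    rw [withDensity_apply _ (hf hA), ← lintegral_indicator (hf hA)]
    refine lintegral_congr fun z => ?_
    by_cases h : f z ∈ A
    · rw [Set.indicator_of_mem h, Set.indicator_of_mem (by exact h)]
      simp
    · rw [Set.indicator_of_notMem h, Set.indicator_of_notMem (by exact h)]
      simp
  rw [hμ, hind r hr, show {z | (ℝ ∙ u)ᗮ.reflection (r z) ∈ A} =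
    (fun z => (ℝ ∙ u)ᗮ.reflection (r z)) ⁻¹' A from rfl, hind _ hr', ← hinv,
    lintegral_withDensity_eq_lintegral_mul _ (by fun_prop) hLm, ← lintegral_add_right]
  · refine lintegral_mono fun z => ?_
    by_cases h : r z ∈ A
    · rw [Set.indicator_of_mem h]
      simpa using hGle (planeRotation u (r z)) z.2
    · rw [Set.indicator_of_notMem h]
      simp
  · exact (by fun_prop : Measurable fun z : F × PiLp 2 (fun _ : ι => F) => G z.2).mul hLm

/-- Second moments at most `s` in every direction bound the part of the log-likelihood ratio which
depends on the columns: `∑ j, ⟪u, x j⟫²` and `‖x‖²` have expectations at most `s` times the numbers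
of coordinates involved. -/
theorem lintegral_quadratic_le {s : ℝ} (hs : 0 ≤ s) {ν : Measure (PiLp 2 (fun _ : ι => F))}
    (hmom : ∀ v, ∫⁻ x, ENNReal.ofReal (inner ℝ v x ^ 2) ∂ν ≤ ENNReal.ofReal (s * ‖v‖ ^ 2))
    {u : F} (hu : ‖u‖ = 1) (hF : 0 < finrank ℝ F) :
    ∫⁻ x, ENNReal.ofReal (4 * (√(∑ j, inner ℝ u (x j) ^ 2) * ‖x‖) +
        2 * ∑ j, inner ℝ u (x j) ^ 2) ∂ν ≤
      ENNReal.ofReal (s * Fintype.card ι * (4 * √(finrank ℝ F) + 2)) := by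
  classical
  have hA : ∫⁻ x, ENNReal.ofReal (∑ j, inner ℝ u (x j) ^ 2) ∂ν ≤
      ENNReal.ofReal (s * Fintype.card ι) := by
    have e1 : ∀ x : PiLp 2 (fun _ : ι => F), ENNReal.ofReal (∑ j, inner ℝ u (x j) ^ 2) =
        ∑ j, ENNReal.ofReal (inner ℝ (WithLp.toLp 2 (Pi.single j u) : PiLp 2 (fun _ : ι => F)) x ^ 2) := by
      intro x
      rw [ENNReal.ofReal_sum_of_nonneg fun j _ => by positivity]
      refine Finset.sum_congr rfl fun j _ => ?_
      rw [PiLp.inner_apply, Finset.sum_eq_single j]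
      · simp
      · intro k _ hk
        simp [hk]
      · simp
    simp_rw [e1]
    rw [lintegral_finsetSum _ fun j _ => by fun_prop]
    refine (Finset.sum_le_sum fun j _ => hmom _).trans ?_
    simp [hu, mul_comm s, ENNReal.ofReal_mul]
  have hX : ∫⁻ x, ENNReal.ofReal (‖x‖ ^ 2) ∂ν ≤
      ENNReal.ofReal (s * (Fintype.card ι * finrank ℝ F)) := by
    have e1 : ∀ x : PiLp 2 (fun _ : ι => F), ENNReal.ofReal (‖x‖ ^ 2) =
        ∑ i, ENNReal.ofReal (inner ℝ (stdOrthonormalBasis ℝ (PiLp 2 (fun _ : ι => F)) i) x ^ 2) := by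
      intro x
      rw [← OrthonormalBasis.sum_sq_inner_right (stdOrthonormalBasis ℝ (PiLp 2 (fun _ : ι => F))) x,
        ENNReal.ofReal_sum_of_nonneg fun j _ => by positivity]
    simp_rw [e1]
    rw [lintegral_finsetSum _ fun j _ => by fun_prop]
    refine (Finset.sum_le_sum fun j _ => hmom _).trans ?_
    have e2 : finrank ℝ (PiLp 2 (fun _ : ι => F)) = Fintype.card ι * finrank ℝ F := by
      rw [LinearEquiv.finrank_eq (WithLp.linearEquiv 2 ℝ (ι → F)), finrank_pi_fintype]
      simp
    rw [mul_comm s, ENNReal.ofReal_mul (by positivity), ENNReal.ofReal_mul (by positivity)]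
    simp [e2]
  set m : ℝ := (finrank ℝ F : ℝ) with hm
  have hmpos : 0 < m := Nat.cast_pos.2 hF
  have hsm : 0 < √m := Real.sqrt_pos.2 hmpos
  calc _ ≤ ∫⁻ x, (ENNReal.ofReal (2 * √m + 2) * ENNReal.ofReal (∑ j, inner ℝ u (x j) ^ 2) +
        ENNReal.ofReal (2 / √m) * ENNReal.ofReal (‖x‖ ^ 2)) ∂ν := by
        refine lintegral_mono fun x => ?_
        have hA0 : 0 ≤ ∑ j, inner ℝ u (x j) ^ 2 := Finset.sum_nonneg fun j _ => by positivity
        rw [← ENNReal.ofReal_mul (by positivity), ← ENNReal.ofReal_mul (by positivity),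
          ← ENNReal.ofReal_add (by positivity) (by positivity)]
        refine ENNReal.ofReal_le_ofReal ?_
        set A2 := ∑ j, inner ℝ u (x j) ^ 2
        -- weighted arithmetic-geometric inequality; the weight `√m` balances the two expectations
        have h1 : 0 ≤ (√m * √A2 - ‖x‖) ^ 2 / √m := by positivity
        have h2 : (√m * √A2 - ‖x‖) ^ 2 / √m = √m * A2 - 2 * (√A2 * ‖x‖) + ‖x‖ ^ 2 / √m := by
          rw [← Real.sq_sqrt hA0]
          field_simp
          simp
          ring
        have h3 : 2 / √m * ‖x‖ ^ 2 = 2 * (‖x‖ ^ 2 / √m) := by ring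
        nlinarith
    _ = ENNReal.ofReal (2 * √m + 2) * ∫⁻ x, ENNReal.ofReal (∑ j, inner ℝ u (x j) ^ 2) ∂ν +
        ENNReal.ofReal (2 / √m) * ∫⁻ x, ENNReal.ofReal (‖x‖ ^ 2) ∂ν := by
        rw [lintegral_add_left (by fun_prop), lintegral_const_mul _ (by fun_prop),
          lintegral_const_mul _ (by fun_prop)]
    _ ≤ ENNReal.ofReal (2 * √m + 2) * ENNReal.ofReal (s * Fintype.card ι) +
        ENNReal.ofReal (2 / √m) * ENNReal.ofReal (s * (Fintype.card ι * m)) := by gcongr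
    _ = _ := by
        rw [← ENNReal.ofReal_mul (by positivity), ← ENNReal.ofReal_mul (by positivity),
          ← ENNReal.ofReal_add (by positivity) (by positivity)]
        congr 1
        have : m / √m = √m := Real.div_sqrt
        calc _ = s * Fintype.card ι * (2 * √m + 2 + 2 * (m / √m)) := by ring
          _ = _ := by rw [this]; ring

/-- Quantitative comparison of the residual vector with its mirror image, for Gaussian columns with
precision operator `B` and second moments at most `s`. -/
theorem residual_measure_le_add {u : F} (hu : ‖u‖ = 1) {r : F × PiLp 2 (fun _ : ι => F) → F}
    (hr : Measurable r)
    (hproj : ∀ᵐ x ∂stdGaussian (PiLp 2 (fun _ : ι => F)), ∀ e,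
      r (e, x) = (Submodule.span ℝ (Set.range x))ᗮ.starProjection e)
    (hd : Fintype.card ι + 5 ≤ finrank ℝ F)
    {B : PiLp 2 (fun _ : ι => F) →L[ℝ] PiLp 2 (fun _ : ι => F)} (b : ℝ)
    (hB : (B : PiLp 2 (fun _ : ι => F) →ₗ[ℝ] PiLp 2 (fun _ : ι => F)).IsSymmetric)
    {c : ℝ} (hc : 0 ≤ c) {ν : Measure (PiLp 2 (fun _ : ι => F))} [SFinite ν]
    (hν : ν = (stdGaussian (PiLp 2 (fun _ : ι => F))).withDensity fun x =>
      ENNReal.ofReal (c * Real.exp (-(inner ℝ x (B x) - ‖x‖ ^ 2) / 2)))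
    {s : ℝ} (hs : 0 ≤ s)
    (hmom : ∀ v, ∫⁻ x, ENNReal.ofReal (inner ℝ v x ^ 2) ∂ν ≤ ENNReal.ofReal (s * ‖v‖ ^ 2))
    {A : Set F} (hA : MeasurableSet A) :
    ((stdGaussian F).prod ν) (r ⁻¹' A) ≤
      ((stdGaussian F).prod ν) {z | (ℝ ∙ u)ᗮ.reflection (r z) ∈ A} +
      ENNReal.ofReal (‖B - b • ContinuousLinearMap.id ℝ _‖ * s * Fintype.card ι *
        (4 * √(finrank ℝ F) + 2) / (finrank ℝ F - Fintype.card ι - 4)) := by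
  have hB' : ((B - b • ContinuousLinearMap.id ℝ _ : PiLp 2 (fun _ : ι => F) →L[ℝ] _) :
      PiLp 2 (fun _ : ι => F) →ₗ[ℝ] PiLp 2 (fun _ : ι => F)).IsSymmetric := by
    have : (b • LinearMap.id : PiLp 2 (fun _ : ι => F) →ₗ[ℝ] _).IsSymmetric :=
      LinearMap.IsSymmetric.id.smul (by simp)
    exact hB.sub this
  have hd' : (0 : ℝ) < (finrank ℝ F : ℝ) - Fintype.card ι - 4 := by
    have : (Fintype.card ι : ℝ) + 5 ≤ finrank ℝ F := by exact_mod_cast hd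
    linarith
  have hlin := lintegral_quadIncrement_le hB' hu hd
  have hne : ∀ᵐ x ∂stdGaussian (PiLp 2 (fun _ : ι => F)), ∀ᵐ e ∂stdGaussian F,
      perpPart u (r (e, x)) ≠ 0 := by
    filter_upwards [hproj] with x hx
    simp_rw [hx]
    exact (hlin x).1
  have hprojν : ∀ᵐ x ∂ν, ∀ e,
      r (e, x) = (Submodule.span ℝ (Set.range x))ᗮ.starProjection e := by
    have : ν ≪ stdGaussian (PiLp 2 (fun _ : ι => F)) := by
      rw [hν]
      exact withDensity_absolutelyContinuous _ _
    exact this hproj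
  refine (residual_measure_le hu hr hproj hne B hc hν hA).trans ?_
  gcongr
  have hm : Measurable fun z : F × PiLp 2 (fun _ : ι => F) => (r z, z.2) :=
    hr.prodMk measurable_snd
  have hLm : Measurable fun z : F × PiLp 2 (fun _ : ι => F) =>
      ENNReal.ofReal (quadIncrement B (planeRotation u (r z)) z.2) :=
    ((measurable_quadIncrement_planeRotation B u).comp hm).ennreal_ofReal
  rw [lintegral_prod_symm' _ hLm]
  set B' := B - b • ContinuousLinearMap.id ℝ (PiLp 2 (fun _ : ι => F)) with hB'def
  set D := (finrank ℝ F : ℝ) - Fintype.card ι - 4 with hD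
  calc _ ≤ ∫⁻ x, ENNReal.ofReal (‖B'‖ / D) *
        ENNReal.ofReal (4 * (√(∑ j, inner ℝ u (x j) ^ 2) * ‖x‖) +
        2 * ∑ j, inner ℝ u (x j) ^ 2) ∂ν := by
        refine lintegral_mono_ae ?_
        filter_upwards [hprojν] with x hx
        simp_rw [hx, ← quadIncrement_sub_smul_id B b]
        refine (hlin x).2.trans (le_of_eq ?_)
        rw [← ENNReal.ofReal_mul (by positivity)]
        congr 1
        ring
    _ ≤ ENNReal.ofReal (‖B'‖ / D) *
        ENNReal.ofReal (s * Fintype.card ι * (4 * √(finrank ℝ F) + 2)) := by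
        rw [lintegral_const_mul _ (by fun_prop)]
        gcongr
        exact lintegral_quadratic_le hs hmom hu (by omega)
    _ = _ := by
        rw [← ENNReal.ofReal_mul (by positivity)]
        congr 1
        ring

end ResidualLaw

/-! ### Recentring the precision operator -/

section OperatorNorm

variable {E : Type*} [NormedAddCommGroup E] [InnerProductSpace ℝ E]

/-- A symmetric operator is bounded by its quadratic form, by polarization. -/
theorem opNorm_le_of_abs_inner_self_le {T : E →L[ℝ] E} (hT : (T : E →ₗ[ℝ] E).IsSymmetric) {M : ℝ}
    (hM : 0 ≤ M) (h : ∀ x, |inner ℝ x (T x)| ≤ M * ‖x‖ ^ 2) : ‖T‖ ≤ M := by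
  refine T.opNorm_le_bound hM fun x => ?_
  by_cases hx : T x = 0
  · rw [hx, norm_zero]
    positivity
  have hx0 : x ≠ 0 := fun h0 => hx (by rw [h0, map_zero])
  have hnx : 0 < ‖x‖ := norm_pos_iff.2 hx0
  have hnT : 0 < ‖T x‖ := norm_pos_iff.2 hx
  have hpol : ∀ y, 4 * inner ℝ y (T x) ≤ 2 * M * (‖x‖ ^ 2 + ‖y‖ ^ 2) := by
    intro y
    have h1 := (abs_le.1 (h (x + y))).2
    have h2 := (abs_le.1 (h (x - y))).1
    have h3 : inner ℝ x (T y) = inner ℝ y (T x) := by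
      have := hT x y
      simp only [ContinuousLinearMap.coe_coe] at this
      rw [← this, real_inner_comm]
    have h4 : ‖x + y‖ ^ 2 + ‖x - y‖ ^ 2 = 2 * (‖x‖ ^ 2 + ‖y‖ ^ 2) := by
      rw [norm_add_sq_real, norm_sub_sq_real]
      ring
    simp only [map_add, map_sub, inner_add_left, inner_add_right, inner_sub_left, inner_sub_right,
      h3] at h1 h2
    nlinarith
  have h5 := hpol ((‖x‖ / ‖T x‖) • T x)
  rw [inner_smul_left, real_inner_self_eq_norm_sq, norm_smul, Real.norm_of_nonneg (by positivity),
    div_mul_cancel₀ _ hnT.ne'] at h5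
  have h6 : (starRingEnd ℝ) (‖x‖ / ‖T x‖) * ‖T x‖ ^ 2 = ‖x‖ * ‖T x‖ := by
    simp
    field_simp
  rw [h6] at h5
  have h7 : ‖x‖ * ‖T x‖ ≤ ‖x‖ * (M * ‖x‖) := by nlinarith
  exact le_of_mul_le_mul_left h7 hnx

/-- The spectrum of `B = (R R†)⁻¹` lies between `‖R‖⁻²` and `‖B‖`; subtracting the midpoint of this
interval leaves an operator of norm at most half its length. -/
theorem exists_norm_sub_smul_id_mul_le (R : E ≃L[ℝ] E) {B : E →L[ℝ] E}
    (hsymm : (B : E →ₗ[ℝ] E).IsSymmetric) (hB : ∀ x, inner ℝ (R x) (B (R x)) = ‖x‖ ^ 2)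
    {s : ℝ} (hs : 0 < s) (hR : ‖(R : E →L[ℝ] E)‖ ^ 2 = s) (hκ : 1 ≤ s * ‖B‖) :
    ∃ b : ℝ, ‖B - b • ContinuousLinearMap.id ℝ E‖ * s ≤ (s * ‖B‖ - 1) / 2 := by
  have hlow : ∀ x, ‖x‖ ^ 2 / s ≤ inner ℝ x (B x) := by
    intro x
    have h1 := hB (R.symm x)
    rw [R.apply_symm_apply] at h1
    rw [h1, div_le_iff₀ hs, ← hR, ← mul_pow, mul_comm]
    gcongr
    conv_lhs => rw [← R.apply_symm_apply x]
    exact (R : E →L[ℝ] E).le_opNorm _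
  have hup : ∀ x, inner ℝ x (B x) ≤ ‖B‖ * ‖x‖ ^ 2 := by
    intro x
    calc inner ℝ x (B x) ≤ ‖x‖ * ‖B x‖ := real_inner_le_norm _ _
      _ ≤ ‖x‖ * (‖B‖ * ‖x‖) := by gcongr; exact B.le_opNorm x
      _ = ‖B‖ * ‖x‖ ^ 2 := by ring
  have hκ' : 1 / s ≤ ‖B‖ := by
    rw [div_le_iff₀ hs]
    linarith
  -- the midpoint of the interval `[1 / s, ‖B‖]`
  refine ⟨(‖B‖ + 1 / s) / 2, ?_⟩
  have hc : ∀ y, (((‖B‖ + 1 / s) / 2) • ContinuousLinearMap.id ℝ E) y = ((‖B‖ + 1 / s) / 2) • y :=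
    fun _ => rfl
  have hle : ‖B - ((‖B‖ + 1 / s) / 2) • ContinuousLinearMap.id ℝ E‖ ≤ (‖B‖ - 1 / s) / 2 := by
    refine opNorm_le_of_abs_inner_self_le ?_ (by linarith) fun x => ?_
    · have : (((‖B‖ + 1 / s) / 2) • LinearMap.id : E →ₗ[ℝ] E).IsSymmetric :=
        LinearMap.IsSymmetric.id.smul (by simp)
      exact hsymm.sub this
    · rw [sub_apply, hc, inner_sub_right, inner_smul_right, real_inner_self_eq_norm_sq, abs_le]
      have h1 := hlow x
      have h2 := hup x
      rw [div_eq_mul_one_div] at h1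
      constructor <;> nlinarith
  calc _ ≤ (‖B‖ - 1 / s) / 2 * s := by gcongr
    _ = _ := by field_simp

end OperatorNorm

/-! ### Linear images of the standard Gaussian measure -/

section LinearImage

variable {E : Type*} [NormedAddCommGroup E] [InnerProductSpace ℝ E] [FiniteDimensional ℝ E]
  [MeasurableSpace E] [BorelSpace E]

/-- Density of an invertible linear image of the standard Gaussian measure, relative to the standard
Gaussian measure; `B` is the precision operator `(R R†)⁻¹`. -/
theorem exists_stdGaussian_map_eq_withDensity (R : E ≃L[ℝ] E) {B : E →L[ℝ] E}
    (hB : ∀ x, inner ℝ (R x) (B (R x)) = ‖x‖ ^ 2) :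
    ∃ c : ℝ, 0 ≤ c ∧ (stdGaussian E).map R = (stdGaussian E).withDensity fun x =>
      ENNReal.ofReal (c * Real.exp (-(inner ℝ x (B x) - ‖x‖ ^ 2) / 2)) := by
  set k : ℝ := (2 * Real.pi) ^ (-(Module.finrank ℝ E / 2 : ℝ)) with hk
  have hk0 : 0 ≤ k := by positivity
  have hdet : LinearMap.det (R : E →ₗ[ℝ] E) ≠ 0 :=
    (LinearEquiv.isUnit_det' R.toLinearEquiv).ne_zero
  set c : ℝ := |(LinearMap.det (R : E →ₗ[ℝ] E))⁻¹| with hc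
  refine ⟨c, abs_nonneg _, ?_⟩
  have hvol : (volume : Measure E).map R = ENNReal.ofReal c • volume :=
    Measure.map_linearMap_addHaar_eq_smul_addHaar _ hdet
  have hstd := stdGaussian_eq_withDensity (E := E)
  rw [← hk] at hstd
  have hRm : Measurable R := R.continuous.measurable
  ext A hA
  rw [Measure.map_apply hRm hA, withDensity_apply _ hA]
  conv_rhs => rw [hstd]
  conv_lhs => rw [hstd]
  rw [withDensity_apply _ (hRm hA), ← lintegral_indicator hA, lintegral_withDensity_eq_lintegral_mul _
    (by fun_prop) (Measurable.indicator (by fun_prop) hA), ← lintegral_indicator (hRm hA)]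
  set f : E → ENNReal := A.indicator fun x =>
    ENNReal.ofReal (k * Real.exp (-(1 / 2) * inner ℝ x (B x))) with hf
  have hfm : Measurable f := Measurable.indicator (by fun_prop) hA
  have h1 : ∫⁻ x, f (R x) = ENNReal.ofReal c * ∫⁻ x, f x := by
    rw [← lintegral_map hfm hRm, hvol, lintegral_smul_measure, smul_eq_mul]
  calc _ = ∫⁻ x, f (R x) := by
        refine lintegral_congr fun x => ?_
        by_cases h : R x ∈ A
        · rw [Set.indicator_of_mem (by exact h), hf, Set.indicator_of_mem h, hB]
        · rw [Set.indicator_of_notMem (by exact h), hf, Set.indicator_of_notMem h]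
    _ = _ := by
        rw [h1, ← lintegral_const_mul _ hfm]
        refine lintegral_congr fun x => ?_
        simp only [Pi.mul_apply]
        by_cases h : x ∈ A
        · rw [hf, Set.indicator_of_mem h, Set.indicator_of_mem h, ← ENNReal.ofReal_mul (by positivity),
            ← ENNReal.ofReal_mul (by positivity)]
          congr 1
          calc c * (k * Real.exp (-(1 / 2) * inner ℝ x (B x)))
              = k * c * Real.exp (-(1 / 2) * ‖x‖ ^ 2 + -(inner ℝ x (B x) - ‖x‖ ^ 2) / 2) := by
                rw [mul_left_comm, ← mul_assoc]
                congr 2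
                ring
            _ = _ := by
                rw [Real.exp_add]
                ring
        · rw [hf, Set.indicator_of_notMem h, Set.indicator_of_notMem h]
          simp

theorem lintegral_inner_sq_stdGaussian_map_le (R : E →L[ℝ] E) (v : E) :
    ∫⁻ x, ENNReal.ofReal (inner ℝ v x ^ 2) ∂(stdGaussian E).map R ≤
      ENNReal.ofReal (‖R‖ ^ 2 * ‖v‖ ^ 2) := by
  rw [lintegral_map (by fun_prop) (by fun_prop)]
  simp_rw [← ContinuousLinearMap.adjoint_inner_left]
  rw [lintegral_inner_sq_stdGaussian]
  refine ENNReal.ofReal_le_ofReal ?_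
  rw [← mul_pow]
  gcongr
  refine (ContinuousLinearMap.le_opNorm _ _).trans (le_of_eq ?_)
  rw [LinearIsometryEquiv.norm_map]

end LinearImage

/-- The elementary inequality behind the final constant. -/
theorem residual_bound_le {κ : ℝ} {p m d : ℝ} (hp : 1 ≤ p) (hκ : 1 ≤ κ) (hm : m = d + p)
    (hd : κ * √8 * (p / √d) < 1) (hd0 : 0 < d) :
    5 ≤ d ∧ (κ - 1) / 2 * p * (4 * √m + 2) / (d - 4) ≤ κ * √8 * (p / √d) := by
  have h8 : (0 : ℝ) < √8 := by positivity
  have h8sq : √8 ^ 2 = 8 := Real.sq_sqrt (by norm_num)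
  have h8l : (2.82 : ℝ) ≤ √8 := Real.le_sqrt_of_sq_le (by norm_num)
  have h8u : √8 ≤ (2.83 : ℝ) := Real.sqrt_le_left (by norm_num) |>.mpr (by norm_num)
  set y := √d with hy
  have hy0 : 0 < y := Real.sqrt_pos.2 hd0
  have hyd : y ^ 2 = d := Real.sq_sqrt hd0.le
  have hz : κ * √8 * p < y := by
    rw [← mul_div_assoc, div_lt_one hy0] at hd
    exact hd
  have hpy : √8 * p ≤ κ * √8 * p := by
    have : 0 ≤ (κ - 1) * (√8 * p) := mul_nonneg (by linarith) (by positivity)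
    linarith
  have hp8 : √8 ≤ √8 * p := by nlinarith
  have hy2 : (2.82 : ℝ) < y := by linarith
  have hd5 : 5 ≤ d := by nlinarith
  refine ⟨hd5, ?_⟩
  -- `2.82` is a lower bound for `√8`, so `p ≤ y / 2.82` and `m = y² + p ≤ (y + 0.18)²`
  have hsm : √m ≤ y + 0.18 := by
    refine Real.sqrt_le_iff.2 ⟨by linarith, ?_⟩
    have : 2.82 * p ≤ y := by nlinarith
    rw [hm, ← hyd]
    nlinarith
  have hd4 : 0 < d - 4 := by linarith
  have key : (y - √8 * p) * (2 * √m + 1) ≤ √8 * (d - 4) := by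
    have h1 : 0 ≤ y - √8 * p := by linarith
    calc (y - √8 * p) * (2 * √m + 1) ≤ (y - √8 * p) * (2 * (y + 0.18) + 1) := by gcongr
      _ ≤ (y - 2.82) * (2 * (y + 0.18) + 1) := by
        gcongr
        linarith
      _ ≤ 2.82 * (d - 4) := by
        rw [← hyd]
        nlinarith
      _ ≤ √8 * (d - 4) := by gcongr
  have h1 : κ * √8 * (p / y) * (d - 4) = κ * √8 * p * (d - 4) / y := by ring
  rw [div_le_iff₀ hd4, h1, le_div_iff₀ hy0]
  have h2 : (κ * √8 * p - √8 * p) * y ≤ (κ * √8 * p) * (y - √8 * p) := by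
    have : 0 ≤ √8 * p * (y - κ * √8 * p) := mul_nonneg (by positivity) (by linarith)
    nlinarith
  have h3 : (κ * √8 * p - √8 * p) * y * (2 * √m + 1) ≤ (κ * √8 * p) * (√8 * (d - 4)) := by
    calc _ ≤ (κ * √8 * p) * (y - √8 * p) * (2 * √m + 1) := by gcongr
      _ = (κ * √8 * p) * ((y - √8 * p) * (2 * √m + 1)) := by ring
      _ ≤ _ := by gcongr
  have h4 : √8 * ((κ - 1) / 2 * p * (4 * √m + 2) * y) ≤ √8 * (κ * √8 * p * (d - 4)) := by
    calc _ = (κ * √8 * p - √8 * p) * y * (2 * √m + 1) := by ring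
      _ ≤ _ := h3
      _ = _ := by ring
  exact le_of_mul_le_mul_left h4 h8

namespace FullCP

/-! ### Total variation distance -/

section TotalVariation

variable {E E' : Type*} [MeasurableSpace E] [MeasurableSpace E'] {μ ν : Measure E}

theorem abs_measureReal_sub_le_one [IsProbabilityMeasure μ] [IsProbabilityMeasure ν] (A : Set E) :
    |μ.real A - ν.real A| ≤ 1 := by
  rw [abs_le]
  constructor <;> linarith [measureReal_nonneg (μ := μ) (s := A), measureReal_nonneg (μ := ν) (s := A),
    measureReal_le_one (μ := μ) (s := A), measureReal_le_one (μ := ν) (s := A)]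

theorem abs_measureReal_sub_le_tvDist [IsProbabilityMeasure μ] [IsProbabilityMeasure ν] {A : Set E}
    (hA : MeasurableSet A) : |μ.real A - ν.real A| ≤ tvDist μ ν :=
  le_ciSup (f := fun A : {A : Set E // MeasurableSet A} => |μ.real A.1 - ν.real A.1|)
    ⟨1, by rintro _ ⟨A, rfl⟩; exact abs_measureReal_sub_le_one _⟩ ⟨A, hA⟩

theorem tvDist_le {c : ℝ} (h : ∀ A, MeasurableSet A → |μ.real A - ν.real A| ≤ c) :
    tvDist μ ν ≤ c := by
  have : Nonempty {A : Set E // MeasurableSet A} := ⟨⟨∅, MeasurableSet.empty⟩⟩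
  exact ciSup_le fun A => h A.1 A.2

theorem tvDist_le_one [IsProbabilityMeasure μ] [IsProbabilityMeasure ν] : tvDist μ ν ≤ 1 :=
  tvDist_le fun _ _ => abs_measureReal_sub_le_one _

theorem tvDist_self : tvDist μ μ = 0 := by
  simp [tvDist]

theorem tvDist_map_le [IsProbabilityMeasure μ] [IsProbabilityMeasure ν] {f : E → E'}
    (hf : Measurable f) : tvDist (μ.map f) (ν.map f) ≤ tvDist μ ν := by
  refine tvDist_le fun A hA => ?_
  rw [map_measureReal_apply hf hA, map_measureReal_apply hf hA]
  exact abs_measureReal_sub_le_tvDist (hf hA)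

/-- A one-sided bound on all events bounds the total variation distance, by passing to
complements. -/
theorem tvDist_le_of_measure_le_add [IsProbabilityMeasure μ] [IsProbabilityMeasure ν] {c : ℝ}
    (hc : 0 ≤ c) (h : ∀ A, MeasurableSet A → μ A ≤ ν A + ENNReal.ofReal c) : tvDist μ ν ≤ c := by
  have h' : ∀ A, MeasurableSet A → μ.real A ≤ ν.real A + c := by
    intro A hA
    have := ENNReal.toReal_mono (by finiteness) (h A hA)
    rwa [ENNReal.toReal_add (by finiteness) (by finiteness), ENNReal.toReal_ofReal hc] at this
  refine tvDist_le fun A hA => ?_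
  have h1 := h' A hA
  have h2 := h' Aᶜ hA.compl
  rw [probReal_compl_eq_one_sub hA, probReal_compl_eq_one_sub hA] at h2
  rw [abs_le]
  constructor <;> linarith

end TotalVariation

/-! ### Least squares residuals -/

section LeastSquares

variable {m p : ℕ}

theorem signedResiduals_swapData {n p : ℕ} (i : Fin (n + 1)) (z : Dataset (n + 1) p) :
    signedResiduals leastSquares (swapData i z) =
      fun k => signedResiduals leastSquares z (Equiv.swap i (Fin.last n) k) := by
  set e := Equiv.swap i (Fin.last n)
  have h1 : designMatrix (swapData i z) = (designMatrix z).submatrix e id := rfl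
  have h2 : responses (swapData i z) = responses z ∘ e := rfl
  have h3 : lsCoef (swapData i z) = lsCoef z := by
    rw [lsCoef, lsCoef, h1, h2, Matrix.transpose_submatrix, Matrix.submatrix_mul_equiv,
      Matrix.submatrix_id_id]
    congr 1
    ext j
    simp only [Matrix.mulVec, dotProduct, Matrix.submatrix_apply, id_eq, Function.comp]
    exact Equiv.sum_comp e fun k => (designMatrix z)ᵀ j k * responses z k
  ext k
  simp only [signedResiduals, leastSquares, h3]
  rfl

/-- If the design matrix has full column rank, the residual vector is the projection of the
responses to the orthogonal complement of the columns. -/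
theorem toLp_signedResiduals_eq_starProjection (z : Dataset m p)
    (hz : IsUnit ((designMatrix z)ᵀ * designMatrix z).det) :
    WithLp.toLp 2 (signedResiduals leastSquares z) =
      (Submodule.span ℝ (Set.range fun j : Fin p =>
        (WithLp.toLp 2 fun k => (z k).1 j : EuclideanSpace ℝ (Fin m))))ᗮ.starProjection
        (WithLp.toLp 2 (responses z)) := by
  set K := Submodule.span ℝ (Set.range fun j : Fin p =>
        (WithLp.toLp 2 fun k => (z k).1 j : EuclideanSpace ℝ (Fin m))) with hK
  have hres : signedResiduals leastSquares z = responses z - designMatrix z *ᵥ lsCoef z := rfl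
  symm
  apply Submodule.eq_starProjection_of_mem_orthogonal
  · have h0 : (designMatrix z)ᵀ *ᵥ signedResiduals leastSquares z = 0 := by
      rw [hres, Matrix.mulVec_sub, Matrix.mulVec_mulVec, lsCoef, Matrix.mulVec_mulVec,
        Matrix.mul_nonsing_inv _ hz, Matrix.one_mulVec, sub_self]
    rw [Submodule.mem_orthogonal]
    intro w hw
    induction hw using Submodule.span_induction with
    | mem w hw =>
      obtain ⟨j, rfl⟩ := hw
      have := congrFun h0 j
      rw [PiLp.inner_apply]
      simpa [Matrix.mulVec, dotProduct, designMatrix, mul_comm] using this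
    | zero => simp
    | add a b _ _ ha hb => rw [inner_add_left, ha, hb, add_zero]
    | smul c a _ ha => rw [inner_smul_left, ha, mul_zero]
  · apply K.le_orthogonal_orthogonal
    have : WithLp.toLp 2 (responses z) - WithLp.toLp 2 (signedResiduals leastSquares z) =
        ∑ j, lsCoef z j • (WithLp.toLp 2 fun k => (z k).1 j : EuclideanSpace ℝ (Fin m)) := by
      rw [hres]
      ext k
      simp [Matrix.mulVec, dotProduct, designMatrix, mul_comm]
    rw [this]
    exact K.sum_mem fun j _ => K.smul_mem _ (Submodule.subset_span ⟨j, rfl⟩)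

theorem measurable_det_of_entries {α : Type*} [MeasurableSpace α] {n : Type*} [Fintype n]
    [DecidableEq n] {M : α → Matrix n n ℝ} (hM : ∀ i j, Measurable fun a => M a i j) :
    Measurable fun a => (M a).det := by
  simp_rw [Matrix.det_apply]
  exact Finset.measurable_sum _ fun σ _ =>
    (Finset.measurable_prod _ fun i _ => hM _ _).const_smul (Equiv.Perm.sign σ)

theorem measurable_inv_of_entries {α : Type*} [MeasurableSpace α] {n : Type*} [Fintype n]
    [DecidableEq n] {M : α → Matrix n n ℝ} (hM : ∀ i j, Measurable fun a => M a i j) (i j : n) :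
    Measurable fun a => (M a)⁻¹ i j := by
  simp_rw [Matrix.inv_def, Ring.inverse_eq_inv', Matrix.smul_apply, Matrix.adjugate_apply,
    smul_eq_mul]
  refine (measurable_det_of_entries hM).inv.mul (measurable_det_of_entries fun k l => ?_)
  by_cases h : k = j
  · subst h
    simp
  · simp_rw [Matrix.updateRow_ne h]
    exact hM k l

theorem measurable_signedResiduals_leastSquares :
    Measurable fun z : Dataset m p => signedResiduals leastSquares z := by
  have h1 : ∀ i j, Measurable fun z : Dataset m p =>
      ((designMatrix z)ᵀ * designMatrix z) i j := by
    intro i j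
    simp only [Matrix.mul_apply, Matrix.transpose_apply, designMatrix, Matrix.of_apply]
    fun_prop
  have h2 := measurable_inv_of_entries h1
  refine measurable_pi_lambda _ fun k => ?_
  simp only [signedResiduals, leastSquares, lsCoef, dotProduct, Matrix.mulVec]
  refine Measurable.sub (by fun_prop) (Finset.measurable_sum _ fun i _ => Measurable.mul
    (by fun_prop) (Finset.measurable_sum _ fun j _ => (h2 i j).mul
      (Finset.measurable_sum _ fun l _ => ?_)))
  simp only [Matrix.transpose_apply, designMatrix, Matrix.of_apply, responses]
  fun_prop

end LeastSquares

/-! ### Almost sure full rank -/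

section FullRank

variable {m p : ℕ}

/-- The data set whose covariates are the columns `x` and whose responses are `y`. -/
def ofColumns (y : EuclideanSpace ℝ (Fin m))
    (x : PiLp 2 (fun _ : Fin p => EuclideanSpace ℝ (Fin m))) : Dataset m p :=
  fun k => (fun j => x j k, y k)

/-- The residual vector as a function of the responses and of the columns of the design matrix. -/
noncomputable def residualVector (z : EuclideanSpace ℝ (Fin m) ×
    PiLp 2 (fun _ : Fin p => EuclideanSpace ℝ (Fin m))) : EuclideanSpace ℝ (Fin m) :=
  WithLp.toLp 2 (signedResiduals leastSquares (ofColumns z.1 z.2))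

theorem measurable_residualVector : Measurable (residualVector (m := m) (p := p)) := by
  refine (PiLp.continuous_toLp 2 _).measurable.comp
    (measurable_signedResiduals_leastSquares.comp (measurable_pi_lambda _ fun k => ?_))
  exact (measurable_pi_lambda _ fun j => by fun_prop).prodMk (by fun_prop)

/-- A nonsingular square block of rows forces full column rank. -/
theorem isUnit_det_transpose_mul_self_of_submatrix {A : Matrix (Fin m) (Fin p) ℝ}
    {f : Fin p → Fin m} (h : (A.submatrix f id).det ≠ 0) : IsUnit (Aᵀ * A).det := by
  rw [← Matrix.isUnit_iff_isUnit_det, ← Matrix.mulVec_injective_iff_isUnit,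
    ← Matrix.coe_mulVecLin, ← LinearMap.ker_eq_bot, Matrix.ker_mulVecLin_transpose_mul_self,
    LinearMap.ker_eq_bot']
  intro v hv
  have h1 : A.submatrix f id *ᵥ v = 0 := by
    ext k
    exact congrFun hv (f k)
  exact Matrix.eq_zero_of_mulVec_eq_zero h h1

/-- Almost every design matrix has full column rank: along almost every line parallel to the
identity block, the upper square block is singular in finitely many points only. -/
theorem ae_isUnit_det_gram (hp : p ≤ m) :
    ∀ᵐ x ∂(volume : Measure (PiLp 2 (fun _ : Fin p => EuclideanSpace ℝ (Fin m)))),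
      ∀ y, IsUnit ((designMatrix (ofColumns y x))ᵀ * designMatrix (ofColumns y x)).det := by
  set f : Fin p → Fin m := Fin.castLE hp with hf
  let T : PiLp 2 (fun _ : Fin p => EuclideanSpace ℝ (Fin m)) → Matrix (Fin p) (Fin p) ℝ :=
    fun x => Matrix.of fun k j => x j (f k)
  set N : Set (PiLp 2 (fun _ : Fin p => EuclideanSpace ℝ (Fin m))) := {x | (T x).det = 0} with hN
  have hNm : MeasurableSet N := by
    refine measurableSet_eq_fun (measurable_det_of_entries fun i j => ?_) measurable_const
    simp only [T, Matrix.of_apply]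
    fun_prop
  suffices hN0 : volume N = 0 by
    have : ∀ᵐ x ∂(volume : Measure (PiLp 2 (fun _ : Fin p => EuclideanSpace ℝ (Fin m)))),
      x ∉ N := measure_eq_zero_iff_ae_notMem.1 hN0
    filter_upwards [this] with x hx y
    exact isUnit_det_transpose_mul_self_of_submatrix (f := f) hx
  -- moving along `e0` changes the upper square block by a multiple of the identity, so its determinant
  -- is a characteristic polynomial in the parameter of the line
  let e0 : PiLp 2 (fun _ : Fin p => EuclideanSpace ℝ (Fin m)) :=
    WithLp.toLp 2 fun j => WithLp.toLp 2 fun k => if k = f j then 1 else 0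
  have hT : ∀ x (t : ℝ), T (x + t • e0) = Matrix.scalar (Fin p) t - (-T x) := by
    intro x t
    ext k j
    by_cases hkj : k = j
    · subst hkj
      simp [T, e0, add_comm]
    · have : f k ≠ f j := fun h => hkj (Fin.castLE_injective hp h)
      simp [T, e0, hkj, this]
  -- the exceptional parameters are roots of a monic polynomial
  have hfin : ∀ x, {t : ℝ | x + t • e0 ∈ N}.Finite := by
    intro x
    have hne : (-T x).charpoly ≠ 0 := (Matrix.charpoly_monic _).ne_zero
    refine ((-T x).charpoly.roots.toFinset.finite_toSet).subset fun t ht => ?_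
    have ht' : (T (x + t • e0)).det = 0 := ht
    rw [hT, ← Matrix.eval_charpoly] at ht'
    simp [Polynomial.mem_roots hne, ht']
  set W : Set (PiLp 2 (fun _ : Fin p => EuclideanSpace ℝ (Fin m)) × ℝ) :=
    {z | z.1 + z.2 • e0 ∈ N} with hW
  have hWm : MeasurableSet W := by
    have : Measurable fun z : PiLp 2 (fun _ : Fin p => EuclideanSpace ℝ (Fin m)) × ℝ =>
      z.1 + z.2 • e0 := by fun_prop
    exact this hNm
  have h1 : ((volume : Measure (PiLp 2 (fun _ : Fin p => EuclideanSpace ℝ (Fin m)))).prod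
      (volume.restrict (Set.Icc (0 : ℝ) 1))) W = 0 := by
    rw [Measure.prod_apply hWm]
    refine (lintegral_congr fun x => ?_).trans lintegral_zero
    refine Measure.absolutelyContinuous_of_le Measure.restrict_le_self ?_
    exact (hfin x).measure_zero _
  have h2 : ((volume : Measure (PiLp 2 (fun _ : Fin p => EuclideanSpace ℝ (Fin m)))).prod
      (volume.restrict (Set.Icc (0 : ℝ) 1))) W = volume N := by
    rw [Measure.prod_apply_symm hWm]
    have : ∀ t : ℝ, volume ((fun x => (x, t)) ⁻¹' W) = volume N := fun t =>
      measure_preimage_add_right volume (t • e0) N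
    simp_rw [this]
    simp
  rw [← h2, h1]

theorem ae_residualVector_eq (hp : p ≤ m) :
    ∀ᵐ x ∂(volume : Measure (PiLp 2 (fun _ : Fin p => EuclideanSpace ℝ (Fin m)))), ∀ e,
      residualVector (e, x) = (Submodule.span ℝ (Set.range x))ᗮ.starProjection e := by
  filter_upwards [ae_isUnit_det_gram hp] with x hx e
  exact toLp_signedResiduals_eq_starProjection _ (hx e)

end FullRank

/-! ### The columns of a Gaussian vectorization -/

section Columns

variable (m p : ℕ)

/-- The isometry which splits `vec X` into the columns of `X`. -/
noncomputable def columnsEquiv : EuclideanSpace ℝ (Fin p × Fin m) ≃ₗᵢ[ℝ]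
    PiLp 2 (fun _ : Fin p => EuclideanSpace ℝ (Fin m)) where
  toFun x := WithLp.toLp 2 fun j => WithLp.toLp 2 fun k => x (j, k)
  invFun y := WithLp.toLp 2 fun jk => y jk.1 jk.2
  left_inv _ := rfl
  right_inv _ := rfl
  map_add' _ _ := rfl
  map_smul' _ _ := rfl
  norm_map' x := by
    rw [← sq_eq_sq₀ (norm_nonneg _) (norm_nonneg _), PiLp.norm_sq_eq_of_L2,
      EuclideanSpace.real_norm_sq_eq, Fintype.sum_prod_type]
    simp only [EuclideanSpace.real_norm_sq_eq]
    rfl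

end Columns

/-! ### Exchange of coordinates as a reflection -/

section Swap

variable {m : ℕ}

/-- The unit vector along the difference of two coordinate vectors. -/
noncomputable def swapAxis (i l : Fin m) : EuclideanSpace ℝ (Fin m) :=
  (√2)⁻¹ • (EuclideanSpace.single i 1 - EuclideanSpace.single l 1)

theorem norm_swapAxis {i l : Fin m} (h : i ≠ l) : ‖swapAxis i l‖ = 1 := by
  have h1 : ‖(EuclideanSpace.single i 1 - EuclideanSpace.single l 1 :
      EuclideanSpace ℝ (Fin m))‖ ^ 2 = 2 := by
    rw [norm_sub_sq_real]
    simp [EuclideanSpace.inner_single_left, h.symm]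
    norm_num
  rw [swapAxis, norm_smul, ← Real.sqrt_sq (norm_nonneg (_ - _)), h1, norm_inv,
    Real.norm_of_nonneg (by positivity), inv_mul_cancel₀ (by positivity)]

/-- The reflection along `swapAxis i l` exchanges the coordinates `i` and `l`. -/
theorem reflection_swapAxis {i l : Fin m} (h : i ≠ l) (y : EuclideanSpace ℝ (Fin m)) :
    (ℝ ∙ swapAxis i l)ᗮ.reflection y = WithLp.toLp 2 fun k => y (Equiv.swap i l k) := by
  have h2 : (√2)⁻¹ * (√2)⁻¹ = (1 / 2 : ℝ) := by
    rw [← mul_inv, Real.mul_self_sqrt (by norm_num)]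
    norm_num
  have h3 : (2 * (inner ℝ (swapAxis i l) y / ‖swapAxis i l‖ ^ 2)) • swapAxis i l =
      (y i - y l) • (EuclideanSpace.single i 1 - EuclideanSpace.single l 1) := by
    rw [norm_swapAxis h, swapAxis, inner_smul_left, inner_sub_left, smul_smul]
    congr 1
    simp only [EuclideanSpace.inner_single_left, map_one, one_mul, conj_trivial]
    linear_combination (2 * (y i - y l)) * h2
  rw [reflection_orthogonal_singleton_apply, h3]
  ext k
  by_cases hi : k = i
  · subst hi
    simp [h]
  · by_cases hl : k = l
    · subst hl
      simp [h.symm]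
    · simp [Equiv.swap_apply_of_ne_of_ne hi hl, hi, hl]

end Swap

/-! ### Gaussian design matrices -/

section Gaussian

open Matrix

variable {m p : ℕ}

open scoped Matrix.Norms.L2Operator MatrixOrder in
/-- The law of the columns of a matrix whose vectorization is Gaussian with covariance `S`, as the
image of the standard Gaussian measure under the square root `R` of `S`; `B` is the precision
operator. -/
theorem exists_map_columnsEquiv_multivariateGaussian
    {S : Matrix (Fin p × Fin m) (Fin p × Fin m) ℝ} (hS : S.PosDef) :
    ∃ (R : PiLp 2 (fun _ : Fin p => EuclideanSpace ℝ (Fin m)) ≃L[ℝ] PiLp 2 (fun _ : Fin p => EuclideanSpace ℝ (Fin m)))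
      (B : PiLp 2 (fun _ : Fin p => EuclideanSpace ℝ (Fin m)) →L[ℝ] PiLp 2 (fun _ : Fin p => EuclideanSpace ℝ (Fin m))),
      (multivariateGaussian 0 S).map (columnsEquiv m p) = (stdGaussian _).map R ∧
      (B : PiLp 2 (fun _ : Fin p => EuclideanSpace ℝ (Fin m)) →ₗ[ℝ] PiLp 2 (fun _ : Fin p => EuclideanSpace ℝ (Fin m))).IsSymmetric ∧
      (∀ x, inner ℝ (R x) (B (R x)) = ‖x‖ ^ 2) ∧
      ‖(R : PiLp 2 (fun _ : Fin p => EuclideanSpace ℝ (Fin m)) →L[ℝ] PiLp 2 (fun _ : Fin p => EuclideanSpace ℝ (Fin m)))‖ ^ 2 = ‖S‖ ∧ ‖B‖ = ‖S⁻¹‖ := by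
  set J := columnsEquiv m p with hJ
  set r := toEuclideanCLM (𝕜 := ℝ) (CFC.sqrt S) with hr
  have hrsa : IsSelfAdjoint r := (CFC.sqrt_nonneg S).isSelfAdjoint.map _
  have hrr : r * r = toEuclideanCLM (𝕜 := ℝ) S := by
    rw [hr, ← map_mul, CFC.sqrt_mul_sqrt_self _ hS.posSemidef.nonneg]
  have hdet : IsUnit S.det := (Matrix.isUnit_iff_isUnit_det S).1 hS.isUnit
  set q := toEuclideanCLM (𝕜 := ℝ) S⁻¹ with hq
  have hqS : q * (r * r) = 1 := by
    rw [hrr, hq, ← map_mul, Matrix.nonsing_inv_mul _ hdet, map_one]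
  have hSq : (r * r) * q = 1 := by
    rw [hrr, hq, ← map_mul, Matrix.mul_nonsing_inv _ hdet, map_one]
  have hrqr : r * q * r = 1 := by
    have h1 : r * q * r = q * (r * r) * (r * q * r) := by rw [hqS, one_mul]
    have h2 : q * (r * r) * (r * q * r) = q * r * ((r * r) * q) * r := by simp only [mul_assoc]
    rw [h1, h2, hSq, mul_one, mul_assoc, hqS]
  let ru : (EuclideanSpace ℝ (Fin p × Fin m) →L[ℝ] EuclideanSpace ℝ (Fin p × Fin m))ˣ :=
    ⟨r, r * q, by rw [← mul_assoc, hSq], hrqr⟩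
  let R : PiLp 2 (fun _ : Fin p => EuclideanSpace ℝ (Fin m)) ≃L[ℝ]
      PiLp 2 (fun _ : Fin p => EuclideanSpace ℝ (Fin m)) :=
    (J.symm.toContinuousLinearEquiv.trans (ContinuousLinearEquiv.ofUnit ru)).trans
      J.toContinuousLinearEquiv
  have hRapp : ∀ x, R x = J (r (J.symm x)) := fun x => rfl
  let Jc : EuclideanSpace ℝ (Fin p × Fin m) →L[ℝ] PiLp 2 (fun _ : Fin p => EuclideanSpace ℝ (Fin m)) :=
    J.toContinuousLinearEquiv
  let Jc' : PiLp 2 (fun _ : Fin p => EuclideanSpace ℝ (Fin m)) →L[ℝ] EuclideanSpace ℝ (Fin p × Fin m) :=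
    J.symm.toContinuousLinearEquiv
  let B : PiLp 2 (fun _ : Fin p => EuclideanSpace ℝ (Fin m)) →L[ℝ]
      PiLp 2 (fun _ : Fin p => EuclideanSpace ℝ (Fin m)) := Jc ∘L (q ∘L Jc')
  have hBapp : ∀ x, B x = J (q (J.symm x)) := fun x => rfl
  have hnormconj : ∀ t : EuclideanSpace ℝ (Fin p × Fin m) →L[ℝ] EuclideanSpace ℝ (Fin p × Fin m),
      ‖Jc ∘L (t ∘L Jc')‖ = ‖t‖ := by
    intro t
    have h1 : ‖Jc ∘L (t ∘L Jc')‖ = ‖t ∘L Jc'‖ :=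
      LinearIsometry.norm_toContinuousLinearMap_comp J.toLinearIsometry (g := t ∘L Jc')
    have h2 : ‖t ∘L Jc'‖ = ‖t‖ := ContinuousLinearMap.opNorm_comp_linearIsometryEquiv t J.symm
    exact h1.trans h2
  have hqsa : IsSelfAdjoint q := by
    have : IsSelfAdjoint S⁻¹ := hS.inv.isHermitian
    exact this.map _
  have hBsymm : (B : PiLp 2 (fun _ : Fin p => EuclideanSpace ℝ (Fin m)) →ₗ[ℝ] _).IsSymmetric := by
    intro x y
    simp only [ContinuousLinearMap.coe_coe, hBapp]
    have h1 := hqsa.isSymmetric (J.symm x) (J.symm y)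
    simp only [ContinuousLinearMap.coe_coe] at h1
    rw [J.inner_map_eq_flip, h1, J.symm.inner_map_eq_flip, J.symm_symm]
  have hB : ∀ x, inner ℝ (R x) (B (R x)) = ‖x‖ ^ 2 := by
    intro x
    have h1 := hrsa.isSymmetric (J.symm x) (q (r (J.symm x)))
    simp only [ContinuousLinearMap.coe_coe] at h1
    have h2 : r (q (r (J.symm x))) = J.symm x := by
      change (r * q * r) (J.symm x) = J.symm x
      rw [hrqr]
      rfl
    rw [hBapp, hRapp, J.symm_apply_apply, J.inner_map_map, h1, h2, real_inner_self_eq_norm_sq,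
      LinearIsometryEquiv.norm_map]
  have hRnorm : ‖(R : PiLp 2 (fun _ : Fin p => EuclideanSpace ℝ (Fin m)) →L[ℝ]
      PiLp 2 (fun _ : Fin p => EuclideanSpace ℝ (Fin m)))‖ ^ 2 = ‖S‖ := by
    have h1 : ‖(R : PiLp 2 (fun _ : Fin p => EuclideanSpace ℝ (Fin m)) →L[ℝ]
      PiLp 2 (fun _ : Fin p => EuclideanSpace ℝ (Fin m)))‖ = ‖r‖ := hnormconj r
    rw [h1, ← hrsa.norm_mul_self, hrr, Matrix.cstar_norm_def]
  have hBnorm : ‖B‖ = ‖S⁻¹‖ := (hnormconj q).trans (Matrix.cstar_norm_def _).symm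
  refine ⟨R, B, ?_, hBsymm, hB, hRnorm, hBnorm⟩
  rw [multivariateGaussian, ← stdGaussian_map J.symm, Measure.map_map (by fun_prop)
    (by fun_prop), Measure.map_map (by fun_prop) (by fun_prop)]
  congr 1
  ext x
  simp [hRapp, hr]

open scoped Matrix.Norms.L2Operator MatrixOrder in
/-- Total variation bound for the law of the residual vector and its image under the exchange of
two coordinates, when noise is standard Gaussian. -/
theorem tvDist_residual_swap_le {S : Matrix (Fin p × Fin m) (Fin p × Fin m) ℝ} (hS : S.PosDef)
    (hp0 : 0 < p) (hpm : p + 5 ≤ m) (hκ : 1 ≤ condNumber S) {i l : Fin m} (hil : i ≠ l) :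
    tvDist (((stdGaussian (EuclideanSpace ℝ (Fin m))).prod
        ((multivariateGaussian 0 S).map (columnsEquiv m p))).map residualVector)
      ((((stdGaussian (EuclideanSpace ℝ (Fin m))).prod
        ((multivariateGaussian 0 S).map (columnsEquiv m p))).map residualVector).map
          (ℝ ∙ swapAxis i l)ᗮ.reflection) ≤
      (condNumber S - 1) / 2 * p * (4 * √m + 2) / (m - p - 4) := by
  obtain ⟨R, B, hνR, hBsymm, hB, hRnorm, hBnorm⟩ :=
    exists_map_columnsEquiv_multivariateGaussian (m := m) (p := p) hS
  have hcond : ‖S‖ * ‖B‖ = condNumber S := by rw [hBnorm, condNumber]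
  have hSpos : 0 < ‖S‖ := by
    refine (norm_nonneg S).lt_of_ne fun h0 => ?_
    rw [condNumber, ← h0, zero_mul] at hκ
    linarith
  set ν := (multivariateGaussian 0 S).map (columnsEquiv m p) with hν
  have hνp : IsProbabilityMeasure ν := Measure.isProbabilityMeasure_map (by fun_prop)
  obtain ⟨c, hc, hdens⟩ := exists_stdGaussian_map_eq_withDensity R hB
  obtain ⟨b, hb⟩ := exists_norm_sub_smul_id_mul_le R hBsymm hB hSpos hRnorm (by rw [hcond]; exact hκ)
  rw [hcond] at hb
  have hmres := measurable_residualVector (m := m) (p := p)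
  have hprob := Measure.isProbabilityMeasure_map (μ := (stdGaussian (EuclideanSpace ℝ (Fin m))).prod ν)
    hmres.aemeasurable
  have hrefl : Measurable (ℝ ∙ swapAxis i l)ᗮ.reflection := by fun_prop
  have hprob' := Measure.isProbabilityMeasure_map
    (μ := ((stdGaussian (EuclideanSpace ℝ (Fin m))).prod ν).map residualVector) hrefl.aemeasurable
  have hmp : (0 : ℝ) < m - p - 4 := by
    have : (p : ℝ) + 5 ≤ m := by exact_mod_cast hpm
    linarith
  have hbound0 : 0 ≤ (condNumber S - 1) / 2 * p * (4 * √m + 2) / (m - p - 4) := by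
    have : 0 ≤ condNumber S - 1 := by linarith
    positivity
  refine tvDist_le_of_measure_le_add hbound0 fun A hA => ?_
  rw [Measure.map_map hrefl hmres, Measure.map_apply hmres hA,
    Measure.map_apply (hrefl.comp hmres) hA]
  have hmain := residual_measure_le_add (norm_swapAxis hil) hmres
    (stdGaussian_absolutelyContinuous (ae_residualVector_eq (by omega)))
    (by simpa using hpm) b hBsymm hc (hνR.trans hdens) hSpos.le
    (fun v => by
      rw [hνR, ← hRnorm]
      exact lintegral_inner_sq_stdGaussian_map_le _ v) hA
  refine hmain.trans ?_
  simp only [Fintype.card_fin, finrank_euclideanSpace]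
  refine add_le_add le_rfl (ENNReal.ofReal_le_ofReal ?_)
  gcongr

/-- Nondegenerate Gaussian columns have a density, so that properties of Lebesgue-almost every design
matrix hold almost surely. -/
theorem map_columnsEquiv_multivariateGaussian_absolutelyContinuous
    {S : Matrix (Fin p × Fin m) (Fin p × Fin m) ℝ} (hS : S.PosDef) :
    (multivariateGaussian 0 S).map (columnsEquiv m p) ≪ volume := by
  obtain ⟨R, B, hνR, -, hB, -⟩ := exists_map_columnsEquiv_multivariateGaussian (m := m) (p := p) hS
  obtain ⟨c, -, hdens⟩ := exists_stdGaussian_map_eq_withDensity R hB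
  rw [hνR, hdens]
  exact (withDensity_absolutelyContinuous _ _).trans stdGaussian_absolutelyContinuous

end Gaussian

/-! ### Residuals in the linear model -/

section ResidualLaw

open Matrix

variable {m p : ℕ}

theorem residualVector_smul (c : ℝ) (z : EuclideanSpace ℝ (Fin m) ×
    PiLp 2 (fun _ : Fin p => EuclideanSpace ℝ (Fin m))) :
    residualVector (c • z.1, z.2) = c • residualVector z := by
  have h2 : lsCoef (ofColumns (c • z.1) z.2) = c • lsCoef (ofColumns z.1 z.2) := by
    have h1 : responses (ofColumns (c • z.1) z.2) = c • responses (ofColumns z.1 z.2) := rfl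
    rw [lsCoef, h1, Matrix.mulVec_smul, Matrix.mulVec_smul]
    rfl
  ext k
  simp only [residualVector, signedResiduals, leastSquares, h2, dotProduct_smul]
  simp [signedResiduals, leastSquares, ofColumns, mul_sub]

/-- In the linear model the signal lies in the span of the columns and does not contribute to the
residuals. -/
theorem signedResiduals_eq_residualVector {z : Dataset m p} {β : Fin p → ℝ} {e : Fin m → ℝ}
    {x : PiLp 2 (fun _ : Fin p => EuclideanSpace ℝ (Fin m))}
    (hx : ∀ k j, (z k).1 j = x j k) (he : ∀ k, (z k).2 = (z k).1 ⬝ᵥ β + e k)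
    (hunit : ∀ y, IsUnit ((designMatrix (ofColumns y x))ᵀ * designMatrix (ofColumns y x)).det) :
    WithLp.toLp 2 (signedResiduals leastSquares z) = residualVector (WithLp.toLp 2 e, x) := by
  have hz : designMatrix z = designMatrix (ofColumns (WithLp.toLp 2 e) x) := by
    ext k j
    exact hx k j
  have hcols : (fun j : Fin p => (WithLp.toLp 2 fun k => (z k).1 j : EuclideanSpace ℝ (Fin m))) =
      x := by
    ext j k
    exact hx k j
  rw [residualVector, toLp_signedResiduals_eq_starProjection _ (hz ▸ hunit _),
    toLp_signedResiduals_eq_starProjection _ (hunit _), hcols]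
  have h1 : (fun j : Fin p => (WithLp.toLp 2 fun k => (ofColumns (WithLp.toLp 2 e) x k).1 j :
      EuclideanSpace ℝ (Fin m))) = x := rfl
  rw [h1]
  set K := Submodule.span ℝ (Set.range x)
  have h2 : WithLp.toLp 2 (responses z) = ∑ j, β j • x j + WithLp.toLp 2 e := by
    ext k
    simp [responses, he, dotProduct, hx, mul_comm]
  have h3 : Kᗮ.starProjection (∑ j, β j • x j) = 0 := by
    rw [Submodule.starProjection_apply_eq_zero_iff]
    exact K.le_orthogonal_orthogonal
      (K.sum_mem fun j _ => K.smul_mem _ (Submodule.subset_span ⟨j, rfl⟩))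
  rw [h2, map_add, h3, zero_add]
  rfl

/-- The noise of the linear model is `σ` times a standard Gaussian vector. -/
theorem map_toLp_pi_gaussianReal (σ : ℝ≥0) :
    (Measure.pi fun _ : Fin m => gaussianReal 0 (σ ^ 2)).map (WithLp.toLp 2) =
      (stdGaussian (EuclideanSpace ℝ (Fin m))).map fun e => (σ : ℝ) • e := by
  have h1 : gaussianReal 0 (σ ^ 2) = (gaussianReal 0 1).map fun x => (σ : ℝ) * x := by
    rw [gaussianReal_map_const_mul]
    congr 1
    · simp
    · ext
      simp
  have h2 : (Measure.pi fun _ : Fin m => gaussianReal 0 (σ ^ 2)) =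
      (Measure.pi fun _ : Fin m => gaussianReal 0 1).map fun x k => (σ : ℝ) * x k := by
    rw [h1]
    have : IsProbabilityMeasure ((gaussianReal 0 1).map fun x => (σ : ℝ) * x) := h1 ▸ inferInstance
    rw [Measure.pi_map_pi fun _ => by fun_prop]
  rw [h2, ← map_pi_eq_stdGaussian, Measure.map_map (by fun_prop) (by fun_prop),
    Measure.map_map (by fun_prop) (by fun_prop)]
  rfl

variable {Ω : Type*} [MeasurableSpace Ω] {P : Measure Ω} [IsProbabilityMeasure P]
  {S : Matrix (Fin p × Fin m) (Fin p × Fin m) ℝ} {β : Fin p → ℝ} {σ : ℝ≥0}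
  {X : Ω → Fin m → Fin p → ℝ} {Y : Ω → Fin m → ℝ}

/-- The law of the residuals in the linear model with Gaussian covariates. -/
theorem hasLaw_signedResiduals (hpm : p ≤ m) (hS : S.PosDef) (hX : HasGaussianCovariates P X S)
    (hY : IsLinearModel P X Y β σ) :
    HasLaw (fun ω => signedResiduals leastSquares (dataset X Y ω))
      ((((stdGaussian (EuclideanSpace ℝ (Fin m))).prod
        ((multivariateGaussian 0 S).map (columnsEquiv m p))).map residualVector).map
          fun v k => (σ : ℝ) * v k) P := by
  obtain ⟨ε, hε, hind, hYε⟩ := hY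
  set ν := (multivariateGaussian 0 S).map (columnsEquiv m p) with hν
  set V : Ω → PiLp 2 (fun _ : Fin p => EuclideanSpace ℝ (Fin m)) := fun ω =>
    columnsEquiv m p (WithLp.toLp 2 (Matrix.vec (Matrix.of (X ω)))) with hVdef
  have hVx : ∀ ω k j, X ω k j = V ω j k := fun ω k j => rfl
  have hV : HasLaw V ν P :=
    HasLaw.comp (X := fun ω => WithLp.toLp 2 (Matrix.vec (Matrix.of (X ω))))
      (Y := columnsEquiv m p) ⟨by fun_prop, rfl⟩ hX
  have hU : HasLaw (fun ω => (WithLp.toLp 2 (ε ω) : EuclideanSpace ℝ (Fin m)))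
      ((stdGaussian (EuclideanSpace ℝ (Fin m))).map fun e => (σ : ℝ) • e) P :=
    HasLaw.comp (X := ε) (Y := fun v => (WithLp.toLp 2 v : EuclideanSpace ℝ (Fin m)))
      ⟨by fun_prop, map_toLp_pi_gaussianReal σ⟩ hε
  have hindUV : IndepFun (fun ω => (WithLp.toLp 2 (ε ω) : EuclideanSpace ℝ (Fin m))) V P := by
    have h1 : Measurable fun x : Fin m → Fin p → ℝ =>
        columnsEquiv m p (WithLp.toLp 2 (Matrix.vec (Matrix.of x))) := by
      refine (columnsEquiv m p).continuous.measurable.comp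
        ((PiLp.continuous_toLp 2 _).measurable.comp (measurable_pi_lambda _ fun jk => ?_))
      simp only [Matrix.vec, Matrix.of_apply]
      fun_prop
    exact hind.symm.comp (φ := fun v => (WithLp.toLp 2 v : EuclideanSpace ℝ (Fin m)))
      (by fun_prop) h1
  have hνp : IsProbabilityMeasure ν := Measure.isProbabilityMeasure_map (by fun_prop)
  have hUV := IndepFun.hasLaw_prod hU hV hindUV
  have hmres := measurable_residualVector (m := m) (p := p)
  have hgood : ∀ᵐ ω ∂P, ∀ y, IsUnit
      ((designMatrix (ofColumns y (V ω)))ᵀ * designMatrix (ofColumns y (V ω))).det := by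
    have h := hV.map_eq
    refine ae_of_ae_map (p := fun x => ∀ y, IsUnit
      ((designMatrix (ofColumns y x))ᵀ * designMatrix (ofColumns y x)).det) hV.aemeasurable ?_
    rw [h]
    exact map_columnsEquiv_multivariateGaussian_absolutelyContinuous hS (ae_isUnit_det_gram hpm)
  have hmres' : Measurable fun z => WithLp.ofLp (residualVector (m := m) (p := p) z) :=
    (PiLp.continuous_ofLp 2 _).measurable.comp hmres
  have hmap : (((stdGaussian (EuclideanSpace ℝ (Fin m))).map fun e => (σ : ℝ) • e).prod ν).map
      (fun z => WithLp.ofLp (residualVector z)) =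
      (((stdGaussian (EuclideanSpace ℝ (Fin m))).prod ν).map residualVector).map
        fun v k => (σ : ℝ) * v k := by
    have h1 : ((stdGaussian (EuclideanSpace ℝ (Fin m))).map fun e => (σ : ℝ) • e).prod ν =
        ((stdGaussian (EuclideanSpace ℝ (Fin m))).prod ν).map
          (Prod.map (fun e => (σ : ℝ) • e) id) := by
      rw [← Measure.map_prod_map _ _ (by fun_prop) measurable_id, Measure.map_id]
    rw [h1, Measure.map_map hmres' (by fun_prop), Measure.map_map (by fun_prop) hmres]
    congr 1
    ext z k
    simp only [Function.comp_apply, Prod.map, id]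
    rw [residualVector_smul]
    rfl
  have hlaw := HasLaw.comp (Y := fun z => WithLp.ofLp (residualVector z))
    ⟨hmres'.aemeasurable, hmap⟩ hUV
  refine hlaw.congr ?_
  filter_upwards [hgood, hYε] with ω hω hYω
  have h := signedResiduals_eq_residualVector (z := dataset X Y ω) (hVx ω) (fun k => hYω k) hω
  exact congrArg WithLp.ofLp h

end ResidualLaw

/-! ### Total variation bound for the residuals -/

section TotalVariationBound

variable {Ω : Type*} [MeasurableSpace Ω] {P : Measure Ω} [IsProbabilityMeasure P] {n p : ℕ}
  {S : Matrix (Fin p × Fin (n + 1)) (Fin p × Fin (n + 1)) ℝ} {β : Fin p → ℝ} {σ : ℝ≥0}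
  {X : Ω → Fin (n + 1) → Fin p → ℝ} {Y : Ω → Fin (n + 1) → ℝ}

/-- Without covariates the residual vector is the noise. -/
theorem map_residualVector_of_isEmpty {m : ℕ}
    {ν : Measure (PiLp 2 (fun _ : Fin 0 => EuclideanSpace ℝ (Fin m)))} [IsProbabilityMeasure ν] :
    ((stdGaussian (EuclideanSpace ℝ (Fin m))).prod ν).map residualVector =
      stdGaussian (EuclideanSpace ℝ (Fin m)) := by
  have : (residualVector : EuclideanSpace ℝ (Fin m) ×
      PiLp 2 (fun _ : Fin 0 => EuclideanSpace ℝ (Fin m)) → _) = Prod.fst := by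
    ext z k
    simp [residualVector, signedResiduals, leastSquares, ofColumns]
  rw [this]
  exact Measure.fst_prod

open scoped Matrix.Norms.L2Operator in
theorem one_le_condNumber (hS : S.PosDef) (hp : 0 < p) : 1 ≤ condNumber S := by
  have hne : Nonempty (Fin p × Fin (n + 1)) := ⟨(⟨0, hp⟩, 0)⟩
  have hdet : IsUnit S.det := (Matrix.isUnit_iff_isUnit_det S).1 hS.isUnit
  have h1 : ‖(1 : Matrix (Fin p × Fin (n + 1)) (Fin p × Fin (n + 1)) ℝ)‖ = 1 := norm_one
  rw [condNumber, ← h1, ← Matrix.mul_nonsing_inv S hdet]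
  exact norm_mul_le _ _

open scoped Matrix.Norms.L2Operator in
theorem condNumber_nonneg : 0 ≤ condNumber S := mul_nonneg (norm_nonneg _) (norm_nonneg _)

/-- The bound for signed residuals. It is trivial when the right-hand side is at least `1`; otherwise
the number of residual degrees of freedom is large enough for the inverse moment in
`tvDist_residual_swap_le` to be finite. -/
theorem tvDistLaw_signedResiduals_le (hpn : p ≤ n) (hS : S.PosDef)
    (hX : HasGaussianCovariates P X S) (hY : IsLinearModel P X Y β σ) (i : Fin (n + 1)) :
    tvDistLaw P (fun ω => signedResiduals leastSquares (dataset X Y ω))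
      (fun ω => signedResiduals leastSquares (swapData i (dataset X Y ω))) ≤
      condNumber S * √8 * (p / √((n : ℝ) + 1 - p)) := by
  have hlaw := hasLaw_signedResiduals (by omega) hS hX hY
  have hbound0 : 0 ≤ condNumber S * √8 * (p / √((n : ℝ) + 1 - p)) := by
    have := condNumber_nonneg (S := S)
    positivity
  set ρ := ((stdGaussian (EuclideanSpace ℝ (Fin (n + 1)))).prod
        ((multivariateGaussian 0 S).map (columnsEquiv (n + 1) p))).map residualVector with hρ
  have hνp : IsProbabilityMeasure ((multivariateGaussian 0 S).map (columnsEquiv (n + 1) p)) :=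
    Measure.isProbabilityMeasure_map (by fun_prop)
  have hρp : IsProbabilityMeasure ρ :=
    Measure.isProbabilityMeasure_map measurable_residualVector.aemeasurable
  simp_rw [signedResiduals_swapData]
  by_cases hil : i = Fin.last n
  · subst hil
    simp only [Equiv.swap_self, Equiv.refl_apply]
    rw [tvDistLaw, tvDist_self]
    exact hbound0
  set τ : EuclideanSpace ℝ (Fin (n + 1)) → EuclideanSpace ℝ (Fin (n + 1)) :=
    (ℝ ∙ swapAxis i (Fin.last n))ᗮ.reflection with hτ
  have hτm : Measurable τ := by rw [hτ]; fun_prop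
  have hτp : IsProbabilityMeasure (ρ.map τ) := Measure.isProbabilityMeasure_map hτm.aemeasurable
  set g : EuclideanSpace ℝ (Fin (n + 1)) → Fin (n + 1) → ℝ := fun v k => (σ : ℝ) * v k with hg
  have hgm : Measurable g := by fun_prop
  have hmap1 : P.map (fun ω => signedResiduals leastSquares (dataset X Y ω)) = ρ.map g :=
    hlaw.map_eq
  have hmap2 : P.map (fun ω k => signedResiduals leastSquares (dataset X Y ω)
      (Equiv.swap i (Fin.last n) k)) = (ρ.map τ).map g := by
    have hsw : Measurable fun (v : Fin (n + 1) → ℝ) k => v (Equiv.swap i (Fin.last n) k) := by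
      fun_prop
    have h1 := AEMeasurable.map_map_of_aemeasurable hsw.aemeasurable hlaw.aemeasurable
    have h2 : P.map (fun ω k => signedResiduals leastSquares (dataset X Y ω)
      (Equiv.swap i (Fin.last n) k)) = (ρ.map g).map
        (fun (v : Fin (n + 1) → ℝ) k => v (Equiv.swap i (Fin.last n) k)) := by
      rw [← hmap1]
      exact h1.symm
    rw [h2, Measure.map_map hsw hgm, Measure.map_map hgm hτm]
    congr 1
    ext v k
    simp only [Function.comp_apply, hg, hτ, reflection_swapAxis hil]
  rw [tvDistLaw, hmap1, hmap2]
  by_cases hbig : 1 ≤ condNumber S * √8 * (p / √((n : ℝ) + 1 - p))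
  · have := Measure.isProbabilityMeasure_map (μ := ρ) hgm.aemeasurable
    have := Measure.isProbabilityMeasure_map (μ := ρ.map τ) hgm.aemeasurable
    exact tvDist_le_one.trans hbig
  rw [not_le] at hbig
  refine (tvDist_map_le hgm).trans ?_
  rcases Nat.eq_zero_or_pos p with hp | hp
  · subst hp
    have h1 : ρ = stdGaussian (EuclideanSpace ℝ (Fin (n + 1))) := map_residualVector_of_isEmpty
    have h2 : ρ.map τ = ρ := by
      rw [h1]
      exact stdGaussian_map _
    rw [h2, tvDist_self]
    exact hbound0
  · have hκ := one_le_condNumber hS hp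
    have hpn' : (p : ℝ) ≤ n := by exact_mod_cast hpn
    obtain ⟨h5, hle⟩ := residual_bound_le (m := ((n + 1 : ℕ) : ℝ)) (by exact_mod_cast hp) hκ
      (by push_cast; ring) hbig (by linarith)
    have h5' : p + 5 ≤ n + 1 := by
      have : (p : ℝ) + 5 ≤ ((n + 1 : ℕ) : ℝ) := by
        push_cast
        linarith
      exact_mod_cast this
    refine (tvDist_residual_swap_le hS hp h5' hκ hil).trans ?_
    push_cast at hle ⊢
    exact hle

/-- Absolute residuals are an image of signed residuals. -/
theorem tvDistLaw_fullCPResiduals_le (hpn : p ≤ n) (hS : S.PosDef)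
    (hX : HasGaussianCovariates P X S) (hY : IsLinearModel P X Y β σ) (i : Fin (n + 1)) :
    tvDistLaw P (fun ω => fullCPResiduals leastSquares (dataset X Y ω))
      (fun ω => fullCPResiduals leastSquares (swapData i (dataset X Y ω))) ≤
      condNumber S * √8 * (p / √((n : ℝ) + 1 - p)) := by
  refine le_trans ?_ (tvDistLaw_signedResiduals_le hpn hS hX hY i)
  have hlaw := hasLaw_signedResiduals (by omega) hS hX hY
  have hU := hlaw.aemeasurable
  have hsw : Measurable fun (v : Fin (n + 1) → ℝ) k => v (Equiv.swap i (Fin.last n) k) := by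
    fun_prop
  have hV : AEMeasurable (fun ω => signedResiduals leastSquares (swapData i (dataset X Y ω))) P := by
    simp_rw [signedResiduals_swapData]
    exact hsw.comp_aemeasurable hU
  have habs : Measurable fun (v : Fin (n + 1) → ℝ) k => |v k| := by fun_prop
  have := Measure.isProbabilityMeasure_map hU
  have := Measure.isProbabilityMeasure_map hV
  have h1 := AEMeasurable.map_map_of_aemeasurable habs.aemeasurable hU
  have h2 := AEMeasurable.map_map_of_aemeasurable habs.aemeasurable hV
  have h := tvDist_map_le (μ := P.map fun ω => signedResiduals leastSquares (dataset X Y ω))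
    (ν := P.map fun ω => signedResiduals leastSquares (swapData i (dataset X Y ω))) habs
  rw [h1, h2] at h
  exact h

end TotalVariationBound

/-! ### Autoregressive covariates -/

section Autoregressive

variable {Ω : Type*} [MeasurableSpace Ω] {P : Measure Ω} {n : ℕ}
  {X : Ω → Fin (n + 1) → Fin 1 → ℝ} {W : Fin (n + 1) → Ω → ℝ} {γ : ℝ}

/-- A linear combination of independent variables in which `W i` has coefficient zero is independent
of `W i`. -/
theorem indepFun_sum_mul {ι : Type*} [Fintype ι] {W : ι → Ω → ℝ} (hW : iIndepFun W P)
    (hm : ∀ i, AEMeasurable (W i) P) {d : ι → ℝ} {i : ι} (hd : d i = 0) :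
    IndepFun (fun ω => ∑ l, d l * W l ω) (W i) P := by
  classical
  -- all factors but number `i` are scaled, so that only `W i` itself is compared with a sum
  let φ : ι → ℝ → ℝ := fun l x => if l = i then x else d l * x
  have hφ : ∀ l, Measurable (φ l) := fun l => by
    by_cases h : l = i <;> simp only [φ, h, if_true, if_false] <;> fun_prop
  have h1 : iIndepFun (fun l => φ l ∘ W l) P := hW.comp φ hφ
  have h2 := h1.indepFun_finsetSum_of_notMem₀ (fun l => (hφ l).comp_aemeasurable (hm l))
    (Finset.notMem_erase i Finset.univ)
  convert h2 using 1
  · ext ω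
    rw [Finset.sum_apply, ← Finset.sum_erase Finset.univ (a := i) (by simp [hd])]
    refine Finset.sum_congr rfl fun l hl => ?_
    simp [φ, Finset.ne_of_mem_erase hl]
  · ext ω
    simp [φ]

theorem hasLaw_add_const_mul_of_indepFun {U V : Ω → ℝ} {u v w : ℝ≥0}
    (hU : HasLaw U (gaussianReal 0 u) P) (hV : HasLaw V (gaussianReal 0 v) P)
    (hUV : IndepFun U V P) (a : ℝ) (hw : (w : ℝ) = u + a ^ 2 * v) :
    HasLaw (fun ω => U ω + a * V ω) (gaussianReal 0 w) P := by
  have h1 := gaussianReal_const_mul hV a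
  have h2 : IndepFun U (fun ω => a * V ω) P :=
    hUV.comp (φ := id) (ψ := fun x => a * x) measurable_id (by fun_prop)
  have h3 := gaussianReal_add_gaussianReal_of_indepFun h2 hU.map_eq h1.map_eq
  refine ⟨hU.aemeasurable.add h1.aemeasurable, ?_⟩
  refine h3.trans ?_
  congr 1
  · simp
  · ext
    simp [hw]

/-- The covariate number `k` is a linear combination of the first innovations, up to number `k`. -/
theorem exists_autoregressive_eq_sum (h : ∀ᵐ ω ∂P, X ω 0 0 = W 0 ω ∧
      ∀ k : Fin n, X ω k.succ 0 = γ * X ω k.castSucc 0 + W k.succ ω) (k : Fin (n + 1)) :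
    ∃ d : Fin (n + 1) → ℝ, (∀ l, k < l → d l = 0) ∧
      ∀ᵐ ω ∂P, X ω k 0 = ∑ l, d l * W l ω := by
  induction k using Fin.induction with
  | zero =>
    refine ⟨Pi.single 0 1, fun l hl => Pi.single_eq_of_ne hl.ne' _, ?_⟩
    filter_upwards [h] with ω hω
    rw [hω.1, Fintype.sum_eq_single 0 (fun l hl => by simp [hl])]
    simp
  | succ k ih =>
    obtain ⟨d, hd, hX⟩ := ih
    refine ⟨fun l => γ * d l + (Pi.single k.succ 1 : Fin (n + 1) → ℝ) l, fun l hl => ?_, ?_⟩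
    · beta_reduce
      rw [hd l (Fin.castSucc_lt_succ.trans hl), Pi.single_eq_of_ne hl.ne']
      simp
    · filter_upwards [h, hX] with ω hω hXω
      rw [hω.2 k, hXω]
      simp only [add_mul, Finset.sum_add_distrib, Finset.mul_sum, mul_assoc]
      congr 1
      rw [Fintype.sum_eq_single k.succ (fun l hl => by simp [hl])]
      simp

theorem combination_variance_nonneg (hγ : |γ| < 1) (a b : ℝ) (m : ℕ) :
    0 ≤ a ^ 2 + b ^ 2 + 2 * a * b * γ ^ m := by
  have h1 : |γ ^ m| ≤ 1 := by
    rw [abs_pow]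
    exact pow_le_one₀ (abs_nonneg _) hγ.le
  have h2 := abs_le.1 h1
  nlinarith [sq_nonneg (a + b), sq_nonneg (a - b)]

/-- The stationary autoregressive process has unit variances and correlations `γ ^ |k - j|`. -/
theorem hasLaw_autoregressive_combination [IsProbabilityMeasure P] (hγ : |γ| < 1)
    (hind : iIndepFun W P)
    (h0 : HasLaw (W 0) (gaussianReal 0 1) P)
    (hsucc : ∀ k : Fin n, HasLaw (W k.succ) (gaussianReal 0 (Real.toNNReal (1 - γ ^ 2))) P)
    (h : ∀ᵐ ω ∂P, X ω 0 0 = W 0 ω ∧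
      ∀ k : Fin n, X ω k.succ 0 = γ * X ω k.castSucc 0 + W k.succ ω)
    (k : Fin (n + 1)) : ∀ j ≤ k, ∀ a b : ℝ, HasLaw (fun ω => a * X ω k 0 + b * X ω j 0)
      (gaussianReal 0 (Real.toNNReal (a ^ 2 + b ^ 2 + 2 * a * b * γ ^ (k.val - j.val)))) P := by
  have hγ2 : (0 : ℝ) ≤ 1 - γ ^ 2 := by
    have := (sq_lt_one_iff_abs_lt_one γ).2 hγ
    linarith
  have hm : ∀ i, AEMeasurable (W i) P := Fin.cases h0.aemeasurable fun k => (hsucc k).aemeasurable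
  induction k using Fin.induction with
  | zero =>
    intro j hj a b
    obtain rfl : j = 0 := le_antisymm hj (Fin.zero_le _)
    have h1 := gaussianReal_const_mul h0 (a + b)
    have h2 : HasLaw (fun ω => (a + b) * W 0 ω) (gaussianReal 0
        (Real.toNNReal (a ^ 2 + b ^ 2 + 2 * a * b * γ ^ (0 - 0)))) P := by
      convert h1 using 2
      · simp
      · ext
        rw [Real.coe_toNNReal _ (combination_variance_nonneg hγ a b (0 - 0))]
        simp
        ring
    refine h2.congr ?_
    filter_upwards [h] with ω hω
    rw [hω.1]
    ring
  | succ k ih =>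
    -- the case `j = k + 1` is the case `b = 0` of this one, with `a + b` in place of `a`
    have key : ∀ j ≤ k.castSucc, ∀ a b : ℝ, HasLaw (fun ω => a * X ω k.succ 0 + b * X ω j 0)
        (gaussianReal 0 (Real.toNNReal
          (a ^ 2 + b ^ 2 + 2 * a * b * γ ^ (k.succ.val - j.val)))) P := by
      intro j hj a b
      obtain ⟨d, hd, hdX⟩ := exists_autoregressive_eq_sum h k.castSucc
      obtain ⟨e, he, heX⟩ := exists_autoregressive_eq_sum h j
      have hi := indepFun_sum_mul (i := k.succ) (d := fun l => a * γ * d l + b * e l) hind hm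
        (by rw [hd _ Fin.castSucc_lt_succ, he _ (hj.trans_lt Fin.castSucc_lt_succ)]; simp)
      have hi' : IndepFun (fun ω => a * γ * X ω k.castSucc 0 + b * X ω j 0) (W k.succ) P := by
        refine hi.congr ?_ (ae_eq_refl _)
        filter_upwards [hdX, heX] with ω h1 h2
        rw [h1, h2]
        simp only [add_mul, Finset.sum_add_distrib, Finset.mul_sum, mul_assoc]
      have hsub : k.succ.val - j.val = (k.castSucc.val - j.val) + 1 := by
        have : j.val ≤ k.castSucc.val := hj
        simp only [Fin.val_succ, Fin.val_castSucc] at *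
        omega
      refine (hasLaw_add_const_mul_of_indepFun (ih j hj (a * γ) b) (hsucc k) hi' a
        (w := Real.toNNReal (a ^ 2 + b ^ 2 + 2 * a * b * γ ^ (k.succ.val - j.val))) ?_).congr ?_
      · rw [Real.coe_toNNReal _ (combination_variance_nonneg hγ _ _ _),
          Real.coe_toNNReal _ (combination_variance_nonneg hγ _ _ _),
          Real.coe_toNNReal _ hγ2, hsub]
        ring
      · filter_upwards [h] with ω hω
        rw [hω.2 k]
        ring
    intro j hj a b
    rcases hj.eq_or_lt with rfl | hj
    · have h1 := key k.castSucc le_rfl (a + b) 0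
      have h2 : (a + b) ^ 2 + 0 ^ 2 + 2 * (a + b) * 0 * γ ^ (k.succ.val - k.castSucc.val) =
          a ^ 2 + b ^ 2 + 2 * a * b * γ ^ (k.succ.val - k.succ.val) := by
        rw [Nat.sub_self]
        ring
      rw [h2] at h1
      exact h1.congr (Filter.Eventually.of_forall fun ω => by ring)
    · exact key j (Fin.le_castSucc_iff.2 hj) a b

theorem IsAutoregressive.aemeasurable (hX : IsAutoregressive P X γ) : AEMeasurable X P := by
  obtain ⟨W, hind, h0, hsucc, h⟩ := hX
  have hm : ∀ i, AEMeasurable (W i) P := Fin.cases h0.aemeasurable fun k => (hsucc k).aemeasurable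
  refine aemeasurable_pi_lambda _ fun k => aemeasurable_pi_lambda _ fun j => ?_
  obtain rfl : j = 0 := Subsingleton.elim _ _
  obtain ⟨d, -, hd⟩ := exists_autoregressive_eq_sum h k
  have h1 : AEMeasurable (fun ω => ∑ l, d l * W l ω) P :=
    Finset.aemeasurable_fun_sum _ fun l _ => (hm l).const_mul _
  exact h1.congr (hd.mono fun ω hω => hω.symm)

theorem IsLinearModel.aemeasurable {m p : ℕ} {X : Ω → Fin m → Fin p → ℝ} {Y : Ω → Fin m → ℝ}
    {β : Fin p → ℝ} {σ : ℝ≥0} (hY : IsLinearModel P X Y β σ) (hX : AEMeasurable X P) :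
    AEMeasurable Y P := by
  obtain ⟨ε, hε, -, h⟩ := hY
  have h1 : AEMeasurable (fun ω k => X ω k ⬝ᵥ β + ε ω k) P := by
    have h2 : Measurable fun q : (Fin m → Fin p → ℝ) × (Fin m → ℝ) => fun k =>
        q.1 k ⬝ᵥ β + q.2 k := by
      simp only [dotProduct]
      fun_prop
    exact h2.comp_aemeasurable (hX.prodMk hε.aemeasurable)
  exact h1.congr (h.mono fun ω hω => funext fun k => (hω k).symm)

/-- The law of `Z_i - γ Z_{i-1}` in the covariates distinguishes the original data set, where it is
an innovation, from the swapped data set, where it is `X_{n+1} - γ X_{i-1}`. -/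
theorem tvDist_gaussianReal_le_tvDistLaw_dataset [IsProbabilityMeasure P] (hγ : |γ| < 1)
    (hX : IsAutoregressive P X γ)
    {Y : Ω → Fin (n + 1) → ℝ} {β : Fin 1 → ℝ} {σ : ℝ≥0} (hY : IsLinearModel P X Y β σ)
    {i : Fin (n + 1)} (hi1 : 1 ≤ i.val) (hin : i.val < n) :
    tvDist (gaussianReal 0 (Real.toNNReal (1 - γ ^ 2)))
        (gaussianReal 0 (Real.toNNReal (1 + γ ^ 2 - 2 * γ ^ (n + 2 - i.val)))) ≤
      tvDistLaw P (dataset X Y) fun ω => swapData i (dataset X Y ω) := by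
  have hXm := hX.aemeasurable
  have hYm := hY.aemeasurable hXm
  obtain ⟨W, hind, h0, hsucc, h⟩ := hX
  obtain ⟨k, rfl⟩ : ∃ k : Fin n, i = k.succ := by
    refine ⟨⟨i.val - 1, by omega⟩, ?_⟩
    ext
    simp
    omega
  rw [Fin.val_succ] at hin
  -- the statistic reads the covariates number `i` and `i - 1` only; the latter is not exchanged
  let φ : Dataset (n + 1) 1 → ℝ := fun z => (z k.succ).1 0 - γ * (z k.castSucc).1 0
  have hφ : Measurable φ := by fun_prop
  have hZ : AEMeasurable (dataset X Y) P := by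
    have : Measurable fun q : (Fin (n + 1) → Fin 1 → ℝ) × (Fin (n + 1) → ℝ) =>
        (fun l => (q.1 l, q.2 l) : Dataset (n + 1) 1) := by fun_prop
    exact this.comp_aemeasurable (hXm.prodMk hYm)
  have hsm : Measurable fun z : Dataset (n + 1) 1 => swapData k.succ z := by
    unfold swapData
    fun_prop
  have hZ' : AEMeasurable (fun ω => swapData k.succ (dataset X Y ω)) P := hsm.comp_aemeasurable hZ
  have h1 : (P.map (dataset X Y)).map φ = gaussianReal 0 (Real.toNNReal (1 - γ ^ 2)) := by
    rw [AEMeasurable.map_map_of_aemeasurable hφ.aemeasurable hZ, ← (hsucc k).map_eq]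
    refine Measure.map_congr ?_
    filter_upwards [h] with ω hω
    simp only [Function.comp, φ, dataset, hω.2 k]
    ring
  have hlast : k.castSucc ≤ Fin.last n := Fin.le_last _
  have h2 : (P.map fun ω => swapData k.succ (dataset X Y ω)).map φ =
      gaussianReal 0 (Real.toNNReal (1 + γ ^ 2 - 2 * γ ^ (n + 2 - k.succ.val))) := by
    rw [AEMeasurable.map_map_of_aemeasurable hφ.aemeasurable hZ']
    have h3 := hasLaw_autoregressive_combination hγ hind h0 hsucc h _ _ hlast 1 (-γ)
    have h4 : (1 : ℝ) ^ 2 + (-γ) ^ 2 + 2 * 1 * -γ * γ ^ ((Fin.last n).val - k.castSucc.val) =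
        1 + γ ^ 2 - 2 * γ ^ (n + 2 - k.succ.val) := by
      have : n + 2 - k.succ.val = (Fin.last n).val - k.castSucc.val + 1 := by
        simp
        omega
      rw [this]
      ring
    rw [h4] at h3
    rw [← h3.map_eq]
    congr 1
    ext ω
    have h5 : Equiv.swap k.succ (Fin.last n) k.castSucc = k.castSucc := by
      refine Equiv.swap_apply_of_ne_of_ne Fin.castSucc_lt_succ.ne fun h => ?_
      have := congrArg Fin.val h
      simp at this
      omega
    simp only [Function.comp, φ, swapData, Equiv.swap_apply_left, h5, dataset]
    ring
  have := Measure.isProbabilityMeasure_map hZ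
  have := Measure.isProbabilityMeasure_map hZ'
  rw [← h1, ← h2]
  exact tvDist_map_le hφ

end Autoregressive

/-! ### Gaussian vectors given by a whitening matrix -/

section Whitening

open Matrix

variable {ι : Type*} [Fintype ι] [DecidableEq ι]

theorem map_toEuclideanCLM_stdGaussian (B : Matrix ι ι ℝ) :
    (stdGaussian (EuclideanSpace ℝ ι)).map (toEuclideanCLM (𝕜 := ℝ) B) =
      multivariateGaussian 0 (B * Bᴴ) := by
  have hpos : (B * Bᴴ).PosSemidef := posSemidef_self_mul_conjTranspose B
  apply IsGaussian.ext
  · simp only [id_eq, integral_id_multivariateGaussian]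
    rw [ContinuousLinearMap.integral_id_map IsGaussian.integrable_id]
    simp
  · ext x y
    rw [covarianceBilin_map IsGaussian.memLp_two_id, covarianceBilin_stdGaussian,
      covarianceBilin_multivariateGaussian hpos, innerSL_apply_apply,
      ContinuousLinearMap.adjoint_inner_left, ← inner_toEuclideanCLM, map_mul,
      ← star_eq_conjTranspose, map_star]
    rfl

/-- A random vector that `A` turns into white noise is Gaussian with covariance `(A† A)⁻¹`. -/
theorem hasLaw_multivariateGaussian_of_whitening {Ω : Type*} [MeasurableSpace Ω] {P : Measure Ω}
    {A : Matrix ι ι ℝ} (hA : IsUnit A.det) {ξ : Ω → ι → ℝ}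
    (hξ : HasLaw (fun ω => A *ᵥ ξ ω) (Measure.pi fun _ => gaussianReal 0 1) P) :
    HasLaw (fun ω => (WithLp.toLp 2 (ξ ω) : EuclideanSpace ℝ ι))
      (multivariateGaussian 0 (Aᴴ * A)⁻¹) P := by
  have h1 : HasLaw (fun ω => (WithLp.toLp 2 (A *ᵥ ξ ω) : EuclideanSpace ℝ ι))
      (stdGaussian (EuclideanSpace ℝ ι)) P :=
    HasLaw.comp (X := fun ω => A *ᵥ ξ ω) (Y := WithLp.toLp 2)
      ⟨by fun_prop, map_pi_eq_stdGaussian⟩ hξ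
  have h2 : (Aᴴ * A)⁻¹ = A⁻¹ * (A⁻¹)ᴴ := by
    rw [Matrix.mul_inv_rev, conjTranspose_nonsing_inv]
  rw [h2]
  refine (HasLaw.comp (Y := toEuclideanCLM (𝕜 := ℝ) A⁻¹)
    ⟨by fun_prop, map_toEuclideanCLM_stdGaussian A⁻¹⟩ h1).congr ?_
  refine Filter.Eventually.of_forall fun ω => ?_
  simp [Matrix.nonsing_inv_mul _ hA]

open scoped Matrix.Norms.L2Operator in
theorem norm_sq_le_of_sum_sq_mulVec_le {A : Matrix ι ι ℝ} {a : ℝ} (ha : 0 ≤ a)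
    (h : ∀ x : ι → ℝ, ∑ i, (A *ᵥ x) i ^ 2 ≤ a * ∑ i, x i ^ 2) : ‖A‖ ^ 2 ≤ a := by
  have h1 : ‖A‖ ≤ √a := by
    rw [cstar_norm_def]
    refine ContinuousLinearMap.opNorm_le_bound _ (Real.sqrt_nonneg _) fun x => ?_
    rw [EuclideanSpace.norm_eq, EuclideanSpace.norm_eq, ← Real.sqrt_mul ha]
    refine Real.sqrt_le_sqrt ?_
    simpa using h x.ofLp
  calc ‖A‖ ^ 2 ≤ √a ^ 2 := by gcongr
    _ = a := Real.sq_sqrt ha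

theorem isUnit_det_of_sum_sq_le {A : Matrix ι ι ℝ} {b : ℝ}
    (h : ∀ x : ι → ℝ, ∑ i, x i ^ 2 ≤ b * ∑ i, (A *ᵥ x) i ^ 2) : IsUnit A.det := by
  rw [← isUnit_iff_isUnit_det, ← mulVec_injective_iff_isUnit]
  refine (injective_iff_map_eq_zero (Matrix.mulVecLin A)).2 fun x hx => ?_
  have h1 := h x
  rw [show A *ᵥ x = 0 from hx] at h1
  have h2 : ∑ i, x i ^ 2 = 0 :=
    le_antisymm (by simpa using h1) (Finset.sum_nonneg fun i _ => sq_nonneg _)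
  ext i
  have h3 := (Finset.sum_eq_zero_iff_of_nonneg fun i _ => sq_nonneg (x i)).1 h2 i
    (Finset.mem_univ i)
  simpa using h3

open scoped Matrix.Norms.L2Operator in
/-- If `‖A‖² ≤ a` and `‖A⁻¹‖² ≤ b`, the covariance `(A† A)⁻¹` has condition number at most `b * a`. -/
theorem condNumber_whitening_le {A : Matrix ι ι ℝ} {a b : ℝ} (ha : 0 ≤ a) (hb : 0 ≤ b)
    (h1 : ∀ x : ι → ℝ, ∑ i, (A *ᵥ x) i ^ 2 ≤ a * ∑ i, x i ^ 2)
    (h2 : ∀ x : ι → ℝ, ∑ i, x i ^ 2 ≤ b * ∑ i, (A *ᵥ x) i ^ 2) :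
    condNumber (Aᴴ * A)⁻¹ ≤ b * a := by
  have hdet := isUnit_det_of_sum_sq_le h2
  have hdet' : IsUnit (Aᴴ * A).det := by
    rw [det_mul, det_conjTranspose]
    exact hdet.star.mul hdet
  have h3 : ‖A‖ ^ 2 ≤ a := norm_sq_le_of_sum_sq_mulVec_le ha h1
  have h4 : ‖A⁻¹‖ ^ 2 ≤ b := by
    refine norm_sq_le_of_sum_sq_mulVec_le hb fun x => ?_
    have := h2 (A⁻¹ *ᵥ x)
    rwa [mulVec_mulVec, mul_nonsing_inv _ hdet, one_mulVec] at this
  rw [condNumber, nonsing_inv_nonsing_inv _ hdet', Matrix.mul_inv_rev,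
    ← conjTranspose_nonsing_inv, l2_opNorm_conjTranspose_mul_self, ← pow_two]
  calc ‖A⁻¹ * (A⁻¹)ᴴ‖ * ‖A‖ ^ 2 ≤ ‖A⁻¹‖ ^ 2 * ‖A‖ ^ 2 := by
        gcongr
        refine (norm_mul_le _ _).trans (le_of_eq ?_)
        rw [l2_opNorm_conjTranspose, pow_two]
    _ ≤ b * a := by gcongr

end Whitening

/-! ### Condition number in the autoregressive model -/

section AutoregressiveCovariance

open Matrix

variable {n : ℕ} {γ : ℝ}

/-- The linear map taking a path of the autoregressive process to its starting point and its
innovations, normalised to unit variance. -/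
noncomputable def innovationMap (n : ℕ) (γ : ℝ) :
    (Fin 1 × Fin (n + 1) → ℝ) →ₗ[ℝ] (Fin 1 × Fin (n + 1) → ℝ) where
  toFun x jk := Fin.cases (x (jk.1, 0))
    (fun k => (√(1 - γ ^ 2))⁻¹ * (x (jk.1, k.succ) - γ * x (jk.1, k.castSucc))) jk.2
  map_add' x y := by
    ext ⟨j, k⟩
    refine Fin.cases ?_ (fun k => ?_) k
    · simp
    · simp only [Fin.cases_succ, Pi.add_apply]
      ring
  map_smul' c x := by
    ext ⟨j, k⟩
    refine Fin.cases ?_ (fun k => ?_) k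
    · simp
    · simp only [Fin.cases_succ, Pi.smul_apply, smul_eq_mul, RingHom.id_apply]
      ring

/-- The matrix of `innovationMap`. -/
noncomputable def innovationMatrix (n : ℕ) (γ : ℝ) :
    Matrix (Fin 1 × Fin (n + 1)) (Fin 1 × Fin (n + 1)) ℝ :=
  LinearMap.toMatrix' (innovationMap n γ)

theorem innovationMatrix_mulVec (x : Fin 1 × Fin (n + 1) → ℝ) :
    innovationMatrix n γ *ᵥ x = innovationMap n γ x := by
  rw [innovationMatrix, LinearMap.toMatrix'_mulVec]

theorem sum_fin_one_prod (f : Fin 1 × Fin (n + 1) → ℝ) : ∑ i, f i = ∑ k, f (0, k) := by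
  rw [Fintype.sum_prod_type, Fin.sum_univ_one]

theorem sum_sq_innovationMap (hγ : |γ| < 1) (x : Fin 1 × Fin (n + 1) → ℝ) :
    ∑ i, innovationMap n γ x i ^ 2 =
      x (0, 0) ^ 2 + (1 - γ ^ 2)⁻¹ * ∑ k : Fin n, (x (0, k.succ) - γ * x (0, k.castSucc)) ^ 2 := by
  have hγ2 : (0 : ℝ) ≤ 1 - γ ^ 2 := by
    have := (sq_lt_one_iff_abs_lt_one γ).2 hγ
    linarith
  rw [sum_fin_one_prod, Fin.sum_univ_succ, Finset.mul_sum]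
  simp only [innovationMap, LinearMap.coe_mk, AddHom.coe_mk, Fin.cases_zero, Fin.cases_succ,
    mul_pow, inv_pow, Real.sq_sqrt hγ2]

/-- Upper bound for the squared operator norm of `innovationMap`, from
`(a - γ b)² ≤ (1 + |γ|) (a² + |γ| b²)`. -/
theorem sum_sq_innovationMap_le (hγ : |γ| < 1) (x : Fin 1 × Fin (n + 1) → ℝ) :
    ∑ i, innovationMap n γ x i ^ 2 ≤ (1 - γ ^ 2)⁻¹ * (1 + |γ|) ^ 2 * ∑ i, x i ^ 2 := by
  have hγ2 : (0 : ℝ) < 1 - γ ^ 2 := by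
    have := (sq_lt_one_iff_abs_lt_one γ).2 hγ
    linarith
  have h1 : ∀ a b : ℝ, (a - γ * b) ^ 2 ≤ (1 + |γ|) * a ^ 2 + (1 + |γ|) * |γ| * b ^ 2 := by
    intro a b
    have h3 : -(2 * (γ * (a * b))) ≤ |γ| * (a ^ 2 + b ^ 2) := by
      rcases abs_cases γ with ⟨h, h'⟩ | ⟨h, h'⟩ <;> rw [h] <;>
        nlinarith [sq_nonneg (a + b), sq_nonneg (a - b)]
    nlinarith [sq_abs γ, mul_nonneg (abs_nonneg γ) (sq_nonneg b)]
  rw [sum_sq_innovationMap hγ, sum_fin_one_prod]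
  have h4 : ∑ k : Fin n, (x (0, k.succ) - γ * x (0, k.castSucc)) ^ 2 ≤
      (1 + |γ|) * ∑ k : Fin n, x (0, k.succ) ^ 2 +
        (1 + |γ|) * |γ| * ∑ k : Fin n, x (0, k.castSucc) ^ 2 := by
    rw [Finset.mul_sum, Finset.mul_sum, ← Finset.sum_add_distrib]
    exact Finset.sum_le_sum fun k _ => h1 _ _
  have h5 := Fin.sum_univ_succ fun k : Fin (n + 1) => x (0, k) ^ 2
  have h6 := Fin.sum_univ_castSucc fun k : Fin (n + 1) => x (0, k) ^ 2
  set s := ∑ k : Fin (n + 1), x (0, k) ^ 2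
  have h7 : ∑ k : Fin n, x (0, k.castSucc) ^ 2 ≤ s := by
    rw [h6]
    linarith [sq_nonneg (x (0, Fin.last n))]
  have h8 : (1 + |γ|) * |γ| * ∑ k : Fin n, x (0, k.castSucc) ^ 2 ≤ (1 + |γ|) * |γ| * s := by
    gcongr
  have h9 : x (0, 0) ^ 2 ≤ (1 - γ ^ 2)⁻¹ * ((1 + |γ|) * x (0, 0) ^ 2) := by
    rw [← mul_assoc]
    refine le_mul_of_one_le_left (sq_nonneg _) ?_
    rw [inv_mul_eq_div, le_div_iff₀ hγ2]
    nlinarith [abs_nonneg γ, sq_nonneg γ]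
  calc _ ≤ (1 - γ ^ 2)⁻¹ * ((1 + |γ|) * x (0, 0) ^ 2) + (1 - γ ^ 2)⁻¹ *
        ((1 + |γ|) * ∑ k : Fin n, x (0, k.succ) ^ 2 + (1 + |γ|) * |γ| * s) := by
        gcongr
        exact h4.trans (by linarith)
    _ = (1 - γ ^ 2)⁻¹ * ((1 + |γ|) * (x (0, 0) ^ 2 + ∑ k : Fin n, x (0, k.succ) ^ 2) +
          (1 + |γ|) * |γ| * s) := by ring
    _ = _ := by
        rw [← h5]
        ring

/-- Upper bound for the squared operator norm of the inverse of `innovationMap`. -/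
theorem sum_sq_le_sum_sq_innovationMap (hγ : |γ| < 1) (x : Fin 1 × Fin (n + 1) → ℝ) :
    ∑ i, x i ^ 2 ≤ ((1 - |γ|) ^ 2)⁻¹ * ∑ i, innovationMap n γ x i ^ 2 := by
  have hγ2 : (0 : ℝ) < 1 - γ ^ 2 := by
    have := (sq_lt_one_iff_abs_lt_one γ).2 hγ
    linarith
  have hγ1 : 0 < 1 - |γ| := by linarith
  -- convexity of the square: `a = γ b + (a - γ b)` is a convex combination, with weights `|γ|` and
  -- `1 - |γ|`, of `± b` and `(a - γ b) / (1 - |γ|)`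
  have h1 : ∀ a b : ℝ, (1 - |γ|) * a ^ 2 ≤ (1 - |γ|) * |γ| * b ^ 2 + (a - γ * b) ^ 2 := by
    intro a b
    have h3 : (1 - |γ|) * |γ| * b ^ 2 + (a - γ * b) ^ 2 - (1 - |γ|) * a ^ 2 =
        |γ| * (a ^ 2 + b ^ 2) - 2 * (γ * (a * b)) := by
      linear_combination -b ^ 2 * sq_abs γ
    have h4 : 2 * (γ * (a * b)) ≤ |γ| * (a ^ 2 + b ^ 2) := by
      rcases abs_cases γ with ⟨h, h'⟩ | ⟨h, h'⟩ <;> rw [h] <;>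
        nlinarith [sq_nonneg (a + b), sq_nonneg (a - b)]
    linarith
  rw [sum_sq_innovationMap hγ, sum_fin_one_prod, inv_mul_eq_div, le_div_iff₀ (by positivity)]
  have h5 := Fin.sum_univ_succ fun k : Fin (n + 1) => x (0, k) ^ 2
  have h6 := Fin.sum_univ_castSucc fun k : Fin (n + 1) => x (0, k) ^ 2
  set s := ∑ k : Fin (n + 1), x (0, k) ^ 2
  set t := ∑ k : Fin n, (x (0, k.succ) - γ * x (0, k.castSucc)) ^ 2 with ht
  have h7 : ∑ k : Fin n, x (0, k.castSucc) ^ 2 ≤ s := by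
    rw [h6]
    linarith [sq_nonneg (x (0, Fin.last n))]
  have h8 : (1 - |γ|) * ∑ k : Fin n, x (0, k.succ) ^ 2 ≤ (1 - |γ|) * |γ| * s + t := by
    calc _ ≤ (1 - |γ|) * |γ| * ∑ k : Fin n, x (0, k.castSucc) ^ 2 + t := by
          rw [ht, Finset.mul_sum, Finset.mul_sum, ← Finset.sum_add_distrib]
          exact Finset.sum_le_sum fun k _ => h1 _ _
      _ ≤ _ := by gcongr
  have ht0 : 0 ≤ t := Finset.sum_nonneg fun k _ => sq_nonneg _
  have h9 : t ≤ (1 - γ ^ 2)⁻¹ * t := by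
    refine le_mul_of_one_le_left ht0 ((one_le_inv₀ hγ2).2 ?_)
    linarith [sq_nonneg γ]
  have h10 : (1 - |γ|) * x (0, 0) ^ 2 ≤ x (0, 0) ^ 2 := by
    nlinarith [abs_nonneg γ, sq_nonneg (x (0, 0))]
  have h11 : (1 - |γ|) * s = (1 - |γ|) * x (0, 0) ^ 2 +
      (1 - |γ|) * ∑ k : Fin n, x (0, k.succ) ^ 2 := by
    rw [h5]
    ring
  nlinarith

/-- The autoregressive covariates are Gaussian covariates whose covariance matrix has
a condition number bounded in terms of `γ` only. -/
theorem IsAutoregressive.exists_hasGaussianCovariates {Ω : Type*} [MeasurableSpace Ω]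
    {P : Measure Ω} {X : Ω → Fin (n + 1) → Fin 1 → ℝ} (hγ : |γ| < 1)
    (hX : IsAutoregressive P X γ) :
    ∃ S : Matrix (Fin 1 × Fin (n + 1)) (Fin 1 × Fin (n + 1)) ℝ, S.PosDef ∧
      HasGaussianCovariates P X S ∧
      condNumber S ≤ ((1 - |γ|) ^ 2)⁻¹ * ((1 - γ ^ 2)⁻¹ * (1 + |γ|) ^ 2) := by
  have hγ2 : (0 : ℝ) < 1 - γ ^ 2 := by
    have := (sq_lt_one_iff_abs_lt_one γ).2 hγ
    linarith
  obtain ⟨W, hind, h0, hsucc, h⟩ := hX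
  set A := innovationMatrix n γ with hA
  have h1 : ∀ x : Fin 1 × Fin (n + 1) → ℝ,
      ∑ i, (A *ᵥ x) i ^ 2 ≤ (1 - γ ^ 2)⁻¹ * (1 + |γ|) ^ 2 * ∑ i, x i ^ 2 := fun x => by
    rw [hA, innovationMatrix_mulVec]
    exact sum_sq_innovationMap_le hγ x
  have h2 : ∀ x : Fin 1 × Fin (n + 1) → ℝ,
      ∑ i, x i ^ 2 ≤ ((1 - |γ|) ^ 2)⁻¹ * ∑ i, (A *ᵥ x) i ^ 2 := fun x => by
    rw [hA, innovationMatrix_mulVec]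
    exact sum_sq_le_sum_sq_innovationMap hγ x
  have hdet := isUnit_det_of_sum_sq_le h2
  refine ⟨(Aᴴ * A)⁻¹, (PosDef.conjTranspose_mul_self A ?_).inv, ?_,
    condNumber_whitening_le (by positivity) (by positivity) h1 h2⟩
  · rwa [mulVec_injective_iff_isUnit, isUnit_iff_isUnit_det]
  · refine hasLaw_multivariateGaussian_of_whitening hdet ?_
    -- `c k` normalises the innovation `W k` to unit variance
    let c : Fin (n + 1) → ℝ := Fin.cases 1 fun _ => (√(1 - γ ^ 2))⁻¹
    have hlaw : ∀ k, HasLaw (fun ω => c k * W k ω) (gaussianReal 0 1) P := by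
      intro k
      refine Fin.cases ?_ (fun k => ?_) k
      · simpa [c] using h0
      · have h3 := gaussianReal_const_mul (hsucc k) (c k.succ)
        convert h3 using 2
        · simp
        · ext
          simp only [c, Fin.cases_succ, NNReal.coe_mul, NNReal.coe_mk, inv_pow,
            Real.sq_sqrt hγ2.le, Real.coe_toNNReal _ hγ2.le, NNReal.coe_one]
          rw [inv_mul_cancel₀ hγ2.ne']
    have hind' : iIndepFun (fun k ω => c k * W k ω) P :=
      hind.comp (fun k x => c k * x) fun k => by fun_prop
    have hsnd : Function.Injective fun i : Fin 1 × Fin (n + 1) => i.2 := fun i j hij =>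
      Prod.ext (Subsingleton.elim _ _) hij
    refine (iIndepFun.hasLaw_pi (fun i => hlaw i.2) (hind'.precomp hsnd)).congr ?_
    filter_upwards [h] with ω hω
    have hvec : ∀ k, Matrix.vec (Matrix.of (X ω)) (0, k) = X ω k 0 := fun _ => rfl
    rw [hA, innovationMatrix_mulVec]
    generalize Matrix.vec (Matrix.of (X ω)) = x at hvec ⊢
    ext ⟨j, k⟩
    obtain rfl : j = 0 := Subsingleton.elim _ _
    refine Fin.cases ?_ (fun k => ?_) k
    · simp [innovationMap, c, hvec, hω.1]
    · simp [innovationMap, c, hvec, hω.2 k]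

/-- For autoregressive covariates the residual bound is of order `n ^ (-1/2)`. -/
theorem tvDistLaw_residuals_autoregressive_le {Ω : Type*} [MeasurableSpace Ω] {P : Measure Ω}
    [IsProbabilityMeasure P] {X : Ω → Fin (n + 1) → Fin 1 → ℝ} (hγ : |γ| < 1)
    (hX : IsAutoregressive P X γ) {Y : Ω → Fin (n + 1) → ℝ} {β : Fin 1 → ℝ} {σ : ℝ≥0}
    (hY : IsLinearModel P X Y β σ) (hn : 1 ≤ n) (i : Fin (n + 1)) :
    tvDistLaw P (fun ω => signedResiduals leastSquares (dataset X Y ω))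
        (fun ω => signedResiduals leastSquares (swapData i (dataset X Y ω))) ≤
      ((1 - |γ|) ^ 2)⁻¹ * ((1 - γ ^ 2)⁻¹ * (1 + |γ|) ^ 2) * √8 / √(n : ℝ) ∧
    tvDistLaw P (fun ω => fullCPResiduals leastSquares (dataset X Y ω))
        (fun ω => fullCPResiduals leastSquares (swapData i (dataset X Y ω))) ≤
      ((1 - |γ|) ^ 2)⁻¹ * ((1 - γ ^ 2)⁻¹ * (1 + |γ|) ^ 2) * √8 / √(n : ℝ) := by
  obtain ⟨S, hS, hXS, hcond⟩ := hX.exists_hasGaussianCovariates hγ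
  have h1 := tvDistLaw_signedResiduals_le hn hS hXS hY i
  have h2 := tvDistLaw_fullCPResiduals_le hn hS hXS hY i
  have h3 : condNumber S * √8 * ((1 : ℕ) / √((n : ℝ) + 1 - (1 : ℕ))) ≤
      ((1 - |γ|) ^ 2)⁻¹ * ((1 - γ ^ 2)⁻¹ * (1 + |γ|) ^ 2) * √8 / √(n : ℝ) := by
    rw [Nat.cast_one, add_sub_cancel_right, mul_one_div]
    gcongr
  exact ⟨h1.trans h3, h2.trans h3⟩

end AutoregressiveCovariance

/-! ### Total variation distance of centred Gaussians on the line -/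

section ScalarGaussians

/-- The standard normal density is at least its value at `1` on `(ρ, 1]`. -/
theorem ofReal_mul_le_gaussianReal_Ioc {ρ : ℝ} (hρ : 0 ≤ ρ) :
    ENNReal.ofReal (gaussianPDFReal 0 1 1 * (1 - ρ)) ≤ gaussianReal 0 1 (Set.Ioc ρ 1) := by
  rw [gaussianReal_apply 0 one_ne_zero, ENNReal.ofReal_mul (gaussianPDFReal_nonneg 0 1 1),
    ← Real.volume_Ioc, ← setLIntegral_const]
  refine setLIntegral_mono (measurable_gaussianPDF 0 1) fun x hx => ?_
  refine ENNReal.ofReal_le_ofReal ?_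
  simp only [gaussianPDFReal]
  gcongr <;> nlinarith [hx.1, hx.2]

/-- The mass of `(0, √v]` separates two centred Gaussians. -/
theorem mul_le_tvDist_gaussianReal {v w : ℝ≥0} (hv : v ≠ 0) {g : ℝ} (hg0 : 0 ≤ g) (hg1 : g ≤ 1)
    (hvw : (1 + g) * v ≤ w) :
    gaussianPDFReal 0 1 1 / 4 * g ≤ tvDist (gaussianReal 0 v) (gaussianReal 0 w) := by
  have hscale : ∀ u : ℝ≥0, gaussianReal 0 u = (gaussianReal 0 1).map fun x => √(u : ℝ) * x := by
    intro u
    rw [gaussianReal_map_const_mul]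
    congr 1
    · simp
    · ext
      simp
  have hv0 : 0 < √(v : ℝ) := Real.sqrt_pos.2 (by positivity)
  have hv' : (0 : ℝ) < v := by positivity
  have hw' : (0 : ℝ) < w := lt_of_lt_of_le (by positivity) hvw
  have hw0 : 0 < √(w : ℝ) := Real.sqrt_pos.2 hw'
  have hIoc : ∀ u : ℝ≥0, 0 < √(u : ℝ) →
      (gaussianReal 0 u).real (Set.Ioc 0 √(v : ℝ)) =
        (gaussianReal 0 1).real (Set.Ioc 0 (√(v : ℝ) / √(u : ℝ))) := by
    intro u hu
    rw [hscale u, map_measureReal_apply (by fun_prop) measurableSet_Ioc]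
    congr 1
    ext x
    simp only [Set.mem_preimage, Set.mem_Ioc, mul_pos_iff_of_pos_left hu, le_div_iff₀ hu]
    rw [mul_comm]
  set ρ := √(v : ℝ) / √(w : ℝ) with hρ
  have hρ0 : 0 ≤ ρ := by positivity
  have hρ1 : ρ ≤ 1 - g / 4 := by
    refine abs_le_of_sq_le_sq' ?_ (by linarith) |>.2
    rw [hρ, div_pow, Real.sq_sqrt hv'.le, Real.sq_sqrt hw'.le, div_le_iff₀ hw']
    have h1 : 1 ≤ (1 - g / 4) ^ 2 * (1 + g) := by
      nlinarith [mul_nonneg hg0 (sub_nonneg.2 hg1), pow_nonneg hg0 3, pow_nonneg hg0 2]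
    calc (v : ℝ) ≤ (1 - g / 4) ^ 2 * (1 + g) * v := le_mul_of_one_le_left hv'.le h1
      _ = (1 - g / 4) ^ 2 * ((1 + g) * v) := by ring
      _ ≤ _ := by gcongr
  have h1 := abs_measureReal_sub_le_tvDist (μ := gaussianReal 0 v) (ν := gaussianReal 0 w)
    (measurableSet_Ioc (a := 0) (b := √(v : ℝ)))
  rw [hIoc v hv0, hIoc w hw0, div_self hv0.ne', ← hρ] at h1
  have h2 : (gaussianReal 0 1).real (Set.Ioc 0 1) =
      (gaussianReal 0 1).real (Set.Ioc 0 ρ) + (gaussianReal 0 1).real (Set.Ioc ρ 1) := by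
    rw [← Set.Ioc_union_Ioc_eq_Ioc hρ0 (by linarith),
      measureReal_union (Set.Ioc_disjoint_Ioc_of_le le_rfl) measurableSet_Ioc]
  have h3 : gaussianPDFReal 0 1 1 * (1 - ρ) ≤ (gaussianReal 0 1).real (Set.Ioc ρ 1) :=
    (ENNReal.ofReal_le_iff_le_toReal (by finiteness)).1 (ofReal_mul_le_gaussianReal_Ioc hρ0)
  have h4 : gaussianPDFReal 0 1 1 / 4 * g ≤ gaussianPDFReal 0 1 1 * (1 - ρ) := by
    have := gaussianPDFReal_nonneg 0 1 1
    nlinarith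
  linarith [le_abs_self ((gaussianReal 0 1).real (Set.Ioc 0 1) -
    (gaussianReal 0 1).real (Set.Ioc 0 ρ))]

/-- For `e ≥ 3` the variance `1 + γ² - 2 γ ^ e` exceeds `1 - γ²` at least by the factor `1 + γ²`. -/
theorem mul_sq_le_tvDist_innovation {γ : ℝ} (hγ : |γ| < 1) {e : ℕ} (he : 3 ≤ e) :
    gaussianPDFReal 0 1 1 / 4 * γ ^ 2 ≤
      tvDist (gaussianReal 0 (Real.toNNReal (1 - γ ^ 2)))
        (gaussianReal 0 (Real.toNNReal (1 + γ ^ 2 - 2 * γ ^ e))) := by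
  have hγ2 : γ ^ 2 < 1 := (sq_lt_one_iff_abs_lt_one γ).2 hγ
  have h1 : γ ^ e ≤ |γ| ^ 3 := calc
    γ ^ e ≤ |γ ^ e| := le_abs_self _
    _ = |γ| ^ e := abs_pow γ e
    _ ≤ |γ| ^ 3 := pow_le_pow_of_le_one (abs_nonneg _) hγ.le he
  have h2 : 2 * |γ| ^ 3 ≤ γ ^ 2 + (γ ^ 2) ^ 2 := by
    rw [← sq_abs γ]
    nlinarith [sq_nonneg (|γ| * (1 - |γ|))]
  refine mul_le_tvDist_gaussianReal (Real.toNNReal_pos.2 (by linarith)).ne' (sq_nonneg γ) hγ2.le ?_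
  rw [Real.coe_toNNReal _ (by linarith)]
  refine le_trans ?_ (Real.le_coe_toNNReal _)
  nlinarith

end ScalarGaussians

end FullCP

/-- First part: the total variation bound for the least squares residuals (signed residuals and
absolute residuals), for every `i ∈ {1, …, n+1}`.  Second part: in the autoregressive model with
`p = 1`, the distance between the data sets is at least `c γ²` while the distance between the
residual vectors is at most `C_γ / √n`.  (The index `i : Fin (n + 1)` counts from `0`, so that the
point number `j` is `i = j - 1` and `n + 3 - j = n + 2 - i`.) -/
theorem mainTheorem8 :
    (∀ (n p : ℕ) (_ : p ≤ n)
        (Ω : Type u) (_ : MeasurableSpace Ω) (P : Measure Ω) (_ : IsProbabilityMeasure P)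
        (S : Matrix (Fin p × Fin (n + 1)) (Fin p × Fin (n + 1)) ℝ) (_ : S.PosDef)
        (β : Fin p → ℝ) (σ : ℝ≥0)
        (X : Ω → Fin (n + 1) → Fin p → ℝ) (Y : Ω → Fin (n + 1) → ℝ)
        (_ : FullCP.HasGaussianCovariates P X S) (_ : FullCP.IsLinearModel P X Y β σ)
        (i : Fin (n + 1)),
      FullCP.tvDistLaw P
          (fun ω => FullCP.signedResiduals FullCP.leastSquares (FullCP.dataset X Y ω))
          (fun ω => FullCP.signedResiduals FullCP.leastSquares
            (FullCP.swapData i (FullCP.dataset X Y ω)))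
        ≤ FullCP.condNumber S * √8 * (p / √((n : ℝ) + 1 - p)) ∧
      FullCP.tvDistLaw P
          (fun ω => FullCP.fullCPResiduals FullCP.leastSquares (FullCP.dataset X Y ω))
          (fun ω => FullCP.fullCPResiduals FullCP.leastSquares
            (FullCP.swapData i (FullCP.dataset X Y ω)))
        ≤ FullCP.condNumber S * √8 * (p / √((n : ℝ) + 1 - p))) ∧
    (∃ c : ℝ, 0 < c ∧ ∀ γ : ℝ, |γ| < 1 → ∃ C : ℝ,
      ∀ (n : ℕ)
        (Ω : Type u) (_ : MeasurableSpace Ω) (P : Measure Ω) (_ : IsProbabilityMeasure P)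
        (β : Fin 1 → ℝ) (σ : ℝ≥0)
        (X : Ω → Fin (n + 1) → Fin 1 → ℝ) (Y : Ω → Fin (n + 1) → ℝ)
        (_ : FullCP.IsAutoregressive P X γ) (_ : FullCP.IsLinearModel P X Y β σ)
        (i : Fin (n + 1)) (_ : 1 ≤ i.val) (_ : i.val < n),
      FullCP.tvDist (gaussianReal 0 (Real.toNNReal (1 - γ ^ 2)))
            (gaussianReal 0 (Real.toNNReal (1 + γ ^ 2 - 2 * γ ^ (n + 2 - i.val))))
          ≤ FullCP.tvDistLaw P (FullCP.dataset X Y)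
              (fun ω => FullCP.swapData i (FullCP.dataset X Y ω)) ∧
      c * γ ^ 2 ≤ FullCP.tvDist (gaussianReal 0 (Real.toNNReal (1 - γ ^ 2)))
            (gaussianReal 0 (Real.toNNReal (1 + γ ^ 2 - 2 * γ ^ (n + 2 - i.val)))) ∧
      FullCP.tvDistLaw P
          (fun ω => FullCP.signedResiduals FullCP.leastSquares (FullCP.dataset X Y ω))
          (fun ω => FullCP.signedResiduals FullCP.leastSquares
            (FullCP.swapData i (FullCP.dataset X Y ω)))
        ≤ C / √(n : ℝ) ∧
      FullCP.tvDistLaw P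
          (fun ω => FullCP.fullCPResiduals FullCP.leastSquares (FullCP.dataset X Y ω))
          (fun ω => FullCP.fullCPResiduals FullCP.leastSquares
            (FullCP.swapData i (FullCP.dataset X Y ω)))
        ≤ C / √(n : ℝ)) := by
  refine ⟨?_, gaussianPDFReal 0 1 1 / 4, by
    have := gaussianPDFReal_pos 0 1 1 one_ne_zero
    positivity, fun γ hγ =>
    ⟨((1 - |γ|) ^ 2)⁻¹ * ((1 - γ ^ 2)⁻¹ * (1 + |γ|) ^ 2) * √8, ?_⟩⟩
  · intro n p hpn Ω _ P _ S hS β σ X Y hX hY i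
    exact ⟨FullCP.tvDistLaw_signedResiduals_le hpn hS hX hY i,
      FullCP.tvDistLaw_fullCPResiduals_le hpn hS hX hY i⟩
  · intro n Ω _ P _ β σ X Y hX hY i hi1 hin
    obtain ⟨h1, h2⟩ := FullCP.tvDistLaw_residuals_autoregressive_le hγ hX hY (by omega) i
    exact ⟨FullCP.tvDist_gaussianReal_le_tvDistLaw_dataset hγ hX hY hi1 hin,
      FullCP.mul_sq_le_tvDist_innovation hγ (by omega), h1, h2⟩
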